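/- **Setting.** Let $p>2$ be a prime, $F$ a finite unramified extension of $\mathbb{Q}_p$ with residue field of cardinality $q$, $\pi$ a uniformizer of $F$, and $E/F$ the unramified quadratic extension with nontrivial automorphism $z\mapsto z^*$; let $O_F$, $O_E$ be the rings of integers. Let $\psi:F\to\mathbb{C}^\times$ be an additive character with values of absolute value $1$ which is trivial on $O_F$ but not on $\pi^{-1}O_F$. For a square matrix $A$ put $A[X]={}^tX^*AX$ and $A^{[r]}=\mathrm{diag}(A,1_{2r})$ for integers $r\ge 0$. Let $V_m(E)$ be the space of hermitian $m\times m$ matrices (${}^tY^*=Y$), $X_m(E)=V_m(E)\cap GL_m(E)$, and $V_m(O_E)=V_m(E)\cap M_{m,m}(O_E)$. Fix $n\ge 0$. **Representation densities.** For a hermitian $m\times m$ matrix $A$ over $O_E$ and $B\in X_k(E)$ let $$\alpha(A,B)=\lim_{d\to\infty}(q^{-d})^{k(2m-k)}\,\bigl|\{x\in M_{m,k}(O_E/\pi^dO_E): A[x]\equiv B \bmod \pi^d\}\bigr|$$ (the set is empty if $B$ is not integral). If $\alpha(A^{[r]},B)$ is a polynomial in $x=(-q)^{-2r}$, let $\alpha'(A,B)=-\frac{d}{dx}\alpha(A^{[r]},B)\big|_{x=1}$.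 **The functions $W_{h,t}$.** For $0\le t\le n$ let $A_t=\mathrm{diag}(1_{2n-t},\pi^{-1}1_t)$. For $0\le h\le 2n$ let $1_{h,t}^{[r]}$ be the characteristic function of the set of $X\in M_{2n+2r,2n}(O_E)$ whose block in rows $2n-t+1,\dots,2n$ and columns $1,\dots,2n-h$ has entries in $\pi O_E$. For $B\in X_{2n}(E)$ put $$W_{h,t}(B,r)=\int_{V_{2n}(E)}\int_{M_{2n+2r,2n}(E)}\psi\bigl(\mathrm{Tr}(Y(A_t^{[r]}[X]-B))\bigr)\,1^{[r]}_{h,t}(X)\,dX\,dY ,$$ with the Haar measures that give $M_{2n+2r,2n}(O_E)$ and $V_{2n}(O_E)$ volume $1$, the outer integral being the limit as $d\to\infty$ of the integrals over $Y\in\pi^{-d}V_{2n}(O_E)$. If $W_{h,t}(B,r)$ is a polynomial in $x=(-q)^{-2r}$, put $W'_{h,t}(B,0)=-\frac{d}{dx}W_{h,t}(B,r)\big|_{x=1}$. **The constants $\beta_i^h$.** For $X=\begin{pmatrix}A&B\\C&D\end{pmatrix}\in X_{2n}(E)$ with $A$ of size $2n-h$ and $D$ of size $h$, let $X^{\vee_h}=\begin{pmatrix}\pi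 D&C\\B&\pi^{-1}A\end{pmatrix}$. Let $\beta_0^h,\dots,\beta_{n-1}^h,\beta_0^{2n-h},\dots,\beta_{n-1}^{2n-h},\delta_h$ be the (unique) constants such that for all $B\in X_{2n}(E)$ $$W'_{h,n}(B,0)-W'_{2n-h,n}(B^{\vee_h},0)=\sum_{i=0}^{n-1}\beta_i^hW_{h,i}(B,0)-\sum_{j=0}^{n-1}\beta_j^{2n-h}W_{2n-h,j}(B^{\vee_h},0)+\delta_hW_{h,n}(B,0).$$ **Theorem 3.16** (Compatibility with $\mathcal{N}^0(1,n-1)$). Let $B=\mathrm{diag}(B_1,\pi^{-1}1_n)$ with $B_1\in X_n(E)$. Then the limits defining $W_{n,n}(B,r)$ and $\alpha((1_n)^{[r]},B_1)$ for $r\ge 0$, $W_{n,n}(A_n,0)$ and $\alpha(1_n,1_n)$ exist; $W_{n,n}(B,r)$ and $\alpha((1_n)^{[r]},B_1)$ are polynomials in $x=(-q)^{-2r}$; $W_{n,n}(A_n,0)\ne 0$ and $\alpha(1_n,1_n)\neq 0$; $W_{n,i}(B,0)=0$ for $0\le i<n$; and $$\mathcal{J}_n^n(B):=\frac{1}{W_{n,n}(A_n,0)}\Bigl\{W'_{n,n}(B,0)-\sum_{0\le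 i\le n-1}\beta_i^nW_{n,i}(B,0)\Bigr\}=\frac{\alpha'(1_n,B_1)}{\alpha(1_n,1_n)}.$$ -/

import Mathlib

open MeasureTheory Filter Topology Matrix
open scoped NormedField

namespace HermitianDensity

noncomputable section

/-- `ϖ` is a uniformizer of the discretely valued nonarchimedean field `K`: a nonzero element
of norm `< 1` that generates the maximal ideal of the ring of integers. -/
def IsUniformizer {K : Type*} [NormedField K] (ϖ : K) : Prop :=
  ϖ ≠ 0 ∧ ‖ϖ‖ < 1 ∧ ∀ x : K, ‖x‖ < 1 → ‖x‖ ≤ ‖ϖ‖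

/-- The cardinality `q` of the residue field of `F`. -/
def resCard (F : Type*) [NontriviallyNormedField F] [IsUltrametricDist F] : ℕ :=
  Nat.card (Valued.ResidueField F)

section matrices

variable {E : Type*} [NontriviallyNormedField E] [StarRing E] {m n : Type*}
  [Fintype m] [Fintype n]

/-- `A[X] = ᵗX* A X`, where `*` (written `star` in Lean) is the involution of `E`. -/
def act (A : Matrix m m E) (X : Matrix m n E) : Matrix n n E := Xᴴ * A * X

/-- `A^{[r]} = diag(A, 1_{2r})`. -/
def stab (A : Matrix m m E) (r : ℕ) : Matrix (m ⊕ Fin (2 * r)) (m ⊕ Fin (2 * r)) E :=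
  fromBlocks A 0 0 1

/-- The space `V_ι(E)` of hermitian matrices `ᵗY* = Y` indexed by `ι`. -/
abbrev HermMat (ι E : Type*) [NontriviallyNormedField E] [StarRing E] : AddSubgroup (Matrix ι ι E) :=
  selfAdjoint (Matrix ι ι E)

/-- The space of hermitian matrices carries its Borel σ-algebra. -/
instance instMeasurableSpaceHermMat (ι E : Type*) [NontriviallyNormedField E] [StarRing E] :
    MeasurableSpace (HermMat ι E) := borel _

instance instBorelSpaceHermMat (ι E : Type*) [NontriviallyNormedField E] [StarRing E] :
    BorelSpace (HermMat ι E) := ⟨rfl⟩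

end matrices

section densities

variable {F E : Type*} [NontriviallyNormedField F] [IsUltrametricDist F]
  [NontriviallyNormedField E] [IsUltrametricDist E] [NormedAlgebra F E] [StarRing E]

/-- A function `f` of `r = 0, 1, 2, …` is a polynomial `P` in `x = (-q)^{-2r}`. -/
def IsPolyIn (q : ℕ) (f : ℕ → ℂ) (P : Polynomial ℂ) : Prop :=
  ∀ r : ℕ, f r = P.eval ((-(q : ℂ)) ^ (-(2 * (r : ℤ))))

open Classical in
/-- `f' = - (d/dx) f |_{x = 1}` for a function `f` of `r` which is a polynomial in
`x = (-q)^{-2r}` (the polynomial is unique, since `q ≥ 2`). -/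
def derivAtOne (q : ℕ) (f : ℕ → ℂ) : ℂ :=
  if hf : ∃ P : Polynomial ℂ, IsPolyIn q f P then - hf.choose.derivative.eval 1 else 0

/-- The ideal `π^d O_E`. -/
def piIdeal (E : Type*) [NontriviallyNormedField E] [IsUltrametricDist E] [NormedAlgebra F E]
    (π : F) (d : ℕ) : Ideal (Valued.integer E) :=
  Ideal.span {y : (Valued.integer E) | (y : E) = algebraMap F E π ^ d}

variable {m n : Type*} [Fintype m] [Fintype n]

/-- The set `𝒜_d(A, B) = {x ∈ M_{m,n}(O_E / π^d O_E) : A[x] ≡ B mod π^d}`. The entries of `B`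
may be any elements of `E`; the set is empty if some entry of `B` is not integral
(and `A` is). -/
def solSet (π : F) (A : Matrix m m E) (B : Matrix n n E) (d : ℕ) :
    Set (Matrix m n ((Valued.integer E) ⧸ piIdeal E π d)) :=
  (fun x : Matrix m n (Valued.integer E) => x.map (Ideal.Quotient.mk (piIdeal E π d))) ''
    {x | ∀ i j, ∃ c ∈ piIdeal E π d, (act A (x.map (fun y => (y : E))) - B) i j = (c : E)}

/-- `(q^{-d})^{n(2m-n)} |𝒜_d(A, B)|` for `A` of size `m` and `B` of size `n`. -/
def densApprox (π : F) (A : Matrix m m E) (B : Matrix n n E) (d : ℕ) : ℂ :=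
  ((resCard F : ℂ) ^ (-(d : ℤ))) ^
      ((Fintype.card n : ℤ) * (2 * (Fintype.card m : ℤ) - (Fintype.card n : ℤ))) *
    ((solSet π A B d).ncard : ℂ)

/-- The representation density `α(A, B) = lim_d (q^{-d})^{n(2m-n)} |𝒜_d(A, B)|`. -/
def dens (π : F) (A : Matrix m m E) (B : Matrix n n E) : ℂ :=
  limUnder atTop (densApprox π A B)

/-- `α'(A, B)`: minus the derivative at `x = 1` of `α(A^{[r]}, B)`, as a function of
`x = (-q)^{-2r}`. -/
def dens' (π : F) (A : Matrix m m E) (B : Matrix n n E) : ℂ :=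
  derivAtOne (resCard F) (fun r => dens π (stab A r) B)

end densities

section whittaker

variable {F E : Type*} [NontriviallyNormedField F] [IsUltrametricDist F]
  [NontriviallyNormedField E] [NormedAlgebra F E] [StarRing E]

/-- The `F`-linear projection `z ↦ (1/2) Tr_{E/F}(z)` of `E` onto `F`, for `[E : F] = 2`. It is
the identity on `F`, and is only used to regard an element of `E` that lies in `F` as an
element of `F`. -/
def toBase (F : Type*) {E : Type*} [NontriviallyNormedField F] [NontriviallyNormedField E]
    [NormedAlgebra F E] (z : E) : F :=
  (2 : F)⁻¹ * Algebra.trace F E z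

/-- `A_t = diag(1_{2n-t}, π^{-1} 1_t)`, of size `2n = n + n`. -/
def gramA (E : Type*) [NontriviallyNormedField E] [NormedAlgebra F E] (π : F) (n t : ℕ) :
    Matrix (Fin (n + n)) (Fin (n + n)) E :=
  diagonal fun i => if (i : ℕ) < 2 * n - t then 1 else (algebraMap F E π)⁻¹

/-- The support of `1_{h,t}^{[r]}` in `M_{2n+2r,2n}(E)`: the matrices with entries in `O_E` whose
block formed by the rows `2n-t+1, …, 2n` and the columns `1, …, 2n-h` has entries in `π O_E`.
In the coordinates of a basis of `L_t` with Gram matrix `A_t`, this is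
`(L_t^∨)^{2n-h} × (L_t)^h` in the first `2n` rows. -/
def suppSet (E : Type*) [NontriviallyNormedField E] (π : F) (n h t r : ℕ) :
    Set (Fin (n + n) ⊕ Fin (2 * r) → Fin (n + n) → E) :=
  {X | (∀ i j, ‖X i j‖ ≤ 1) ∧
    ∀ i j : Fin (n + n), 2 * n - t ≤ (i : ℕ) → (j : ℕ) < 2 * n - h → ‖X (Sum.inl i) j‖ ≤ ‖π‖}

variable [MeasurableSpace E] (π : F) (ψ : AddChar F Circle) (μ : Measure E) {n : ℕ}
  (ν : Measure (HermMat (Fin (n + n)) E))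

/-- The integral
`∫_{Y ∈ π^{-d} V_{2n}(O_E)} ∫_{X ∈ M_{2n+2r,2n}(E)} ψ(Tr(Y (A_t^{[r]}[X] - B))) 1_{h,t}^{[r]}(X) dX dY`,
where `dX` is the product measure of copies of `μ` and `dY` is `ν`. -/
def whitTrunc (h t : ℕ) (B : Matrix (Fin (n + n)) (Fin (n + n)) E) (r d : ℕ) : ℂ :=
  ∫ Y in {Y : HermMat (Fin (n + n)) E | ∀ i j, ‖Y.1 i j‖ ≤ ‖π‖ ^ (-(d : ℤ))},
    ∫ X : Fin (n + n) ⊕ Fin (2 * r) → Fin (n + n) → E,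
      ((ψ (toBase F (trace (Y.1 *
          (act (stab (gramA E π n t) r) (Matrix.of X) - B)))) : Circle) : ℂ) *
        (suppSet E π n h t r).indicator (fun _ => (1 : ℂ)) X
      ∂(Measure.pi fun _ => Measure.pi fun _ => μ)
    ∂ν

/-- `W_{h,t}(B, r)`. The outer integral over the (noncompact) space `V_{2n}(E)` is not absolutely
convergent for small `r`; as usual for Whittaker functionals and representation densities, it is
the limit of the integrals over the compact subgroups `π^{-d} V_{2n}(O_E)`, as `d → ∞`. -/
def whit (h t : ℕ) (B : Matrix (Fin (n + n)) (Fin (n + n)) E) (r : ℕ) : ℂ :=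
  limUnder atTop (whitTrunc π ψ μ ν h t B r)

/-- `W'_{h,t}(B, 0)`: minus the derivative at `x = 1` of `W_{h,t}(B, r)`, as a function of
`x = (-q)^{-2r}`. -/
def whit' (h t : ℕ) (B : Matrix (Fin (n + n)) (Fin (n + n)) E) : ℂ :=
  derivAtOne (resCard F) (whit π ψ μ ν h t B)

/-- The permutation of the indices that carries the first `h` indices to the last `h` ones, and
the last `2n - h` indices to the first `2n - h` ones (for `h ≤ 2n`). -/
def swapIdx (h : ℕ) (i : Fin (n + n)) : Fin (n + n) :=
  ⟨((i : ℕ) + (n + n - h)) % (n + n), Nat.mod_lt _ (Nat.zero_lt_of_lt i.isLt)⟩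

/-- `X^{∨_h} = (π D, C; B, π^{-1} A)` for `X = (A, B; C, D)` with `A` of size `2n - h` and `D` of
size `h`. -/
def veeMat (h : ℕ) (X : Matrix (Fin (n + n)) (Fin (n + n)) E) :
    Matrix (Fin (n + n)) (Fin (n + n)) E :=
  Matrix.of fun i j =>
    (if (i : ℕ) < h ∧ (j : ℕ) < h then algebraMap F E π
      else if h ≤ (i : ℕ) ∧ h ≤ (j : ℕ) then (algebraMap F E π)⁻¹ else 1) *
    X (swapIdx h i) (swapIdx h j)

/-- The identity which characterizes the constants `β_0^h, …, β_{n-1}^h`, `β_0^{2n-h}, …,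
β_{n-1}^{2n-h}`, `δ_h`: for all nondegenerate hermitian `B` of size `2n`,
`W'_{h,n}(B,0) - W'_{2n-h,n}(B^{∨_h},0) = ∑_i β_i^h W_{h,i}(B,0)
  - ∑_j β_j^{2n-h} W_{2n-h,j}(B^{∨_h},0) + δ_h W_{h,n}(B,0)`. -/
def IsCorrection (h : ℕ) (c : (Fin n → ℂ) × (Fin n → ℂ) × ℂ) : Prop :=
  ∀ B : Matrix (Fin (n + n)) (Fin (n + n)) E, B.IsHermitian → IsUnit B.det →
    whit' π ψ μ ν h n B - whit' π ψ μ ν (2 * n - h) n (veeMat π h B) =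
      ∑ i : Fin n, c.1 i * whit π ψ μ ν h i B 0
      - ∑ j : Fin n, c.2.1 j * whit π ψ μ ν (2 * n - h) j (veeMat π h B) 0
      + c.2.2 * whit π ψ μ ν h n B 0

/-- The constants `β_0^h, …, β_{n-1}^h`: the first part of the (unique) system of constants with
the property `IsCorrection`. -/
def corrBeta (h : ℕ) : Fin n → ℂ :=
  (Classical.epsilon (IsCorrection π ψ μ ν h)).1

/-- `𝒥_h^n(B) = W_{n,n}(A_n,0)^{-1} { W'_{h,n}(B,0) - ∑_{0 ≤ i ≤ n-1} β_i^h W_{h,i}(B,0) }`. -/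
def calJ (h : ℕ) (B : Matrix (Fin (n + n)) (Fin (n + n)) E) : ℂ :=
  1 / whit π ψ μ ν n n (gramA E π n n) 0 *
    (whit' π ψ μ ν h n B - ∑ i : Fin n, corrBeta π ψ μ ν h i * whit π ψ μ ν h i B 0)

end whittaker

/-- The matrix `diag(B₁, π^{-1} 1_n)` of size `2n = n + n`. -/
def blockB {F E : Type*} [NontriviallyNormedField F] [NontriviallyNormedField E]
    [NormedAlgebra F E] (π : F) {n : ℕ} (B₁ : Matrix (Fin n) (Fin n) E) :
    Matrix (Fin (n + n)) (Fin (n + n)) E :=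
  Matrix.reindex finSumFinEquiv finSumFinEquiv
    (fromBlocks B₁ 0 0 ((algebraMap F E π)⁻¹ • (1 : Matrix (Fin n) (Fin n) E)))

end

end HermitianDensity

open HermitianDensity

/-! Orthogonality of characters turns both kinds of quantities into volumes. Integrating `ψ(Tr(Y
Z))` over `Y ∈ π^{-d} V` gives the volume of `π^{-d} V` if `Z ≡ 0 mod π^d`, and `0` otherwise. So
the truncated Whittaker integral is a power of `q` times the volume of the `X` in the support with
`A_t^{[r]}[X] ≡ B mod π^d` (`whitTrunc_eq`). The approximations of `α` have the same shape
(`densApprox_eq`).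

For `B = diag(B₁, π^{-1})` and `t = h = n`, write `X` in blocks `P, Q, R, U`, where the lower rows
`(R, U)` carry the form `π^{-1}`. The congruences become `U*U ≡ 1 - πQ*Q mod π^{d+1}`, `P*Q +
π^{-1}R*U ≡ 0` and `P*P + π^{-1}R*R ≡ B₁ mod π^d`. The first makes `U` unitary modulo `π`, hence
invertible over `O_E`. The second then determines `R mod π^{d+1}` from `P`, and the third becomes
`P* S P ≡ B₁` with `S` hermitian and `S ≡ 1 mod π` (`elim_block`). Since `p` is odd, such an `S` is
`T*T` to any precision with `T ≡ 1 mod π`. A change of variables therefore replaces `S` by `1`, and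
likewise `1 - πQ*Q` by `1`. By Fubini (`volume_blocks`) the volume is a product, and in the limit
`W_{n,n}(B, r) = q^{-3n²} α(1_n, 1_n) α(1_n^{[r]}, B₁)`. The case `B₁ = 1`, `r = 0` is `W_{n,n}(A_n,
0)`, so the quotient of the derivative by this value is `α'(1_n, B₁) / α(1_n, 1_n)`.

For `i < n` the matrix `π A_i^{[r]}` has only `i` diagonal entries that are units. It cannot
represent modulo `π` the block `1_n` of `πB`, so `W_{n,i}(B, 0) = 0` (`suppSet_blockB_empty`). The
sum containing the constants `β` vanishes whatever their values.

Two analytic points remain. Convergence: for nondegenerate `B` the approximations of `α(1, B)` are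
constant once `d` exceeds a bound depending on `B^{-1}` only (`volume_step`, `densApprox_stable`).
Polynomiality: at a fixed level `d`, the density with `m + 2r` rows is the Fourier integral of
`G(Y)^{m+2r}`, where `G(Y)` is the Gauss integral of `Y`. As `-1` is a norm modulo every power of
`π`, `G(-Y) = G(Y)`. Hence `G(Y)² = G(Y)G(-Y)` is the volume of an `O_E`-lattice, namely `q^{-2k}`
with `k` bounded in terms of `d` (`gaussInt_sq`). Thus `G(Y)^{2r} = x^k` with `x = (-q)^{-2r}`, and
sorting the `Y` by `k` gives a polynomial. -/

namespace HermitianDensity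

/-! ### Entrywise bounds, the language for congruences modulo powers of `π`. -/

/-- All entries of `X` have norm at most `c`. -/
def EntryLe {E : Type*} [NontriviallyNormedField E] {m n : Type*} (X : Matrix m n E) (c : ℝ) :
    Prop :=
  ∀ i j, ‖X i j‖ ≤ c

section EntryLe

variable {E : Type*} [NontriviallyNormedField E] {l m n : Type*} {X Y : Matrix m n E} {a b c : ℝ}

theorem EntryLe.mono (h : EntryLe X a) (hab : a ≤ b) : EntryLe X b :=
  fun i j => (h i j).trans hab

theorem EntryLe.neg (hX : EntryLe X c) : EntryLe (-X) c := fun i j => by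
  rw [Matrix.neg_apply, norm_neg]
  exact hX i j

theorem EntryLe.sub_comm (h : EntryLe (X - Y) c) : EntryLe (Y - X) c := by
  simpa using h.neg

theorem EntryLe.smul (hX : EntryLe X c) {s : E} (hs : ‖s‖ ≤ a) :
    EntryLe (s • X) (a * c) := fun i j => by
  rw [Matrix.smul_apply, smul_eq_mul, norm_mul]
  exact mul_le_mul hs (hX i j) (norm_nonneg _) ((norm_nonneg _).trans hs)

theorem entryLe_zero (hc : 0 ≤ c) : EntryLe (0 : Matrix m n E) c := fun i j => by simpa using hc

theorem entryLe_one [DecidableEq n] : EntryLe (1 : Matrix n n E) 1 := fun i j => by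
  rw [Matrix.one_apply]
  split_ifs <;> simp

variable [IsUltrametricDist E]

theorem norm_add_le_of_le {x y : E} (hx : ‖x‖ ≤ c) (hy : ‖y‖ ≤ c) : ‖x + y‖ ≤ c :=
  (IsUltrametricDist.norm_add_le_max x y).trans (max_le hx hy)

theorem norm_sub_le_of_le {x y : E} (hx : ‖x‖ ≤ c) (hy : ‖y‖ ≤ c) : ‖x - y‖ ≤ c := by
  rw [sub_eq_add_neg]
  exact norm_add_le_of_le hx (by rwa [norm_neg])

theorem EntryLe.add (hX : EntryLe X c) (hY : EntryLe Y c) : EntryLe (X + Y) c :=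
  fun i j => norm_add_le_of_le (hX i j) (hY i j)

theorem EntryLe.sub (hX : EntryLe X c) (hY : EntryLe Y c) : EntryLe (X - Y) c :=
  fun i j => norm_sub_le_of_le (hX i j) (hY i j)

/-- By the ultrametric inequality; this is the device for exchanging one congruence for an
equivalent one after a change of variables. -/
theorem EntryLe.congr_sub (h : EntryLe (X - Y) c) : EntryLe X c ↔ EntryLe Y c :=
  ⟨fun hX => by simpa using hX.sub h, fun hY => by simpa using h.add hY⟩

theorem EntryLe.mul [Fintype m] {X : Matrix l m E} {Y : Matrix m n E} (hX : EntryLe X a)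
    (hY : EntryLe Y b) (ha : 0 ≤ a) (hb : 0 ≤ b) : EntryLe (X * Y) (a * b) := fun i j => by
  rw [Matrix.mul_apply]
  refine IsUltrametricDist.norm_sum_le_of_forall_le_of_nonneg (mul_nonneg ha hb) fun k _ => ?_
  rw [norm_mul]
  exact mul_le_mul (hX i k) (hY k j) (norm_nonneg _) ha

theorem EntryLe.mul_one_left [Fintype m] {X : Matrix l m E} {Y : Matrix m n E} (hX : EntryLe X 1)
    (hY : EntryLe Y b) (hb : 0 ≤ b) : EntryLe (X * Y) b := by
  simpa using hX.mul hY zero_le_one hb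

theorem EntryLe.mul_one_right [Fintype m] {X : Matrix l m E} {Y : Matrix m n E} (hX : EntryLe X a)
    (hY : EntryLe Y 1) (ha : 0 ≤ a) : EntryLe (X * Y) a := by
  simpa using hX.mul hY ha zero_le_one

/-- A matrix congruent to `1` modulo elements of norm `< 1` preserves the sup norm. -/
theorem entryLe_mul_iff_of_sub_one [Fintype m] [Finite n] [DecidableEq m] {T : Matrix m m E}
    (hT : EntryLe (T - 1) a) (ha0 : 0 ≤ a) (ha : a < 1) (hc : 0 ≤ c) {X : Matrix m n E} :
    EntryLe (T * X) c ↔ EntryLe X c := by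
  have hT1 : EntryLe T 1 := by
    have := (hT.mono ha.le).add entryLe_one
    simpa using this
  refine ⟨fun h => ?_, fun h => hT1.mul_one_left h hc⟩
  by_contra hX
  simp only [EntryLe, not_forall, not_le] at hX
  obtain ⟨i₀, j₀, h₀⟩ := hX
  -- At an entry of maximal norm `M`, the identity `X = TX - (T - 1)X` gives `M ≤ max c (aM)`. This
  -- is impossible when `M > c`, since `a < 1`.
  obtain ⟨⟨i₁, j₁⟩, hmax⟩ :=
    (haveI : Nonempty (m × n) := ⟨(i₀, j₀)⟩; Finite.exists_max fun ij : m × n => ‖X ij.1 ij.2‖)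
  have hM : EntryLe X ‖X i₁ j₁‖ := fun i j => hmax (i, j)
  have hpos : 0 < ‖X i₁ j₁‖ := (hc.trans_lt h₀).trans_le (hmax (i₀, j₀))
  have h1 := hT.mul hM ha0 hpos.le
  have h2 : X = T * X - (T - 1) * X := by rw [Matrix.sub_mul, Matrix.one_mul, sub_sub_cancel]
  have h3 : ‖X i₁ j₁‖ ≤ max c (a * ‖X i₁ j₁‖) := by
    have := ((h.mono (le_max_left c (a * ‖X i₁ j₁‖))).sub (h1.mono (le_max_right _ _))) i₁ j₁
    rwa [← h2] at this
  rcases le_max_iff.1 h3 with h4 | h4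
  · exact absurd (h₀.trans_le (hmax (i₀, j₀))) (not_lt.2 h4)
  · nlinarith

/-- Transposition turns the right factor `R` into a left factor `Rᵀ`, which is again close to `1`.
-/
theorem entryLe_mul_mul_iff [Fintype m] [Fintype n] [DecidableEq m] [DecidableEq n]
    {L : Matrix m m E} {R : Matrix n n E} (hL : EntryLe (L - 1) a) (hR : EntryLe (R - 1) a)
    (ha0 : 0 ≤ a) (ha : a < 1) (hc : 0 ≤ c) {X : Matrix m n E} :
    EntryLe (L * X * R) c ↔ EntryLe X c := by
  have ht : ∀ (Y : Matrix m n E), EntryLe Yᵀ c ↔ EntryLe Y c := fun Y =>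
    ⟨fun h i j => h j i, fun h i j => h j i⟩
  have hR' : EntryLe (Rᵀ - 1) a := fun i j => by
    have := hR j i
    rwa [← transpose_one, ← transpose_sub]
  rw [← ht, transpose_mul, entryLe_mul_iff_of_sub_one hR' ha0 ha hc, ht,
    entryLe_mul_iff_of_sub_one hL ha0 ha hc]

/-- `T` preserves the bound `0` in both directions, so a vector in its kernel vanishes. -/
theorem isUnit_det_of_sub_one [Fintype m] [DecidableEq m] {T : Matrix m m E}
    (hT : EntryLe (T - 1) a) (ha0 : 0 ≤ a) (ha : a < 1) : IsUnit T.det := by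
  rw [isUnit_iff_ne_zero]
  intro h0
  obtain ⟨v, hv, hTv⟩ := Matrix.exists_mulVec_eq_zero_iff.2 h0
  apply hv
  have h1 : EntryLe (T * Matrix.replicateCol Unit v) 0 := by
    intro i j
    have : (T * Matrix.replicateCol Unit v) i j = (T *ᵥ v) i := rfl
    rw [this, hTv]
    simp
  rw [entryLe_mul_iff_of_sub_one hT ha0 ha le_rfl] at h1
  ext i
  simpa using h1 i ()

end EntryLe

/-! ### Discreteness of the norm, unramified quadratic extensions, square roots of hermitian
matrices. -/

/-- The norm is discrete: its values are the powers of the norm of a uniformizer. -/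
theorem IsUniformizer.le_of_lt_zpow {K : Type*} [NormedField K] {ϖ : K} (hϖ : IsUniformizer ϖ)
    {x : K} {d : ℤ} (hx : ‖x‖ < ‖ϖ‖ ^ d) : ‖x‖ ≤ ‖ϖ‖ ^ (d + 1) := by
  have hpos : 0 < ‖ϖ‖ := norm_pos_iff.2 hϖ.1
  have h0 : 0 < ‖ϖ‖ ^ d := zpow_pos hpos d
  have h1 := hϖ.2.2 (x / ϖ ^ d) (by
    rw [norm_div, norm_zpow, div_lt_one h0]
    exact hx)
  rw [norm_div, norm_zpow, div_le_iff₀ h0] at h1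
  rw [zpow_add_one₀ hpos.ne', mul_comm]
  exact h1

/-- The norm lies between two consecutive powers of `‖ϖ‖`, and discreteness excludes the open
interval between them. -/
theorem IsUniformizer.exists_norm_eq_zpow {K : Type*} [NormedField K] {ϖ : K}
    (hϖ : IsUniformizer ϖ) {x : K} (hx : x ≠ 0) : ∃ d : ℤ, ‖x‖ = ‖ϖ‖ ^ d := by
  obtain ⟨k, hk1, hk2⟩ := exists_mem_Ioc_zpow (norm_pos_iff.2 hx)
    ((one_lt_inv₀ (norm_pos_iff.2 hϖ.1)).2 hϖ.2.1)
  rw [_root_.inv_zpow, ← _root_.zpow_neg] at hk1 hk2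
  refine ⟨-(k + 1), le_antisymm hk2 ?_⟩
  by_contra hlt
  have := hϖ.le_of_lt_zpow (not_le.1 hlt)
  rw [show -(k + 1) + 1 = -k by ring] at this
  exact absurd hk1 (not_lt.2 this)

/-- The properties of an unramified quadratic extension `E / F` with involution `star` and
uniformizer `π` on which the computation of the densities is based. -/
structure UnramQuad (F E : Type*) [NontriviallyNormedField F] [NontriviallyNormedField E]
    [NormedAlgebra F E] [StarRing E] (π : F) : Prop where
  unif : IsUniformizer π
  unifE : IsUniformizer (algebraMap F E π)
  norm_star : ∀ z : E, ‖star z‖ = ‖z‖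
  star_algebraMap : ∀ a : F, star (algebraMap F E a) = algebraMap F E a
  fixed : ∀ z : E, star z = z → ∃ a : F, algebraMap F E a = z
  norm_two : ‖(2 : F)‖ = 1
  trace_eq : ∀ z : E, algebraMap F E (Algebra.trace F E z) = z + star z
  imag : ∃ w : E, ‖w‖ = 1 ∧ star w = -w

theorem toBase_add {F E : Type*} [NontriviallyNormedField F] [NontriviallyNormedField E]
    [NormedAlgebra F E] (x y : E) : toBase F (x + y) = toBase F x + toBase F y := by
  simp [toBase, mul_add]

section UnramQuad

variable {F E : Type*} [NontriviallyNormedField F] [NontriviallyNormedField E]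
    [NormedAlgebra F E] [StarRing E] {π : F} {l m n : Type*}

theorem EntryLe.conjTranspose (h : UnramQuad F E π) {X : Matrix m n E} {c : ℝ}
    (hX : EntryLe X c) : EntryLe Xᴴ c := fun i j => by
  rw [Matrix.conjTranspose_apply, h.norm_star]
  exact hX j i

namespace UnramQuad

variable (h : UnramQuad F E π)
include h

theorem norm_pos : 0 < ‖π‖ := norm_pos_iff.2 h.unif.1

theorem norm_lt_one : ‖π‖ < 1 := h.unif.2.1

theorem norm_pow_pos (d : ℕ) : 0 < ‖π‖ ^ d := pow_pos h.norm_pos d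

theorem norm_twoE : ‖(2 : E)‖ = 1 := by
  rw [← h.norm_two, ← norm_algebraMap' E (2 : F), map_ofNat]

theorem two_ne : (2 : F) ≠ 0 := by
  rw [← norm_pos_iff, h.norm_two]
  exact one_pos

theorem twoE_ne : (2 : E) ≠ 0 := by
  rw [← norm_pos_iff, h.norm_twoE]
  exact one_pos

theorem star_half : star (2 : E)⁻¹ = (2 : E)⁻¹ := by
  rw [show (2 : E)⁻¹ = algebraMap F E (2⁻¹) by rw [map_inv₀, map_ofNat], h.star_algebraMap]

theorem le_of_lt_zpow {x : E} {d : ℤ} (hx : ‖x‖ < ‖π‖ ^ d) : ‖x‖ ≤ ‖π‖ ^ (d + 1) := by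
  rw [← norm_algebraMap' E π] at hx ⊢
  exact h.unifE.le_of_lt_zpow hx

theorem algebraMap_toBase (z : E) :
    algebraMap F E (toBase F z) = (2 : E)⁻¹ * (z + star z) := by
  rw [toBase, map_mul, map_inv₀, map_ofNat, h.trace_eq]

theorem norm_toBase_le [IsUltrametricDist E] (z : E) : ‖toBase F z‖ ≤ ‖z‖ := by
  rw [← norm_algebraMap' E, h.algebraMap_toBase, norm_mul, norm_inv, h.norm_twoE, inv_one, one_mul]
  exact norm_add_le_of_le le_rfl (h.norm_star z).le

/-- Hermitian matrices congruent to `1` are approximately of the form `ᵗT* T`. -/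
theorem exists_conjTranspose_mul_self [IsUltrametricDist E] [Fintype n] [DecidableEq n]
    {S : Matrix n n E} (hS : S.IsHermitian) (hS1 : EntryLe (S - 1) ‖π‖) (k : ℕ) :
    ∃ T : Matrix n n E, EntryLe (T - 1) ‖π‖ ∧ EntryLe (Tᴴ * T - S) (‖π‖ ^ (k + 1)) := by
  have hp := h.norm_pos
  induction k with
  | zero =>
    refine ⟨1, by simpa using entryLe_zero hp.le, ?_⟩
    simpa using hS1.sub_comm
  | succ k ih =>
    obtain ⟨T, hT, hTS⟩ := ih
    have hT1 : EntryLe T 1 := by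
      simpa using (hT.mono h.norm_lt_one.le).add entryLe_one
    set D : Matrix n n E := S - Tᴴ * T with hD
    have hDle : EntryLe D (‖π‖ ^ (k + 1)) := hTS.sub_comm
    have hDH : Dᴴ = D := by
      rw [hD, conjTranspose_sub, conjTranspose_mul, conjTranspose_conjTranspose, hS.eq]
    set c : E := (2 : E)⁻¹ with hc
    have hcn : ‖c‖ ≤ 1 := by rw [hc, norm_inv, h.norm_twoE, inv_one]
    have hc2 : c + c = 1 := by
      rw [hc, ← two_mul, mul_inv_cancel₀ h.twoE_ne]
    have hDπ : EntryLe D ‖π‖ := hDle.mono (by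
      rw [pow_succ]
      exact mul_le_of_le_one_left hp.le (pow_le_one₀ hp.le h.norm_lt_one.le))
    have hk0 : 0 ≤ ‖π‖ ^ (k + 1) := by positivity
    -- Newton step `T ↦ T(1 + D/2)`, where `D` is the current error. It changes `T*T` by `(D T*T +
    -- T*T D)/2` up to a term quadratic in `D`. This differs from `D` by `(DN + ND)/2` with `N = T*T
    -- - 1 ≡ 0 mod π`, so one power of `π` is gained.
    refine ⟨T + c • (T * D), ?_, ?_⟩
    · have h1 : EntryLe (c • (T * D)) ‖π‖ := by
        simpa using (hT1.mul_one_left hDπ hp.le).smul hcn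
      have := hT.add h1
      rwa [sub_add_eq_add_sub] at this
    · obtain ⟨N, hN⟩ : ∃ N, N = Tᴴ * T - 1 := ⟨_, rfl⟩
      have hNle : EntryLe N ‖π‖ := by
        have : N = (S - 1) - D := by rw [hN, hD]; abel
        rw [this]
        exact hS1.sub hDπ
      have key : (T + c • (T * D))ᴴ * (T + c • (T * D)) - S =
          c • (D * N + N * D) + (c * c) • (D * (Tᴴ * T) * D) := by
        have e1 : (T + c • (T * D))ᴴ = Tᴴ + c • (D * Tᴴ) := by
          rw [conjTranspose_add, conjTranspose_smul, conjTranspose_mul, hDH, hc, h.star_half]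
        have e2 : S = D + Tᴴ * T := by rw [hD]; abel
        have e3 : D = (c + c) • D := by rw [hc2, one_smul]
        rw [e1, e2, hN]
        simp only [add_mul, mul_add, mul_sub, sub_mul, smul_add, smul_sub, mul_one, one_mul,
          Matrix.smul_mul, Matrix.mul_smul, smul_smul, Matrix.mul_assoc]
        nth_rw 5 [e3]
        rw [add_smul]
        abel
      rw [key]
      have hTT : EntryLe (Tᴴ * T) 1 := (hT1.conjTranspose h).mul_one_left hT1 zero_le_one
      have hcc : ‖c * c‖ ≤ 1 := by
        rw [norm_mul]
        exact mul_le_one₀ hcn (norm_nonneg _) hcn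
      have b1 : EntryLe (D * N + N * D) (‖π‖ ^ (k + 1 + 1)) := by
        refine EntryLe.add ?_ ?_
        · simpa [pow_succ] using hDle.mul hNle hk0 hp.le
        · simpa [pow_succ'] using hNle.mul hDle hp.le hk0
      have b2 : EntryLe (D * (Tᴴ * T) * D) (‖π‖ ^ (k + 1 + 1)) := by
        simpa [pow_succ] using (hDle.mul_one_right hTT hk0).mul hDπ hk0 hp.le
      have hk1 : 0 ≤ ‖π‖ ^ (k + 1 + 1) := by positivity
      refine EntryLe.add ?_ ?_
      · simpa using b1.smul hcn
      · simpa using b2.smul hcc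

end UnramQuad

end UnramQuad

attribute [local instance 2000] PseudoMetricSpace.toUniformSpace

/-! ### Comparison of Haar measures, counting of fibres, Fubini with constant slices. -/

section Haar

open Measure in
/-- An additive homeomorphism multiplies Haar measure by a constant, which can be read off from a
single set of positive finite measure. -/
theorem measure_preimage_mul_of_haar {V W : Type*} [AddCommGroup V] [TopologicalSpace V]
    [IsTopologicalAddGroup V] [MeasurableSpace V] [BorelSpace V]
    [AddCommGroup W] [TopologicalSpace W] [IsTopologicalAddGroup W] [LocallyCompactSpace W]
    [SecondCountableTopology W] [MeasurableSpace W] [BorelSpace W]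
    (μ : Measure V) [μ.IsAddHaarMeasure] (ν : Measure W) [ν.IsAddHaarMeasure]
    (e : V ≃+ W) (he : Continuous e) (he' : Continuous e.symm) (K S : Set W) :
    μ (e ⁻¹' S) * ν K = μ (e ⁻¹' K) * ν S := by
  have hmeas : MeasurableEmbedding e :=
    (Homeomorph.mk e.toEquiv he he').measurableEmbedding
  have : (μ.map e).IsAddHaarMeasure := e.isAddHaarMeasure_map μ he he'
  obtain ⟨c, hc⟩ : ∃ c : NNReal, μ.map e = c • ν := ⟨_, isAddLeftInvariant_eq_smul (μ.map e) ν⟩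
  have key : ∀ A : Set W, μ (e ⁻¹' A) = c * ν A := fun A => by
    rw [← hmeas.map_apply, hc]
    rfl
  rw [key, key]
  ring

/-- With this, preservation of volume need only be checked on one set, in practice the integral
points. -/
theorem measure_preimage_of_haar {V W : Type*} [AddCommGroup V] [TopologicalSpace V]
    [IsTopologicalAddGroup V] [MeasurableSpace V] [BorelSpace V]
    [AddCommGroup W] [TopologicalSpace W] [IsTopologicalAddGroup W] [LocallyCompactSpace W]
    [SecondCountableTopology W] [MeasurableSpace W] [BorelSpace W]
    (μ : Measure V) [μ.IsAddHaarMeasure] (ν : Measure W) [ν.IsAddHaarMeasure]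
    (e : V ≃+ W) (he : Continuous e) (he' : Continuous e.symm) {K : Set W} (hK : ν K = 1)
    (hK' : μ (e ⁻¹' K) = 1) (S : Set W) : μ (e ⁻¹' S) = ν S := by
  simpa [hK, hK'] using measure_preimage_mul_of_haar μ ν e he he' K S

/-- If all nonempty fibres of `f` on `S` have the same measure, then the measure of `S` is the
number of these fibres times that measure. -/
theorem measure_eq_ncard_mul {V T : Type*} [MeasurableSpace V] [Finite T] (μ : Measure V)
    (f : V → T) (S : Set V) (c : ENNReal) (hm : ∀ s ∈ S, MeasurableSet {x | x ∈ S ∧ f x = f s})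
    (hc : ∀ s ∈ S, μ {x | x ∈ S ∧ f x = f s} = c) : μ S = (f '' S).ncard * c := by
  have hfin : (f '' S).Finite := Set.toFinite _
  have h1 : S = ⋃ t ∈ hfin.toFinset, {x | x ∈ S ∧ f x = t} := by
    ext x
    simp only [Set.mem_iUnion, Set.mem_ofPred_eq, Set.Finite.mem_toFinset, Set.mem_image]
    constructor
    · exact fun hx => ⟨f x, ⟨x, hx, rfl⟩, hx, rfl⟩
    · rintro ⟨_, _, hx, _⟩
      exact hx
  conv_lhs => rw [h1]
  rw [measure_biUnion_finset]
  · rw [Finset.sum_congr rfl (g := fun _ => c)]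
    · rw [Finset.sum_const, Set.ncard_eq_toFinset_card _ hfin, nsmul_eq_mul]
    · intro t ht
      obtain ⟨s, hs, rfl⟩ := hfin.mem_toFinset.1 ht
      exact hc s hs
  · intro a _ b _ hab
    refine Set.disjoint_left.2 fun x hx hx' => hab ?_
    rw [← hx.2, ← hx'.2]
  · intro t ht
    obtain ⟨s, hs, rfl⟩ := hfin.mem_toFinset.1 ht
    exact hm s hs

/-- Fubini for a measurable set whose nonempty slices have constant measure. -/
theorem prod_apply_of_const_slice {V W : Type*} [MeasurableSpace V] [MeasurableSpace W]
    (μ : Measure V) (ν : Measure W) [SFinite ν] {S : Set (V × W)} (hS : MeasurableSet S)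
    {T : Set V} (hT : MeasurableSet T) (c : ENNReal)
    (h1 : ∀ a ∈ T, ν (Prod.mk a ⁻¹' S) = c) (h2 : ∀ a ∉ T, ν (Prod.mk a ⁻¹' S) = 0) :
    μ.prod ν S = μ T * c := by
  rw [Measure.prod_apply hS, mul_comm, ← lintegral_indicator_const hT]
  refine lintegral_congr fun a => ?_
  by_cases ha : a ∈ T
  · rw [h1 a ha, Set.indicator_of_mem ha]
  · rw [h2 a ha, Set.indicator_of_notMem ha]

end Haar

/-! ### Finiteness of residue rings; the volume of the maximal ideal. -/

section ResidueField

variable {K : Type*} [NontriviallyNormedField K] [IsUltrametricDist K] [ProperSpace K]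

theorem compactSpace_integer : CompactSpace (Valued.integer K) := by
  rw [← isCompact_univ_iff, Subtype.isCompact_iff, Set.image_univ, Subtype.range_coe_subtype]
  convert isCompact_closedBall (0 : K) 1 using 1
  ext x
  simp [Valued.integer.mem_iff]

/-- An ideal containing a ball around `0` is an open subgroup of a compact group, hence of finite
index. -/
theorem finite_quotient_integer (I : Ideal (Valued.integer K)) {c : ℝ} (hc : 0 < c)
    (hI : ∀ x : Valued.integer K, ‖(x : K)‖ ≤ c → x ∈ I) : Finite (Valued.integer K ⧸ I) := by
  have : CompactSpace (Valued.integer K) := compactSpace_integer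
  refine AddSubgroup.quotient_finite_of_isOpen I.toAddSubgroup ?_
  refine AddSubgroup.isOpen_of_mem_nhds _ (g := 0) ?_
  have : {x : Valued.integer K | ‖(x : K)‖ < c} ∈ 𝓝 (0 : Valued.integer K) := by
    refine IsOpen.mem_nhds ?_ (by simpa using hc)
    exact isOpen_lt (continuous_norm.comp continuous_subtype_val) continuous_const
  filter_upwards [this] with x hx
  exact hI x (le_of_lt hx)

omit [ProperSpace K] in
theorem IsUniformizer.mem_maximalIdeal_iff {ϖ : K} (hϖ : IsUniformizer ϖ)
    (x : Valued.integer K) :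
    x ∈ IsLocalRing.maximalIdeal (Valued.integer K) ↔ ‖(x : K)‖ ≤ ‖ϖ‖ := by
  rw [IsLocalRing.mem_maximalIdeal, mem_nonunits_iff, Valued.integer.isUnit_iff_norm_eq_one]
  have hx := Valued.integer.norm_le_one x
  constructor
  · exact fun h => hϖ.2.2 _ (lt_of_le_of_ne hx h)
  · exact fun h => (h.trans_lt hϖ.2.1).ne

theorem IsUniformizer.finite_residueField {ϖ : K} (hϖ : IsUniformizer ϖ) :
    Finite (Valued.ResidueField K) :=
  finite_quotient_integer _ (norm_pos_iff.2 hϖ.1) fun x hx => (hϖ.mem_maximalIdeal_iff x).2 hx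

theorem IsUniformizer.one_lt_resCard {ϖ : K} (hϖ : IsUniformizer ϖ) : 1 < resCard K := by
  have := hϖ.finite_residueField
  exact Finite.one_lt_card

omit [ProperSpace K] in
theorem measure_ball_add_left [MeasurableSpace K] [BorelSpace K] (μ : Measure K)
    [μ.IsAddHaarMeasure] (a : K) (c : ℝ) : μ {x | ‖x - a‖ ≤ c} = μ {x | ‖x‖ ≤ c} := by
  have := measure_preimage_add_right μ (-a) {x | ‖x‖ ≤ c}
  simpa [Set.preimage, sub_eq_add_neg] using this

/-- The fibres of the residue map on the unit ball are the translates of the maximal ideal. -/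
theorem IsUniformizer.resCard_mul_measure [MeasurableSpace K] [BorelSpace K] (μ : Measure K)
    [μ.IsAddHaarMeasure] {ϖ : K} (hϖ : IsUniformizer ϖ) :
    resCard K * μ {x | ‖x‖ ≤ ‖ϖ‖} = μ {x | ‖x‖ ≤ 1} := by
  classical
  have := hϖ.finite_residueField
  -- The value `0` outside the unit ball is irrelevant: only fibres inside the unit ball are
  -- counted.
  let f : K → Valued.ResidueField K := fun x =>
    if hx : ‖x‖ ≤ 1 then IsLocalRing.residue _ ⟨x, Valued.integer.mem_iff.2 hx⟩ else 0
  have hfib : ∀ s ∈ {x : K | ‖x‖ ≤ 1},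
      {x | x ∈ {x : K | ‖x‖ ≤ 1} ∧ f x = f s} = {x | ‖x - s‖ ≤ ‖ϖ‖} := by
    intro s hs
    have hs : ‖s‖ ≤ 1 := hs
    ext x
    simp only [Set.mem_ofPred_eq]
    have key : ∀ hx : ‖x‖ ≤ 1, f x = f s ↔ ‖x - s‖ ≤ ‖ϖ‖ := by
      intro hx
      simp only [f, dif_pos hx, dif_pos hs]
      rw [← sub_eq_zero, ← map_sub, IsLocalRing.residue_eq_zero_iff, hϖ.mem_maximalIdeal_iff]
      rfl
    constructor
    · rintro ⟨hx, h⟩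
      exact (key hx).1 h
    · intro h
      have hx : ‖x‖ ≤ 1 := by
        simpa using norm_add_le_of_le (h.trans hϖ.2.1.le) hs
      exact ⟨hx, (key hx).2 h⟩
  rw [measure_eq_ncard_mul μ f {x | ‖x‖ ≤ 1} (μ {x | ‖x‖ ≤ ‖ϖ‖})]
  · congr 2
    rw [resCard, ← Set.ncard_univ]
    congr 1
    symm
    rw [Set.eq_univ_iff_forall]
    intro y
    obtain ⟨a, rfl⟩ := IsLocalRing.residue_surjective y
    have ha : ‖(a : K)‖ ≤ 1 := Valued.integer.norm_le_one a
    refine ⟨a, ha, ?_⟩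
    simp only [f, dif_pos ha]
  · intro s hs
    rw [hfib s hs]
    exact (isClosed_le (by fun_prop) continuous_const).measurableSet
  · intro s hs
    rw [hfib s hs, measure_ball_add_left]

end ResidueField

/-! ### Volumes of the lattices of integral matrices and integral hermitian matrices. -/

section Instances

variable {E : Type*} [NontriviallyNormedField E] [ProperSpace E] {m n : Type*} [Fintype m]
  [Fintype n]

instance : SecondCountableTopology (Matrix m n E) :=
  inferInstanceAs (SecondCountableTopology (m → n → E))

instance : LocallyCompactSpace (Matrix m n E) :=
  inferInstanceAs (LocallyCompactSpace (m → n → E))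

variable [StarRing E]

omit [ProperSpace E] [Fintype n] in
theorem isClosed_selfAdjoint_matrix [ContinuousStar E] :
    IsClosed (selfAdjoint (Matrix n n E) : Set (Matrix n n E)) := by
  have : (selfAdjoint (Matrix n n E) : Set (Matrix n n E)) = {Y | Yᴴ = Y} := rfl
  rw [this]
  exact isClosed_eq (by fun_prop) continuous_id

instance : SecondCountableTopology (HermMat n E) :=
  inferInstanceAs (SecondCountableTopology (selfAdjoint (Matrix n n E) : Set (Matrix n n E)))

instance [ContinuousStar E] : LocallyCompactSpace (HermMat n E) :=
  isClosed_selfAdjoint_matrix.isClosedEmbedding_subtypeVal.locallyCompactSpace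

end Instances

/-- The Haar measure on matrices which is the product of copies of `μ`. -/
noncomputable abbrev matVol {E : Type*} [MeasurableSpace E] (μ : Measure E) (m n : Type*)
    [Fintype m] [Fintype n] : Measure (m → n → E) :=
  Measure.pi fun _ => Measure.pi fun _ => μ

instance {E : Type*} [NontriviallyNormedField E] [ProperSpace E] [MeasurableSpace E]
    [BorelSpace E] (μ : Measure E) [μ.IsAddHaarMeasure] (m n : Type*) [Fintype m] [Fintype n] :
    (matVol μ m n).IsAddHaarMeasure := by
  have h1 : (Measure.pi fun _ : n => μ).IsAddHaarMeasure := Measure.pi.isAddHaarMeasure _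
  exact Measure.pi.isAddHaarMeasure _

instance {E : Type*} [MeasurableSpace E] (μ : Measure E) [SigmaFinite μ] (m n : Type*) [Fintype m]
    [Fintype n] : SigmaFinite (matVol μ m n) := by
  have h1 : SigmaFinite (Measure.pi fun _ : n => μ) := inferInstance
  exact Measure.pi.sigmaFinite _

theorem matVol_entryLe {E : Type*} [NontriviallyNormedField E] [MeasurableSpace E]
    (μ : Measure E) [SigmaFinite μ] (m n : Type*) [Fintype m] [Fintype n] (c : ℝ) :
    matVol μ m n {X | EntryLe (of X) c} =
      μ {x | ‖x‖ ≤ c} ^ (Fintype.card m * Fintype.card n) := by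
  have : {X : m → n → E | EntryLe (of X) c} =
      Set.univ.pi fun _ : m => Set.univ.pi fun _ : n => {x | ‖x‖ ≤ c} := by
    ext X
    simp [EntryLe, Set.mem_pi]
  rw [this, Measure.pi_pi]
  simp only [Measure.pi_pi, Finset.prod_const, Finset.card_univ, ← pow_mul]
  rw [mul_comm]

namespace UnramQuad

variable {F E : Type*} [NontriviallyNormedField F] [NontriviallyNormedField E]
    [NormedAlgebra F E] [StarRing E] {π : F} (h : UnramQuad F E π)
include h

theorem continuousStar : ContinuousStar E := by
  refine ⟨?_⟩
  refine AddMonoidHomClass.continuous_of_bound (starAddEquiv : E ≃+ E) 1 fun x => ?_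
  rw [one_mul]
  exact (h.norm_star x).le

theorem continuous_toBase [IsUltrametricDist E] : Continuous (toBase F : E → F) := by
  refine AddMonoidHomClass.continuous_of_bound (AddMonoidHom.mk' (toBase F : E → F) toBase_add) 1
    fun x => ?_
  rw [one_mul]
  exact h.norm_toBase_le x

theorem ne_zeroE : algebraMap F E π ≠ 0 := h.unifE.1

section measureE

variable [IsUltrametricDist F] [IsUltrametricDist E] [ProperSpace F] [ProperSpace E]
  [MeasurableSpace E] [BorelSpace E] (μ : Measure E) [μ.IsAddHaarMeasure]

/-- For a unit `w` with `star w = -w`, the projections `z ↦ toBase z` and `z ↦ toBase (w⁻¹ z)` do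
not increase norms. So every ball of `E` is the product of two balls of `F` in the basis `1, w`, and
`πO_E` has volume `q^{-1} · q^{-1}`. -/
theorem measure_unif (hμ : μ {x : E | ‖x‖ ≤ 1} = 1) :
    μ {x : E | ‖x‖ ≤ ‖π‖} = ((resCard F : ENNReal) ^ 2)⁻¹ := by
  obtain ⟨w, hw1, hws⟩ := h.imag
  have hw0 : w ≠ 0 := norm_pos_iff.1 (by rw [hw1]; exact one_pos)
  let _ : MeasurableSpace F := borel F
  have : BorelSpace F := ⟨rfl⟩
  let K₀ : TopologicalSpace.PositiveCompacts F := ⟨⟨Metric.closedBall 0 1, isCompact_closedBall 0 1⟩,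
    ⟨0, mem_interior_iff_mem_nhds.2 (Metric.closedBall_mem_nhds 0 one_pos)⟩⟩
  let κ : Measure F := Measure.addHaarMeasure K₀
  have hκ : κ {x : F | ‖x‖ ≤ 1} = 1 := by
    have : ((K₀ : Set F)) = {x : F | ‖x‖ ≤ 1} := by
      ext x
      change x ∈ Metric.closedBall 0 1 ↔ _
      simp
    rw [← this]
    exact Measure.addHaarMeasure_self
  have hcT := h.continuous_toBase
  let e : F × F ≃+ E :=
    { toFun := fun ab => algebraMap F E ab.1 + algebraMap F E ab.2 * w
      invFun := fun z => (toBase F z, toBase F (w⁻¹ * z))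
      left_inv := by
        rintro ⟨a, b⟩
        ext
        · apply (algebraMap F E).injective
          have h2 := h.twoE_ne
          rw [h.algebraMap_toBase]
          simp only [star_add, star_mul', h.star_algebraMap, hws]
          field_simp
          ring
        · apply (algebraMap F E).injective
          have h2 := h.twoE_ne
          rw [h.algebraMap_toBase]
          simp only [star_add, star_mul', h.star_algebraMap, hws, star_inv₀]
          field_simp
          ring
      right_inv := by
        intro z
        have h2 := h.twoE_ne
        simp only [h.algebraMap_toBase, star_mul', hws, star_inv₀]
        field_simp
        ring
      map_add' := by
        intro a b
        simp only [Prod.fst_add, Prod.snd_add, map_add]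
        ring }
  have hc : Continuous (algebraMap F E) := continuous_algebraMap F E
  have he : Continuous e := by
    change Continuous fun ab : F × F => algebraMap F E ab.1 + algebraMap F E ab.2 * w
    fun_prop
  have he' : Continuous e.symm := by
    change Continuous fun z : E => (toBase F z, toBase F (w⁻¹ * z))
    fun_prop
  have hpre : ∀ c : ℝ, e ⁻¹' {x | ‖x‖ ≤ c} = {x : F | ‖x‖ ≤ c} ×ˢ {x : F | ‖x‖ ≤ c} := by
    intro c
    ext ab
    simp only [Set.mem_preimage, Set.mem_ofPred_eq, Set.mem_prod]
    constructor
    · intro hx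
      obtain ⟨ha, hb⟩ : toBase F (e ab) = ab.1 ∧ toBase F (w⁻¹ * e ab) = ab.2 :=
        Prod.ext_iff.1 (e.left_inv ab)
      rw [← ha, ← hb]
      refine ⟨(h.norm_toBase_le _).trans hx, (h.norm_toBase_le _).trans ?_⟩
      rwa [norm_mul, norm_inv, hw1, inv_one, one_mul]
    · rintro ⟨ha, hb⟩
      refine norm_add_le_of_le ?_ ?_
      · rwa [norm_algebraMap']
      · rwa [norm_mul, norm_algebraMap', hw1, mul_one]
  have hm := measure_preimage_of_haar (κ.prod κ) μ e he he' hμ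
    (by rw [hpre, Measure.prod_prod, hκ, one_mul]) {x | ‖x‖ ≤ ‖π‖}
  rw [← hm, hpre, Measure.prod_prod, ← sq, ENNReal.inv_pow]
  congr 1
  have := h.unif.resCard_mul_measure κ
  rw [hκ, mul_comm] at this
  exact ENNReal.eq_inv_of_mul_eq_one_left this

/-- The volume of the ideal `π^d O_E`. -/
theorem measure_le_pow (hμ : μ {x : E | ‖x‖ ≤ 1} = 1) (d : ℕ) :
    μ {x : E | ‖x‖ ≤ ‖π‖ ^ d} = ((resCard F : ENNReal) ^ (2 * d))⁻¹ := by
  induction d with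
  | zero => simpa using hμ
  | succ d ih =>
    let e : E ≃+ E :=
      { toFun := fun x => (algebraMap F E π)⁻¹ * x
        invFun := fun x => algebraMap F E π * x
        left_inv := fun x => mul_inv_cancel_left₀ h.ne_zeroE x
        right_inv := fun x => inv_mul_cancel_left₀ h.ne_zeroE x
        map_add' := mul_add _ }
    have := measure_preimage_mul_of_haar μ μ e
      (by change Continuous fun x : E => (algebraMap F E π)⁻¹ * x; fun_prop)
      (by change Continuous fun x : E => algebraMap F E π * x; fun_prop)
      {x : E | ‖x‖ ≤ 1} {x : E | ‖x‖ ≤ ‖π‖ ^ d}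
    have hpre : ∀ c : ℝ, e ⁻¹' {x : E | ‖x‖ ≤ c} = {x | ‖x‖ ≤ c * ‖π‖} := by
      intro c
      ext x
      change ‖(algebraMap F E π)⁻¹ * x‖ ≤ c ↔ ‖x‖ ≤ c * ‖π‖
      rw [norm_mul, norm_inv, norm_algebraMap', inv_mul_le_iff₀ h.norm_pos, mul_comm]
    rw [hpre, hpre, hμ, mul_one, one_mul, h.measure_unif μ hμ, ih, ← pow_succ] at this
    rw [this, ← ENNReal.mul_inv, ← pow_add]
    · congr 2
      ring
    · right
      exact ENNReal.pow_ne_top (ENNReal.natCast_ne_top _)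
    · left
      exact ENNReal.pow_ne_top (ENNReal.natCast_ne_top _)

theorem matVol_le_pow (hμ : μ {x : E | ‖x‖ ≤ 1} = 1) (m n : Type*) [Fintype m] [Fintype n]
    (d : ℕ) : matVol μ m n {X | EntryLe (of X) (‖π‖ ^ d)} =
      ((resCard F : ENNReal) ^ (2 * d * (Fintype.card m * Fintype.card n)))⁻¹ := by
  rw [matVol_entryLe, h.measure_le_pow μ hμ, ← ENNReal.inv_pow, ← pow_mul]

theorem matVol_le_one (hμ : μ {x : E | ‖x‖ ≤ 1} = 1) (m n : Type*) [Fintype m] [Fintype n] :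
    matVol μ m n {X | EntryLe (of X) 1} = 1 := by
  simpa using h.matVol_le_pow μ hμ m n 0

end measureE

section measureHerm

variable [IsUltrametricDist F] [IsUltrametricDist E] [ProperSpace F] [ProperSpace E]
  [MeasurableSpace E] [BorelSpace E] (μ : Measure E) [μ.IsAddHaarMeasure]
  {N : Type*} [Fintype N] (ν : Measure (HermMat N E)) [ν.IsAddHaarMeasure]

omit [IsUltrametricDist F] [ProperSpace F] in
/-- The decomposition of square matrices into a hermitian and an antihermitian part. -/
theorem measure_herm_sq (hμ : μ {x : E | ‖x‖ ≤ 1} = 1) (hν : ν {Y | EntryLe Y.1 1} = 1) (c : ℝ) :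
    ν {Y | EntryLe Y.1 c} ^ 2 = matVol μ N N {X | EntryLe (of X) c} := by
  have := h.continuousStar
  obtain ⟨w, hw1, hws⟩ := h.imag
  have hw0 : w ≠ 0 := norm_pos_iff.1 (by rw [hw1]; exact one_pos)
  have h2 := h.twoE_ne
  obtain ⟨t, ht0⟩ : ∃ t : E, t = 2⁻¹ := ⟨_, rfl⟩
  have ht : t + t = 1 := by rw [← two_mul, ht0]; exact mul_inv_cancel₀ h2
  have hts : star t = t := by rw [ht0, h.star_half]
  have htn : ‖t‖ = 1 := by rw [ht0, norm_inv, h.norm_twoE, inv_one]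
  -- The decomposition is `X = Y + wZ` with `Y = (X + X*)/2` and `Z = w⁻¹(X - X*)/2`; here `Z` is
  -- hermitian because `star w = -w`. Both parts are bounded by `X`, since `2` and `w` have norm
  -- `1`.
  let A : (N → N → E) → Matrix N N E := fun X => t • (of X + (of X)ᴴ)
  let B : (N → N → E) → Matrix N N E := fun X => (w⁻¹ * t) • (of X - (of X)ᴴ)
  have hA : ∀ X, A X ∈ selfAdjoint (Matrix N N E) := fun X => by
    change (A X)ᴴ = A X
    simp only [A, conjTranspose_smul, conjTranspose_add, conjTranspose_conjTranspose, hts, add_comm]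
  have hB : ∀ X, B X ∈ selfAdjoint (Matrix N N E) := fun X => by
    change (B X)ᴴ = B X
    simp only [B, conjTranspose_smul, conjTranspose_sub, conjTranspose_conjTranspose, star_mul',
      hts, star_inv₀, hws, inv_neg, neg_mul, neg_smul]
    rw [← smul_neg, neg_sub]
  let e : HermMat N E × HermMat N E ≃+ (N → N → E) :=
    { toFun := fun Y => of.symm (Y.1.1 + w • Y.2.1)
      invFun := fun X => (⟨A X, hA X⟩, ⟨B X, hB X⟩)
      left_inv := by
        rintro ⟨⟨Y, hY⟩, ⟨Z, hZ⟩⟩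
        have hY : Yᴴ = Y := hY
        have hZ : Zᴴ = Z := hZ
        have e1 : Y + w • Z + (Y - w • Z) = Y + Y := by abel
        have e2 : Y + w • Z - (Y - w • Z) = w • Z + w • Z := by abel
        refine Prod.ext (Subtype.ext ?_) (Subtype.ext ?_)
        · simp only [A, Equiv.apply_symm_apply, conjTranspose_add, conjTranspose_smul, hY, hZ, hws,
            neg_smul, ← sub_eq_add_neg, e1]
          rw [smul_add, ← add_smul, ht, one_smul]
        · simp only [B, Equiv.apply_symm_apply, conjTranspose_add, conjTranspose_smul, hY, hZ, hws,
            neg_smul, ← sub_eq_add_neg, e2]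
          rw [smul_add, ← add_smul, ← mul_add, ht, mul_one, smul_smul, inv_mul_cancel₀ hw0,
            one_smul]
      right_inv := by
        intro X
        simp only [A, B]
        rw [smul_smul, ← mul_assoc, mul_inv_cancel₀ hw0, one_mul, ← smul_add, add_add_sub_cancel,
          smul_add, ← add_smul, ht, one_smul]
        rfl
      map_add' := by
        intro a b
        simp only [Prod.fst_add, Prod.snd_add, AddSubgroup.coe_add, smul_add]
        rw [add_add_add_comm]
        rfl }
  have he : Continuous e := by
    refine continuous_pi fun i => continuous_pi fun j => ?_
    change Continuous fun Y : HermMat N E × HermMat N E => Y.1.1 i j + w * Y.2.1 i j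
    have h1 : Continuous fun Y : HermMat N E × HermMat N E => Y.1.1 i j :=
      (continuous_subtype_val.comp continuous_fst).matrix_elem i j
    have h2 : Continuous fun Y : HermMat N E × HermMat N E => Y.2.1 i j :=
      (continuous_subtype_val.comp continuous_snd).matrix_elem i j
    exact h1.add (continuous_const.mul h2)
  have he' : Continuous e.symm := by
    refine Continuous.prodMk (Continuous.subtype_mk ?_ _) (Continuous.subtype_mk ?_ _)
    · refine continuous_matrix fun i j => ?_
      exact continuous_const.mul ((continuous_apply_apply i j).add (continuous_apply_apply j i).star)
    · refine continuous_matrix fun i j => ?_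
      exact continuous_const.mul ((continuous_apply_apply i j).sub (continuous_apply_apply j i).star)
  have hpre : ∀ c : ℝ, e ⁻¹' {X | EntryLe (of X) c} =
      {Y : HermMat N E | EntryLe Y.1 c} ×ˢ {Y : HermMat N E | EntryLe Y.1 c} := by
    intro c
    ext Y
    simp only [Set.mem_preimage, Set.mem_ofPred_eq, Set.mem_prod]
    constructor
    · intro hx
      have hinv := e.left_inv Y
      have ha : Y.1.1 = A (e Y) := congrArg (fun Z => Z.1.1) hinv.symm
      have hb : Y.2.1 = B (e Y) := congrArg (fun Z => Z.2.1) hinv.symm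
      rw [ha, hb]
      constructor
      · exact EntryLe.mono ((hx.add (hx.conjTranspose h)).smul htn.le) (one_mul c).le
      · refine EntryLe.mono ((hx.sub (hx.conjTranspose h)).smul (a := 1) ?_) (one_mul c).le
        rw [norm_mul, norm_inv, hw1, htn, inv_one, one_mul]
    · rintro ⟨ha, hb⟩
      refine EntryLe.add ha ?_
      simpa using hb.smul hw1.le
  have hm := measure_preimage_of_haar (ν.prod ν) (matVol μ N N) e he he'
    (K := {X | EntryLe (of X) 1}) (by rw [matVol_entryLe, hμ, one_pow])
    (by rw [hpre, Measure.prod_prod, hν, one_mul]) {X | EntryLe (of X) c}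
  rw [← hm, hpre, Measure.prod_prod, sq]

/-- The square of this volume is the volume of `π M_N(O_E)`, and squaring is injective on `[0, ∞]`.
-/
theorem measure_herm_unif (hμ : μ {x : E | ‖x‖ ≤ 1} = 1) (hν : ν {Y | EntryLe Y.1 1} = 1) :
    ν {Y | EntryLe Y.1 ‖π‖} = ((resCard F : ENNReal) ^ (Fintype.card N ^ 2))⁻¹ := by
  have h1 := h.measure_herm_sq μ ν hμ hν ‖π‖
  have h2 := h.matVol_le_pow μ hμ N N 1
  rw [pow_one] at h2
  rw [h2] at h1
  rw [← ENNReal.pow_right_strictMono (n := 2) two_ne_zero |>.injective.eq_iff, h1,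
    ← ENNReal.inv_pow, ← pow_mul]
  congr 2
  ring

omit [IsUltrametricDist F] [ProperSpace F] [MeasurableSpace E] [BorelSpace E] in
theorem measure_herm_zpow_succ (hν : ν {Y | EntryLe Y.1 1} = 1) (k : ℤ) :
    ν {Y | EntryLe Y.1 (‖π‖ ^ (k + 1))} =
      ν {Y | EntryLe Y.1 ‖π‖} * ν {Y | EntryLe Y.1 (‖π‖ ^ k)} := by
  have := h.continuousStar
  have h0 := h.ne_zeroE
  have hs : star (algebraMap F E π) = algebraMap F E π := h.star_algebraMap π
  let e : HermMat N E ≃+ HermMat N E :=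
    { toFun := fun Y => ⟨(algebraMap F E π)⁻¹ • Y.1, by
        change ((algebraMap F E π)⁻¹ • Y.1)ᴴ = (algebraMap F E π)⁻¹ • Y.1
        have : Y.1ᴴ = Y.1 := Y.2
        rw [conjTranspose_smul, star_inv₀, hs, this]⟩
      invFun := fun Y => ⟨algebraMap F E π • Y.1, by
        change (algebraMap F E π • Y.1)ᴴ = algebraMap F E π • Y.1
        have : Y.1ᴴ = Y.1 := Y.2
        rw [conjTranspose_smul, hs, this]⟩
      left_inv := fun Y => Subtype.ext (smul_inv_smul₀ h0 Y.1)
      right_inv := fun Y => Subtype.ext (inv_smul_smul₀ h0 Y.1)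
      map_add' := fun Y Z => Subtype.ext (by simp) }
  have he : Continuous e :=
    Continuous.subtype_mk (continuous_subtype_val.const_smul (algebraMap F E π)⁻¹) _
  have he' : Continuous e.symm :=
    Continuous.subtype_mk (continuous_subtype_val.const_smul (algebraMap F E π)) _
  have hpre : ∀ c : ℝ, e ⁻¹' {Y | EntryLe Y.1 c} = {Y | EntryLe Y.1 (c * ‖π‖)} := by
    intro c
    ext Y
    have : ∀ i j, ‖(e Y).1 i j‖ ≤ c ↔ ‖Y.1 i j‖ ≤ c * ‖π‖ := fun i j => by
      change ‖(algebraMap F E π)⁻¹ * Y.1 i j‖ ≤ c ↔ _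
      rw [norm_mul, norm_inv, norm_algebraMap', inv_mul_le_iff₀ h.norm_pos, mul_comm]
    exact forall_congr' fun i => forall_congr' fun j => this i j
  have := measure_preimage_mul_of_haar ν ν e he he' {Y | EntryLe Y.1 1}
    {Y | EntryLe Y.1 (‖π‖ ^ k)}
  rwa [hpre, hpre, hν, mul_one, one_mul, ← zpow_add_one₀ h.norm_pos.ne'] at this

/-- This is the normalizing power of `q` in front of the volumes in `whitTrunc_eq` and
`densApprox_eq`. -/
theorem measure_herm_neg (hμ : μ {x : E | ‖x‖ ≤ 1} = 1) (hν : ν {Y | EntryLe Y.1 1} = 1) (d : ℕ) :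
    ν {Y | EntryLe Y.1 (‖π‖ ^ (-(d : ℤ)))} = (resCard F : ENNReal) ^ (d * Fintype.card N ^ 2) := by
  have hq0 : (resCard F : ENNReal) ≠ 0 :=
    Nat.cast_ne_zero.2 (zero_lt_one.trans h.unif.one_lt_resCard).ne'
  have hqt : (resCard F : ENNReal) ≠ ⊤ := ENNReal.natCast_ne_top _
  induction d with
  | zero => simpa using hν
  | succ d ih =>
    have := h.measure_herm_zpow_succ ν hν (-((d + 1 : ℕ) : ℤ))
    rw [show -((d + 1 : ℕ) : ℤ) + 1 = -(d : ℤ) by push_cast; ring, ih,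
      h.measure_herm_unif μ ν hμ hν] at this
    have h3 := congrArg (fun z => (resCard F : ENNReal) ^ (Fintype.card N ^ 2) * z) this
    simp only [← mul_assoc] at h3
    rw [ENNReal.mul_inv_cancel (pow_ne_zero _ hq0) (ENNReal.pow_ne_top hqt), one_mul, ← pow_add]
      at h3
    rw [← h3]
    congr 1
    ring

end measureHerm

end UnramQuad

/-! ### Orthogonality of characters on hermitian matrices. -/

/-- If `f` is multiplied by `c ≠ 1` under a translation that preserves `S`, then its integral over
`S` vanishes. -/
theorem setIntegral_eq_zero_of_translate {G : Type*} [AddGroup G] [MeasurableSpace G]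
    [MeasurableAdd G] (ν : Measure G) [ν.IsAddRightInvariant] {S : Set G} (hS : MeasurableSet S)
    {f : G → ℂ} {g : G} {c : ℂ} (hc : c ≠ 1) (hg : ∀ y, y + g ∈ S ↔ y ∈ S)
    (hf : ∀ y, f (y + g) = c * f y) : ∫ y in S, f y ∂ν = 0 := by
  have h1 : ∫ y in S, f y ∂ν = c * ∫ y in S, f y ∂ν := by
    rw [← integral_indicator hS]
    nth_rw 1 [← integral_add_right_eq_self (S.indicator f) g]
    rw [← integral_const_mul]
    refine integral_congr_ae (Eventually.of_forall fun y => ?_)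
    by_cases hy : y ∈ S
    · simp only [Set.indicator_of_mem hy, Set.indicator_of_mem ((hg y).2 hy), hf]
    · simp only [Set.indicator_of_notMem hy, Set.indicator_of_notMem (mt (hg y).1 hy), mul_zero]
  have h2 : (1 - c) * ∫ y in S, f y ∂ν = 0 := by
    rw [sub_mul, one_mul, ← h1, sub_self]
  exact (mul_eq_zero.1 h2).resolve_left (sub_ne_zero.2 hc.symm)

theorem act_isHermitian {E : Type*} [NontriviallyNormedField E] [StarRing E] {m n : Type*}
    [Fintype m] [Fintype n] {A : Matrix m m E} (hA : A.IsHermitian) (X : Matrix m n E) :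
    (act A X).IsHermitian := by
  simp [act, IsHermitian, hA.eq, Matrix.mul_assoc]

theorem stab_isHermitian {E : Type*} [NontriviallyNormedField E] [StarRing E] {m : Type*}
    {A : Matrix m m E} (hA : A.IsHermitian) (r : ℕ) : (stab A r).IsHermitian := by
  simp [stab, IsHermitian, fromBlocks_conjTranspose, hA.eq]

/-- Being trivial on the unit ball, `ψ` is locally constant. -/
theorem continuous_addChar {F : Type*} [NontriviallyNormedField F] {ψ : AddChar F Circle}
    (hψ : ∀ a : F, ‖a‖ ≤ 1 → ψ a = 1) : Continuous ψ := by
  rw [continuous_iff_continuousAt]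
  intro x
  refine ContinuousAt.congr (f := fun _ => ψ x) continuousAt_const ?_
  filter_upwards [Metric.closedBall_mem_nhds x one_pos] with y hy
  have : ψ (y - x) = 1 := hψ _ (by rwa [← dist_eq_norm])
  rw [AddChar.map_sub_eq_div, div_eq_one] at this
  exact this.symm

namespace UnramQuad

variable {F E : Type*} [NontriviallyNormedField F] [NontriviallyNormedField E]
    [NormedAlgebra F E] [StarRing E] {π : F} (h : UnramQuad F E π) [IsUltrametricDist E]
    {ψ : AddChar F Circle} {N : Type*} [Fintype N]
include h

omit [IsUltrametricDist E] in
theorem toBase_algebraMap (b : F) : toBase F (algebraMap F E b) = b := by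
  apply (algebraMap F E).injective
  have h2 := h.twoE_ne
  rw [h.algebraMap_toBase, h.star_algebraMap]
  field_simp
  ring

omit [IsUltrametricDist E] in
theorem gramA_isHermitian (n t : ℕ) : (gramA E π n t).IsHermitian := by
  rw [IsHermitian, gramA, diagonal_conjTranspose]
  congr 1
  ext i
  simp only [Pi.star_apply]
  split_ifs
  · exact star_one E
  · rw [star_inv₀, h.star_algebraMap]

theorem norm_trace_mul_le {X Y : Matrix N N E} {a b : ℝ} (hX : EntryLe X a) (hY : EntryLe Y b)
    (ha : 0 ≤ a) (hb : 0 ≤ b) : ‖toBase F (trace (X * Y))‖ ≤ a * b := by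
  refine (h.norm_toBase_le _).trans ?_
  refine IsUltrametricDist.norm_sum_le_of_forall_le_of_nonneg (mul_nonneg ha hb) fun k _ => ?_
  exact hX.mul hY ha hb k k

/-- Let `z` be an entry of `Z` outside `π^d O_E` and let `ψ(b) ≠ 1` with `‖b‖ ≤ ‖π‖⁻¹`. By
discreteness `‖z‖ ≥ ‖π‖^{d-1}`, so `a = b/z` lies in `π^{-d} O_E`. The hermitian matrix with `a/2`
and `star a / 2` in the two places dual to `z` (their sum, on the diagonal) has trace pairing
exactly `b` with `Z`. -/
theorem exists_char_ne_one (hψ' : ∃ a : F, ‖a‖ ≤ ‖π‖⁻¹ ∧ ψ a ≠ 1) {Z : Matrix N N E}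
    (hZ : Z.IsHermitian) {d : ℕ} (hd : ¬ EntryLe Z (‖π‖ ^ d)) :
    ∃ Y : HermMat N E, EntryLe Y.1 (‖π‖ ^ (-(d : ℤ))) ∧ ψ (toBase F (trace (Y.1 * Z))) ≠ 1 := by
  classical
  obtain ⟨b, hb, hψb⟩ := hψ'
  simp only [EntryLe, not_forall, not_le] at hd
  obtain ⟨j, i, hij⟩ := hd
  have hp := h.norm_pos
  have hz0 : Z j i ≠ 0 := norm_pos_iff.1 (lt_trans (by positivity) hij)
  have hz : ‖π‖ ^ ((d : ℤ) - 1) ≤ ‖Z j i‖ := by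
    by_contra hlt
    have := h.le_of_lt_zpow (not_le.1 hlt)
    rw [sub_add_cancel, zpow_natCast] at this
    exact absurd hij (not_lt.2 this)
  let a : E := algebraMap F E b / Z j i
  have ha : ‖a‖ ≤ ‖π‖ ^ (-(d : ℤ)) := by
    rw [norm_div, norm_algebraMap']
    rw [div_le_iff₀ (norm_pos_iff.2 hz0)]
    refine hb.trans ?_
    calc ‖π‖⁻¹ = ‖π‖ ^ (-(d : ℤ)) * ‖π‖ ^ ((d : ℤ) - 1) := by
          rw [← zpow_add₀ hp.ne', ← _root_.zpow_neg_one]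
          congr 1
          ring
      _ ≤ _ := mul_le_mul_of_nonneg_left hz (by positivity)
  have haZ : a * Z j i = algebraMap F E b := by
    rw [div_mul_cancel₀ _ hz0]
  let Y : Matrix N N E := (2 : E)⁻¹ • (single i j a + single j i (star a))
  have hY : Y.IsHermitian := by
    simp only [Y, IsHermitian, conjTranspose_smul, conjTranspose_add, conjTranspose_single, star_star,
      h.star_half]
    rw [add_comm]
  refine ⟨⟨Y, hY⟩, ?_, ?_⟩
  · intro k l
    have hs : ∀ (u v : N) (x : E), ‖x‖ ≤ ‖π‖ ^ (-(d : ℤ)) → ‖single u v x k l‖ ≤ ‖π‖ ^ (-(d : ℤ)) := by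
      intro u v x hx
      rw [single_apply]
      split_ifs
      · exact hx
      · rw [norm_zero]
        positivity
    have ha' := hs j i (star a) (by rwa [h.norm_star])
    change ‖(2 : E)⁻¹ * (single i j a k l + single j i (star a) k l)‖ ≤ _
    rw [norm_mul, norm_inv, h.norm_twoE, inv_one, one_mul]
    exact norm_add_le_of_le (hs i j a ha) ha'
  · have : trace (Y * Z) = algebraMap F E b := by
      simp only [Y, Matrix.smul_mul, trace_smul, Matrix.add_mul, trace_add, trace_single_mul]
      have h1 : star a * Z i j = algebraMap F E b := by
        rw [← hZ.apply i j, ← star_mul', haZ, h.star_algebraMap]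
      have h2 := h.twoE_ne
      simp only [smul_eq_mul, haZ, h1]
      field_simp
      ring
    rw [this, toBase_algebraMap h]
    exact hψb

theorem continuous_char_trace (hψ : ∀ a : F, ‖a‖ ≤ 1 → ψ a = 1) {α : Type*} [TopologicalSpace α]
    {Y Z : α → Matrix N N E} (hY : Continuous Y) (hZ : Continuous Z) :
    Continuous fun x => ((ψ (toBase F (trace (Y x * Z x))) : Circle) : ℂ) := by
  refine continuous_subtype_val.comp ((continuous_addChar hψ).comp (h.continuous_toBase.comp ?_))
  exact (hY.matrix_mul hZ).matrix_trace

omit [StarRing E] [IsUltrametricDist E] [Fintype N] h in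
theorem isClosed_entryLe {α m n : Type*} [TopologicalSpace α] {Z : α → Matrix m n E}
    (hZ : Continuous Z) (c : ℝ) : IsClosed {x | EntryLe (Z x) c} := by
  simp only [EntryLe, Set.ofPred_forall]
  refine isClosed_iInter fun i => isClosed_iInter fun j => ?_
  exact isClosed_le (hZ.matrix_elem i j).norm continuous_const

variable (ν : Measure (HermMat N E)) [ν.IsAddHaarMeasure]

/-- Orthogonality of characters on the space of hermitian matrices. -/
theorem integral_char_trace (hψ : ∀ a : F, ‖a‖ ≤ 1 → ψ a = 1)
    (hψ' : ∃ a : F, ‖a‖ ≤ ‖π‖⁻¹ ∧ ψ a ≠ 1) {Z : Matrix N N E} (hZ : Z.IsHermitian) (d : ℕ)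
    [Decidable (EntryLe Z (‖π‖ ^ d))] :
    ∫ Y in {Y : HermMat N E | EntryLe Y.1 (‖π‖ ^ (-(d : ℤ)))},
      ((ψ (toBase F (trace (Y.1 * Z))) : Circle) : ℂ) ∂ν =
    if EntryLe Z (‖π‖ ^ d) then
      ((ν.real {Y : HermMat N E | EntryLe Y.1 (‖π‖ ^ (-(d : ℤ)))} : ℝ) : ℂ) else 0 := by
  have hp := h.norm_pos
  have hmeas : MeasurableSet {Y : HermMat N E | EntryLe Y.1 (‖π‖ ^ (-(d : ℤ)))} :=
    (isClosed_entryLe continuous_subtype_val _).measurableSet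
  split_ifs with hd
  · rw [setIntegral_congr_fun (g := fun _ => (1 : ℂ)) hmeas]
    · simp
    · intro Y hY
      have := h.norm_trace_mul_le hY hd (by positivity) (by positivity)
      rw [_root_.zpow_neg, zpow_natCast, inv_mul_cancel₀ (by positivity)] at this
      simp only [hψ _ this, Circle.coe_one]
  · obtain ⟨Y₀, hY₀, hne⟩ := h.exists_char_ne_one hψ' hZ hd
    refine setIntegral_eq_zero_of_translate ν hmeas (g := Y₀)
      (c := ((ψ (toBase F (trace (Y₀.1 * Z))) : Circle) : ℂ)) ?_ ?_ ?_
    · exact fun hc => hne (Circle.ext hc)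
    · intro Y
      exact ⟨fun hY => by simpa using hY.sub hY₀, fun hY => hY.add hY₀⟩
    · intro Y
      rw [AddSubgroup.coe_add, Matrix.add_mul, trace_add, toBase_add, AddChar.map_add_eq_mul,
        Circle.coe_mul, mul_comm]

variable [ProperSpace E]

/-- The integral over hermitian `Y` of an integral of a character picks out the congruence
`Z ≡ 0`. -/
theorem integral_integral_char (hψ : ∀ a : F, ‖a‖ ≤ 1 → ψ a = 1)
    (hψ' : ∃ a : F, ‖a‖ ≤ ‖π‖⁻¹ ∧ ψ a ≠ 1) {α : Type*} [TopologicalSpace α]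
    [SecondCountableTopology α] [MeasurableSpace α] [OpensMeasurableSpace α] (κ : Measure α)
    [SFinite κ] {Z : α → Matrix N N E} (hZ : ∀ x, (Z x).IsHermitian) (hZc : Continuous Z)
    {A : Set α} (hA : κ A ≠ ⊤) (d : ℕ)
    (hfin : ν {Y : HermMat N E | EntryLe Y.1 (‖π‖ ^ (-(d : ℤ)))} ≠ ⊤) :
    ∫ Y in {Y : HermMat N E | EntryLe Y.1 (‖π‖ ^ (-(d : ℤ)))},
      ∫ x in A, ((ψ (toBase F (trace (Y.1 * Z x))) : Circle) : ℂ) ∂κ ∂ν =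
    (ν.real {Y : HermMat N E | EntryLe Y.1 (‖π‖ ^ (-(d : ℤ)))} *
      κ.real {x | x ∈ A ∧ EntryLe (Z x) (‖π‖ ^ d)} : ℝ) := by
  classical
  have := h.continuousStar
  have : IsFiniteMeasure (κ.restrict A) := isFiniteMeasure_restrict.2 hA
  have : IsFiniteMeasure (ν.restrict {Y : HermMat N E | EntryLe Y.1 (‖π‖ ^ (-(d : ℤ)))}) :=
    isFiniteMeasure_restrict.2 hfin
  have hE : MeasurableSet {x | EntryLe (Z x) (‖π‖ ^ d)} := (isClosed_entryLe hZc _).measurableSet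
  rw [integral_integral_swap]
  · simp_rw [h.integral_char_trace ν hψ hψ' (hZ _) d]
    have : ∀ x, (if EntryLe (Z x) (‖π‖ ^ d) then
        ((ν.real {Y : HermMat N E | EntryLe Y.1 (‖π‖ ^ (-(d : ℤ)))} : ℝ) : ℂ) else 0) =
        {x | EntryLe (Z x) (‖π‖ ^ d)}.indicator (fun _ =>
        ((ν.real {Y : HermMat N E | EntryLe Y.1 (‖π‖ ^ (-(d : ℤ)))} : ℝ) : ℂ)) x := fun x => rfl
    simp_rw [this]
    rw [integral_indicator hE, setIntegral_const, measureReal_restrict_apply hE, Set.inter_comm]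
    rw [mul_comm, Complex.ofReal_mul]
    rfl
  · refine Integrable.of_bound (C := 1) ?_ (Eventually.of_forall fun x => ?_)
    · refine Continuous.aestronglyMeasurable ?_
      exact h.continuous_char_trace hψ (continuous_subtype_val.comp continuous_fst)
        (hZc.comp continuous_snd)
    · exact (Circle.norm_coe _).le

end UnramQuad

/-! ### Whittaker integrals and representation densities as volumes of congruence sets. -/

theorem matVol_entryLe_sub {E : Type*} [NontriviallyNormedField E] [ProperSpace E]
    [MeasurableSpace E] [BorelSpace E] (μ : Measure E) [μ.IsAddHaarMeasure] {m n : Type*}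
    [Fintype m] [Fintype n] (s : m → n → E) (c : ℝ) :
    matVol μ m n {x | EntryLe (of x - of s) c} = matVol μ m n {x | EntryLe (of x) c} := by
  have := measure_preimage_add_right (matVol μ m n) (-s) {x | EntryLe (of x) c}
  simpa [Set.preimage, sub_eq_add_neg, EntryLe] using this

theorem continuous_act {E : Type*} [NontriviallyNormedField E] [StarRing E] [ContinuousStar E]
    {m n : Type*} [Fintype m] [Fintype n] (A : Matrix m m E) :
    Continuous fun x : m → n → E => act A (of x) := by
  have hX : Continuous fun x : m → n → E => (of x : Matrix m n E) := continuous_id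
  exact (hX.matrix_conjTranspose.matrix_mul continuous_const).matrix_mul hX

theorem isClosed_suppSet {F E : Type*} [NontriviallyNormedField F] [NontriviallyNormedField E]
    (π : F) (n k t r : ℕ) : IsClosed (suppSet E π n k t r) := by
  simp only [suppSet, Set.ofPred_and, Set.ofPred_forall]
  refine IsClosed.inter ?_ ?_
  · refine isClosed_iInter fun i => isClosed_iInter fun j => ?_
    exact isClosed_le (continuous_apply_apply i j).norm continuous_const
  · refine isClosed_iInter fun i => isClosed_iInter fun j => isClosed_iInter fun _ =>
      isClosed_iInter fun _ => ?_
    exact isClosed_le (continuous_apply_apply _ j).norm continuous_const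

namespace UnramQuad

variable {F E : Type*} [NontriviallyNormedField F] [NontriviallyNormedField E]
    [NormedAlgebra F E] [StarRing E] {π : F} (h : UnramQuad F E π) [IsUltrametricDist E]
    [IsUltrametricDist F] [ProperSpace F] [ProperSpace E] [MeasurableSpace E] [BorelSpace E]
    (μ : Measure E) [μ.IsAddHaarMeasure]
include h

/-- The support is compact, so the integrals may be exchanged. Integrating over `Y` first leaves the
indicator of the congruence times the volume of `π^{-d} V_{2n}(O_E)`. -/
theorem whitTrunc_eq {ψ : AddChar F Circle} (hψ : ∀ a : F, ‖a‖ ≤ 1 → ψ a = 1)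
    (hψ' : ∃ a : F, ‖a‖ ≤ ‖π‖⁻¹ ∧ ψ a ≠ 1) (hμ : μ {x : E | ‖x‖ ≤ 1} = 1) {n : ℕ}
    (ν : Measure (HermMat (Fin (n + n)) E)) [ν.IsAddHaarMeasure]
    (hν : ν {Y | EntryLe Y.1 1} = 1) {B : Matrix (Fin (n + n)) (Fin (n + n)) E}
    (hB : B.IsHermitian) (k t r d : ℕ) :
    whitTrunc π ψ μ ν k t B r d = (((resCard F : ℝ) ^ (d * (n + n) ^ 2) *
      (matVol μ _ _).real {X | X ∈ suppSet E π n k t r ∧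
        EntryLe (act (stab (gramA E π n t) r) (of X) - B) (‖π‖ ^ d)} : ℝ) : ℂ) := by
  have := h.continuousStar
  have hS : MeasurableSet (suppSet E π n k t r) := (isClosed_suppSet π n k t r).measurableSet
  have hfin : matVol μ _ _ (suppSet E π n k t r) ≠ ⊤ := by
    refine ne_top_of_le_ne_top ENNReal.one_ne_top ?_
    rw [← h.matVol_le_one μ hμ (Fin (n + n) ⊕ Fin (2 * r)) (Fin (n + n))]
    exact measure_mono fun X hX => hX.1
  have hνd := h.measure_herm_neg μ ν hμ hν d
  have key := h.integral_integral_char ν hψ hψ' (matVol μ (Fin (n + n) ⊕ Fin (2 * r)) (Fin (n + n)))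
    (Z := fun X => act (stab (gramA E π n t) r) (of X) - B)
    (fun X => (act_isHermitian (stab_isHermitian (h.gramA_isHermitian n t) r) (of X)).sub hB)
    ((continuous_act _).sub continuous_const) hfin d
    (by rw [hνd]; exact ENNReal.pow_ne_top (ENNReal.natCast_ne_top _))
  rw [measureReal_def, hνd, ENNReal.toReal_pow, ENNReal.toReal_natCast, Fintype.card_fin] at key
  rw [← key, whitTrunc]
  refine setIntegral_congr_fun (isClosed_entryLe continuous_subtype_val _).measurableSet
    fun Y _ => ?_
  rw [← integral_indicator hS]
  refine integral_congr_ae (Eventually.of_forall fun X => ?_)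
  by_cases hX : X ∈ suppSet E π n k t r
  · simp [hX]
  · simp [hX]

omit [IsUltrametricDist F] [ProperSpace F] [ProperSpace E] [MeasurableSpace E] [BorelSpace E] in
theorem mem_piIdeal_iff (d : ℕ) (y : Valued.integer E) :
    y ∈ piIdeal E π d ↔ ‖(y : E)‖ ≤ ‖π‖ ^ d := by
  have hn : ‖algebraMap F E π ^ d‖ = ‖π‖ ^ d := by rw [norm_pow, norm_algebraMap']
  have h1 : ‖algebraMap F E π ^ d‖ ≤ 1 := by
    rw [hn]
    exact pow_le_one₀ h.norm_pos.le h.norm_lt_one.le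
  have hset : {y : Valued.integer E | (y : E) = algebraMap F E π ^ d} =
      {⟨algebraMap F E π ^ d, Valued.integer.mem_iff.2 h1⟩} := by
    ext y
    rw [Set.mem_ofPred_eq, Set.mem_singleton_iff, Subtype.ext_iff]
  rw [piIdeal, hset, Ideal.mem_span_singleton']
  have h0 : algebraMap F E π ^ d ≠ 0 := pow_ne_zero _ h.ne_zeroE
  constructor
  · rintro ⟨a, rfl⟩
    change ‖(a : E) * algebraMap F E π ^ d‖ ≤ _
    rw [norm_mul, hn]
    exact mul_le_of_le_one_left (h.norm_pow_pos d).le (Valued.integer.norm_le_one a)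
  · intro hy
    refine ⟨⟨(y : E) / algebraMap F E π ^ d, Valued.integer.mem_iff.2 ?_⟩, Subtype.ext ?_⟩
    · rw [norm_div, hn]
      exact div_le_one_of_le₀ hy (h.norm_pow_pos d).le
    · exact div_mul_cancel₀ _ h0

omit [IsUltrametricDist F] [ProperSpace F] [ProperSpace E] [MeasurableSpace E] [BorelSpace E] in
theorem entryLe_act_sub_act {m n : Type*} [Fintype m] [Fintype n] {A : Matrix m m E}
    (hA : EntryLe A 1) {x y : Matrix m n E} (hx : EntryLe x 1) (hy : EntryLe y 1) {c : ℝ}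
    (hc : 0 ≤ c) (hxy : EntryLe (x - y) c) : EntryLe (act A x - act A y) c := by
  have : act A x - act A y = xᴴ * A * (x - y) + (x - y)ᴴ * A * y := by
    simp only [act, conjTranspose_sub, Matrix.mul_sub, Matrix.sub_mul]
    abel
  rw [this]
  refine EntryLe.add ?_ ?_
  · exact ((hx.conjTranspose h).mul_one_left hA zero_le_one).mul_one_left hxy hc
  · exact ((hxy.conjTranspose h).mul_one_right hA hc).mul_one_right hy hc

/-- The number of solutions of a congruence as a volume. -/
theorem densApprox_eq (hμ : μ {x : E | ‖x‖ ≤ 1} = 1) {m n : Type*} [Fintype m] [Fintype n]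
    {A : Matrix m m E} (hA : EntryLe A 1) (B : Matrix n n E) (d : ℕ) :
    densApprox π A B d = (((resCard F : ℝ) ^ (d * Fintype.card n ^ 2) *
      (matVol μ m n).real {x | EntryLe (of x) 1 ∧ EntryLe (act A (of x) - B) (‖π‖ ^ d)} : ℝ) : ℂ) := by
  classical
  have hd0 := (h.norm_pow_pos d).le
  have hd1 : ‖π‖ ^ d ≤ 1 := pow_le_one₀ h.norm_pos.le h.norm_lt_one.le
  have hfq : Finite (Valued.integer E ⧸ piIdeal E π d) :=
    finite_quotient_integer _ (h.norm_pow_pos d) fun x hx => (h.mem_piIdeal_iff d x).2 hx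
  set S : Set (m → n → E) :=
    {x | EntryLe (of x) 1 ∧ EntryLe (act A (of x) - B) (‖π‖ ^ d)} with hS
  let g : E → Valued.integer E ⧸ piIdeal E π d := fun x =>
    if hx : ‖x‖ ≤ 1 then Ideal.Quotient.mk _ ⟨x, Valued.integer.mem_iff.2 hx⟩ else 0
  have hg : ∀ x y : E, ‖x‖ ≤ 1 → ‖y‖ ≤ 1 → (g x = g y ↔ ‖x - y‖ ≤ ‖π‖ ^ d) := by
    intro x y hx hy
    simp only [g, dif_pos hx, dif_pos hy]
    rw [Ideal.Quotient.eq, h.mem_piIdeal_iff]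
    rfl
  let f : (m → n → E) → Matrix m n (Valued.integer E ⧸ piIdeal E π d) :=
    fun x => of fun i j => g (x i j)
  -- Being a solution depends only on the class modulo `π^d`, so each fibre is a full residue class.
  have hfib : ∀ s ∈ S, {x | x ∈ S ∧ f x = f s} = {x | EntryLe (of x - of s) (‖π‖ ^ d)} := by
    rintro s ⟨hs1, hs2⟩
    ext x
    simp only [Set.mem_ofPred_eq]
    have key : EntryLe (of x) 1 → (f x = f s ↔ EntryLe (of x - of s) (‖π‖ ^ d)) := by
      intro hx
      rw [← Matrix.ext_iff]
      exact forall_congr' fun i => forall_congr' fun j => hg _ _ (hx i j) (hs1 i j)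
    constructor
    · rintro ⟨⟨hx1, _⟩, hx2⟩
      exact (key hx1).1 hx2
    · intro hx
      have hx1 : EntryLe (of x) 1 := by simpa using (hx.mono hd1).add hs1
      refine ⟨⟨hx1, ?_⟩, (key hx1).2 hx⟩
      have := (h.entryLe_act_sub_act hA hx1 hs1 hd0 hx).add hs2
      rwa [sub_add_sub_cancel] at this
  have himg : f '' S = solSet π A B d := by
    ext y
    constructor
    · rintro ⟨x, ⟨hx1, hx2⟩, rfl⟩
      have hB : ∀ i j, ‖(act A (of x) - B) i j‖ ≤ 1 := fun i j => (hx2 i j).trans hd1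
      refine ⟨of fun i j => ⟨x i j, Valued.integer.mem_iff.2 (hx1 i j)⟩, fun i j => ?_, ?_⟩
      · exact ⟨⟨_, Valued.integer.mem_iff.2 (hB i j)⟩, (h.mem_piIdeal_iff d _).2 (hx2 i j), rfl⟩
      · ext i j
        have : ‖x i j‖ ≤ 1 := hx1 i j
        simp only [map_apply, of_apply, f, g, dif_pos this]
    · rintro ⟨x, hx, rfl⟩
      refine ⟨fun i j => (x i j : E), ⟨fun i j => Valued.integer.norm_le_one (x i j), fun i j => ?_⟩,
        ?_⟩
      · obtain ⟨c, hc, hc'⟩ := hx i j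
        exact (congrArg norm hc').trans_le ((h.mem_piIdeal_iff d c).1 hc)
      · ext i j
        have : ‖(x i j : E)‖ ≤ 1 := Valued.integer.norm_le_one (x i j)
        simp only [map_apply, of_apply, f, g, dif_pos this]
  have hmS := measure_eq_ncard_mul (matVol μ m n) f S _
    (fun s hs => by
      rw [hfib s hs]
      exact (isClosed_entryLe (Z := fun x : m → n → E => of x - of s)
        (Continuous.sub (f := fun x : m → n → E => (of x : Matrix m n E)) continuous_id continuous_const) _).measurableSet)
    (fun s hs => by rw [hfib s hs, matVol_entryLe_sub, h.matVol_le_pow μ hμ])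
  have hq : (resCard F : ℂ) ≠ 0 :=
    Nat.cast_ne_zero.2 (zero_lt_one.trans h.unif.one_lt_resCard).ne'
  rw [densApprox, measureReal_def, hmS, himg, ENNReal.toReal_mul, ENNReal.toReal_inv,
    ENNReal.toReal_pow, ENNReal.toReal_natCast, ENNReal.toReal_natCast]
  push_cast
  rw [mul_comm _ ((resCard F : ℂ) ^ _)⁻¹, ← mul_assoc]
  congr 1
  -- The exponents agree because `-dn(2m - n) = dn² - 2dmn`, where `q^{-2dmn}` is the volume of a
  -- residue class.
  rw [← zpow_natCast, ← zpow_natCast, ← _root_.zpow_neg, ← _root_.zpow_mul, ← zpow_add₀ hq]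
  congr 1
  push_cast
  ring

end UnramQuad

/-! ### Block decomposition, changes of variables, and elimination of the block `R`. -/

section

variable {E : Type*} [NontriviallyNormedField E] {m n p s a b : Type*}

/-- The matrix with blocks `P, Q, R, U` for `y = ((Q, U), (P, R))`, after reindexing. -/
def blockFun (ρ : p ⊕ s ≃ m) (σ : a ⊕ b ≃ n)
    (y : ((p → b → E) × (s → b → E)) × ((p → a → E) × (s → a → E))) : m → n → E :=
  fun i j => fromBlocks (of y.2.1) (of y.1.1) (of y.2.2) (of y.1.2) (ρ.symm i) (σ.symm j)

omit [NontriviallyNormedField E] in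
theorem submatrix_blockFun (ρ : p ⊕ s ≃ m) (σ : a ⊕ b ≃ n)
    (y : ((p → b → E) × (s → b → E)) × ((p → a → E) × (s → a → E))) :
    (of (blockFun ρ σ y)).submatrix ρ σ =
      fromBlocks (of y.2.1) (of y.1.1) (of y.2.2) (of y.1.2) := by
  ext i j
  simp [blockFun]

theorem entryLe_submatrix_iff (ρ : p ≃ m) (σ : a ≃ n) {X : Matrix m n E} {c : ℝ} :
    EntryLe (X.submatrix ρ σ) c ↔ EntryLe X c := by
  refine ⟨fun hX i j => ?_, fun hX i j => hX _ _⟩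
  have := hX (ρ.symm i) (σ.symm j)
  simpa using this

theorem entryLe_fromBlocks_iff {A : Matrix p a E} {B : Matrix p b E} {C : Matrix s a E}
    {D : Matrix s b E} {c : ℝ} :
    EntryLe (fromBlocks A B C D) c ↔
      (EntryLe A c ∧ EntryLe B c) ∧ (EntryLe C c ∧ EntryLe D c) := by
  simp only [EntryLe, Sum.forall, fromBlocks_apply₁₁, fromBlocks_apply₁₂, fromBlocks_apply₂₁,
    fromBlocks_apply₂₂, forall_and]
  tauto

theorem entryLe_blockFun_iff (ρ : p ⊕ s ≃ m) (σ : a ⊕ b ≃ n)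
    (y : ((p → b → E) × (s → b → E)) × ((p → a → E) × (s → a → E))) (c : ℝ) :
    EntryLe (of (blockFun ρ σ y)) c ↔ (EntryLe (of y.1.1) c ∧ EntryLe (of y.1.2) c) ∧
      (EntryLe (of y.2.1) c ∧ EntryLe (of y.2.2) c) := by
  rw [← entryLe_submatrix_iff ρ σ, submatrix_blockFun, entryLe_fromBlocks_iff]
  tauto

theorem submatrix_act [StarRing E] [Fintype m] [Fintype n] [Fintype p] (ρ : p ≃ m) (σ : a → n)
    (A : Matrix m m E) (X : Matrix m n E) [Fintype a] :
    (act A X).submatrix σ σ = act (A.submatrix ρ ρ) (X.submatrix ρ σ) := by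
  rw [act, act, conjTranspose_submatrix, submatrix_mul_equiv, submatrix_mul_equiv]

variable [ProperSpace E] [MeasurableSpace E] [BorelSpace E] (μ : Measure E) [μ.IsAddHaarMeasure]
  [Fintype m] [Fintype n] [Fintype p] [Fintype s] [Fintype a] [Fintype b]

/-- The pair `(Q, U)` is the first factor because the congruences for `(P, R)` will be solved with
`(Q, U)` fixed. -/
theorem matVol_preimage_blockFun (hμ : μ {x : E | ‖x‖ ≤ 1} = 1) (ρ : p ⊕ s ≃ m) (σ : a ⊕ b ≃ n)
    (S : Set (m → n → E)) :
    (((matVol μ p b).prod (matVol μ s b)).prod ((matVol μ p a).prod (matVol μ s a)))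
      (blockFun ρ σ ⁻¹' S) = matVol μ m n S := by
  let e : ((p → b → E) × (s → b → E)) × ((p → a → E) × (s → a → E)) ≃+ (m → n → E) :=
    { toFun := blockFun ρ σ
      invFun := fun X => ((fun i j => X (ρ (Sum.inl i)) (σ (Sum.inr j)),
        fun i j => X (ρ (Sum.inr i)) (σ (Sum.inr j))),
        (fun i j => X (ρ (Sum.inl i)) (σ (Sum.inl j)),
        fun i j => X (ρ (Sum.inr i)) (σ (Sum.inl j))))
      left_inv := fun y => by simp [blockFun]
      right_inv := fun X => by
        ext i j
        obtain ⟨i, rfl⟩ := ρ.surjective i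
        obtain ⟨j, rfl⟩ := σ.surjective j
        rcases i with i | i <;> rcases j with j | j <;> simp [blockFun]
      map_add' := fun y z => by
        ext i j
        obtain ⟨i, rfl⟩ := ρ.surjective i
        obtain ⟨j, rfl⟩ := σ.surjective j
        rcases i with i | i <;> rcases j with j | j <;> simp [blockFun] }
  have he : Continuous e := by
    refine continuous_pi fun i => continuous_pi fun j => ?_
    obtain ⟨i, rfl⟩ := ρ.surjective i
    obtain ⟨j, rfl⟩ := σ.surjective j
    rcases i with i | i <;> rcases j with j | j <;>
    simp only [e, AddEquiv.coe_mk, Equiv.coe_fn_mk, blockFun, Equiv.symm_apply_apply,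
      fromBlocks_apply₁₁, fromBlocks_apply₁₂, fromBlocks_apply₂₁, fromBlocks_apply₂₂, of_apply]
    · exact (continuous_apply_apply i j).comp (continuous_fst.comp continuous_snd)
    · exact (continuous_apply_apply i j).comp (continuous_fst.comp continuous_fst)
    · exact (continuous_apply_apply i j).comp (continuous_snd.comp continuous_snd)
    · exact (continuous_apply_apply i j).comp (continuous_snd.comp continuous_fst)
  have he' : Continuous e.symm := by
    refine ((continuous_pi fun i => continuous_pi fun j => ?_).prodMk
      (continuous_pi fun i => continuous_pi fun j => ?_)).prodMk
      ((continuous_pi fun i => continuous_pi fun j => ?_).prodMk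
      (continuous_pi fun i => continuous_pi fun j => ?_)) <;>
    exact continuous_apply_apply _ _
  have b1 : BorelSpace ((p → b → E) × (s → b → E)) := inferInstance
  have b2 : BorelSpace ((p → a → E) × (s → a → E)) := inferInstance
  have b3 : BorelSpace (((p → b → E) × (s → b → E)) × ((p → a → E) × (s → a → E))) :=
    inferInstance
  have m1 : ((matVol μ p b).prod (matVol μ s b)).IsAddHaarMeasure :=
    Measure.prod.instIsAddHaarMeasure _ _
  have m2 : ((matVol μ p a).prod (matVol μ s a)).IsAddHaarMeasure :=
    Measure.prod.instIsAddHaarMeasure _ _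
  have m3 := Measure.prod.instIsAddHaarMeasure ((matVol μ p b).prod (matVol μ s b))
    ((matVol μ p a).prod (matVol μ s a))
  refine measure_preimage_of_haar _ (matVol μ m n) e he he' (K := {X | EntryLe (of X) 1}) ?_ ?_ S
  · rw [matVol_entryLe, hμ, one_pow]
  · have : e ⁻¹' {X | EntryLe (of X) 1} =
        ({Q : p → b → E | EntryLe (of Q) 1} ×ˢ {U : s → b → E | EntryLe (of U) 1}) ×ˢ
        ({P : p → a → E | EntryLe (of P) 1} ×ˢ {R : s → a → E | EntryLe (of R) 1}) := by
      ext y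
      exact entryLe_blockFun_iff ρ σ y 1
    rw [this]
    simp only [Measure.prod_prod, matVol_entryLe, hμ, one_pow, mul_one]

/-- Multiplication by matrices congruent to `1` preserves volumes. -/
theorem matVol_preimage_mul [IsUltrametricDist E] [DecidableEq m] [DecidableEq n]
    (hμ : μ {x : E | ‖x‖ ≤ 1} = 1) {c : ℝ} (hc0 : 0 ≤ c) (hc : c < 1) {L : Matrix m m E}
    {R : Matrix n n E} (hL : EntryLe (L - 1) c) (hR : EntryLe (R - 1) c) (S : Set (m → n → E)) :
    matVol μ m n {X | of.symm (L * of X * R) ∈ S} = matVol μ m n S := by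
  have hL' := isUnit_det_of_sub_one hL hc0 hc
  have hR' := isUnit_det_of_sub_one hR hc0 hc
  let e : (m → n → E) ≃+ (m → n → E) :=
    { toFun := fun X => of.symm (L * of X * R)
      invFun := fun X => of.symm (L⁻¹ * of X * R⁻¹)
      left_inv := fun X => by
        simp only [Equiv.apply_symm_apply, Matrix.mul_assoc]
        rw [mul_nonsing_inv _ hR', Matrix.mul_one, ← Matrix.mul_assoc, nonsing_inv_mul _ hL',
          Matrix.one_mul]
        rfl
      right_inv := fun X => by
        simp only [Equiv.apply_symm_apply, Matrix.mul_assoc]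
        rw [nonsing_inv_mul _ hR', Matrix.mul_one, ← Matrix.mul_assoc, mul_nonsing_inv _ hL',
          Matrix.one_mul]
        rfl
      map_add' := fun X Y => by
        change of.symm (L * (of X + of Y) * R) = _
        rw [Matrix.mul_add, Matrix.add_mul]
        rfl }
  have hX : Continuous fun x : m → n → E => (of x : Matrix m n E) := continuous_id
  have hcont : ∀ (A : Matrix m m E) (B : Matrix n n E),
      Continuous fun X : m → n → E => of.symm (A * of X * B) := fun A B =>
    (continuous_const.matrix_mul hX).matrix_mul continuous_const
  refine measure_preimage_of_haar _ (matVol μ m n) e (hcont L R) (hcont L⁻¹ R⁻¹)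
    (K := {X | EntryLe (of X) 1}) ?_ ?_ S
  · rw [matVol_entryLe, hμ, one_pow]
  · have : e ⁻¹' {X | EntryLe (of X) 1} = {X | EntryLe (of X) 1} := by
      ext X
      change EntryLe (L * of X * R) 1 ↔ EntryLe (of X) 1
      rw [entryLe_mul_mul_iff hL hR hc0 hc zero_le_one]
    rw [this, matVol_entryLe, hμ, one_pow]

end

namespace UnramQuad

variable {F E : Type*} [NontriviallyNormedField F] [NontriviallyNormedField E]
    [NormedAlgebra F E] [StarRing E] {π : F} (h : UnramQuad F E π) [IsUltrametricDist E]
    {p n : Type*} [Fintype p] [Fintype n] [DecidableEq n]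
include h

omit [IsUltrametricDist E] [Fintype p] [Fintype n] [DecidableEq n] in
theorem entryLe_smul_iff {X : Matrix p n E} {c : ℝ} :
    EntryLe (algebraMap F E π • X) (‖π‖ * c) ↔ EntryLe X c := by
  refine forall_congr' fun i => forall_congr' fun j => ?_
  rw [Matrix.smul_apply, smul_eq_mul, norm_mul, norm_algebraMap']
  exact mul_le_mul_iff_right₀ h.norm_pos

/-- An integral matrix which is unitary modulo `π` has an integral inverse. -/
theorem inverse_of_unitary {U : Matrix n n E} (hU : EntryLe U 1) (hUU : EntryLe (Uᴴ * U - 1) ‖π‖) :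
    EntryLe U⁻¹ 1 ∧ U * U⁻¹ = 1 ∧ U⁻¹ * U = 1 := by
  have hdet : IsUnit U.det := by
    have := isUnit_det_of_sub_one hUU h.norm_pos.le h.norm_lt_one
    rw [det_mul] at this
    exact isUnit_of_mul_isUnit_right this
  refine ⟨?_, mul_nonsing_inv _ hdet, nonsing_inv_mul _ hdet⟩
  rw [← entryLe_mul_iff_of_sub_one hUU h.norm_pos.le h.norm_lt_one zero_le_one, Matrix.mul_assoc,
    mul_nonsing_inv _ hdet, Matrix.mul_one]
  exact hU.conjTranspose h

/-- Elimination of the lower left block: if `U` is unitary modulo `π`, then the congruences for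
`P` and `R` amount to one for `P` and one which determines `R` from `P`. -/
theorem elim_block {Q : Matrix p n E} {U : Matrix n n E} (hQ : EntryLe Q 1) (hU : EntryLe U 1)
    (hUU : EntryLe (Uᴴ * U - 1) ‖π‖) [DecidableEq p] (B : Matrix n n E) (d : ℕ) (P : Matrix p n E)
    (R : Matrix n n E) :
    ((EntryLe P 1 ∧ EntryLe R ‖π‖) ∧
      EntryLe (Pᴴ * P + (algebraMap F E π)⁻¹ • (Rᴴ * R) - B) (‖π‖ ^ d) ∧
      EntryLe (Pᴴ * Q + (algebraMap F E π)⁻¹ • (Rᴴ * U)) (‖π‖ ^ d)) ↔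
    (EntryLe P 1 ∧
      EntryLe (Pᴴ * (1 + algebraMap F E π • (Q * (U⁻¹ * U⁻¹ᴴ) * Qᴴ)) * P - B) (‖π‖ ^ d)) ∧
      EntryLe (R - -(algebraMap F E π • (U⁻¹ᴴ * Qᴴ * P))) (‖π‖ ^ (d + 1)) := by
  obtain ⟨hV, hUV, hVU⟩ := h.inverse_of_unitary hU hUU
  set V := U⁻¹ with hVdef
  set ϖ : E := algebraMap F E π with hϖ
  have hϖ0 : ϖ ≠ 0 := h.ne_zeroE
  have hϖn : ‖ϖ‖ = ‖π‖ := norm_algebraMap' E π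
  have hs : star ϖ = ϖ := h.star_algebraMap π
  have hp := h.norm_pos
  have hd0 := (h.norm_pow_pos d).le
  have hd1 := (h.norm_pow_pos (d + 1)).le
  -- `R₀` is the exact solution of `P*Q + π^{-1}R*U = 0`. It is divisible by `π`, which matches the
  -- support condition on `R`.
  obtain ⟨R₀, hR₀⟩ : ∃ R₀, R₀ = -(ϖ • (Vᴴ * Qᴴ * P)) := ⟨_, rfl⟩
  rw [← hR₀]
  have hR₀H : R₀ᴴ = -(ϖ • (Pᴴ * Q * V)) := by
    simp [hR₀, conjTranspose_smul, conjTranspose_mul, hs, Matrix.mul_assoc]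
  have hR₀le : EntryLe P 1 → EntryLe R₀ ‖π‖ := fun hP => by
    rw [hR₀]
    have h1 : EntryLe (Vᴴ * Qᴴ * P) 1 :=
      ((hV.conjTranspose h).mul_one_left (hQ.conjTranspose h) zero_le_one).mul_one_left hP
        zero_le_one
    simpa using (h1.smul hϖn.le).neg
  have e2 : Pᴴ * Q + ϖ⁻¹ • (Rᴴ * U) = ϖ⁻¹ • ((R - R₀)ᴴ * U) := by
    rw [conjTranspose_sub, hR₀H, Matrix.sub_mul, Matrix.neg_mul, Matrix.smul_mul, Matrix.mul_assoc,
      hVU, Matrix.mul_one, smul_sub, smul_neg, smul_smul, inv_mul_cancel₀ hϖ0, one_smul,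
      sub_neg_eq_add, add_comm]
  have c2 : EntryLe (Pᴴ * Q + ϖ⁻¹ • (Rᴴ * U)) (‖π‖ ^ d) ↔ EntryLe (R - R₀) (‖π‖ ^ (d + 1)) := by
    rw [e2, ← h.entryLe_smul_iff, ← hϖ, smul_smul, mul_inv_cancel₀ hϖ0, one_smul, ← pow_succ']
    constructor
    · intro h1
      have h2 := (h1.mul_one_right hV hd1).conjTranspose h
      rwa [Matrix.mul_assoc, hUV, Matrix.mul_one, conjTranspose_conjTranspose] at h2
    · exact fun h1 => (h1.conjTranspose h).mul_one_right hU hd1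
  have e1 : Pᴴ * (1 + ϖ • (Q * (V * Vᴴ) * Qᴴ)) * P = Pᴴ * P + ϖ⁻¹ • (R₀ᴴ * R₀) := by
    rw [hR₀H, hR₀]
    simp only [Matrix.mul_add, Matrix.add_mul, Matrix.mul_one, Matrix.mul_smul, Matrix.smul_mul,
      Matrix.neg_mul, Matrix.mul_neg, smul_neg, neg_neg, Matrix.mul_assoc]
    rw [inv_smul_smul₀ hϖ0]
  -- Replacing `R` by `R₀` changes `π^{-1}R*R` by `π^{-1}(R*Δ + Δ*R₀)` with `Δ = R - R₀`. The
  -- precision `π^{d+1}` of `Δ` compensates the factor `π^{-1}`.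
  have c1 : EntryLe P 1 → EntryLe R ‖π‖ → EntryLe (R - R₀) (‖π‖ ^ (d + 1)) →
      EntryLe ((Pᴴ * P + ϖ⁻¹ • (Rᴴ * R) - B) -
        (Pᴴ * (1 + ϖ • (Q * (V * Vᴴ) * Qᴴ)) * P - B)) (‖π‖ ^ d) := by
    intro hP hR hΔ
    have e3 : (Pᴴ * P + ϖ⁻¹ • (Rᴴ * R) - B) - (Pᴴ * (1 + ϖ • (Q * (V * Vᴴ) * Qᴴ)) * P - B) =
        ϖ⁻¹ • (Rᴴ * (R - R₀) + (R - R₀)ᴴ * R₀) := by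
      have : Rᴴ * (R - R₀) + (R - R₀)ᴴ * R₀ = Rᴴ * R - R₀ᴴ * R₀ := by
        rw [Matrix.mul_sub, conjTranspose_sub, Matrix.sub_mul]
        abel
      rw [e1, this, smul_sub]
      abel
    rw [e3, ← h.entryLe_smul_iff, ← hϖ, smul_smul, mul_inv_cancel₀ hϖ0, one_smul, ← pow_succ']
    refine EntryLe.add ?_ ?_
    · exact ((hR.mono h.norm_lt_one.le).conjTranspose h).mul_one_left hΔ hd1
    · exact (hΔ.conjTranspose h).mul_one_right ((hR₀le hP).mono h.norm_lt_one.le) hd1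
  constructor
  · rintro ⟨⟨hP, hR⟩, h1, h2⟩
    rw [c2] at h2
    exact ⟨⟨hP, (c1 hP hR h2).congr_sub.1 h1⟩, h2⟩
  · rintro ⟨⟨hP, h1⟩, h2⟩
    have hR : EntryLe R ‖π‖ := by
      have h3 : EntryLe (R - R₀) ‖π‖ := h2.mono (by
        rw [pow_succ]
        exact mul_le_of_le_one_left hp.le (pow_le_one₀ hp.le h.norm_lt_one.le))
      simpa using h3.add (hR₀le hP)
    exact ⟨⟨hP, hR⟩, (c1 hP hR h2).congr_sub.2 h1, c2.2 h2⟩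

section volume

variable [ProperSpace E] [MeasurableSpace E] [BorelSpace E] (μ : Measure E) [μ.IsAddHaarMeasure]
  (hμ : μ {x : E | ‖x‖ ≤ 1} = 1) [DecidableEq p]
include hμ

/-- The volume of the solutions of `ᵗP* S P ≡ B` does not depend on the hermitian matrix
`S ≡ 1 mod π`. -/
theorem volume_congr_one {S : Matrix p p E} (hS : S.IsHermitian) (hS1 : EntryLe (S - 1) ‖π‖)
    (B : Matrix n n E) (d : ℕ) :
    matVol μ p n {P | EntryLe (of P) 1 ∧ EntryLe ((of P)ᴴ * S * of P - B) (‖π‖ ^ d)} =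
    matVol μ p n {P | EntryLe (of P) 1 ∧ EntryLe ((of P)ᴴ * of P - B) (‖π‖ ^ d)} := by
  obtain ⟨T, hT, hTS⟩ := h.exists_conjTranspose_mul_self hS hS1 d
  have hp := h.norm_pos
  have hd0 := (h.norm_pow_pos d).le
  rw [← matVol_preimage_mul μ hμ hp.le h.norm_lt_one hT (R := 1) (by simpa using entryLe_zero hp.le)
    {P | EntryLe (of P) 1 ∧ EntryLe ((of P)ᴴ * of P - B) (‖π‖ ^ d)}]
  congr 1
  ext P
  simp only [Set.mem_ofPred_eq, Equiv.apply_symm_apply, Matrix.mul_one]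
  rw [entryLe_mul_iff_of_sub_one hT hp.le h.norm_lt_one zero_le_one]
  refine and_congr_right fun hP => ?_
  refine EntryLe.congr_sub ?_
  have : (of P)ᴴ * S * of P - B - ((T * of P)ᴴ * (T * of P) - B) =
      -((of P)ᴴ * (Tᴴ * T - S) * of P) := by
    rw [conjTranspose_mul]
    simp only [Matrix.mul_sub, Matrix.sub_mul, Matrix.mul_assoc]
    abel
  rw [this]
  refine (EntryLe.mono ?_ (pow_le_pow_of_le_one hp.le h.norm_lt_one.le (Nat.le_succ d))).neg
  have hd1 := (h.norm_pow_pos (d + 1)).le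
  exact ((hP.conjTranspose h).mul_one_left hTS hd1).mul_one_right hP hd1

/-- The volume of the solutions of `ᵗU* U ≡ S` does not depend on the hermitian matrix
`S ≡ 1 mod π`. -/
theorem volume_congr_right {S : Matrix n n E} (hS : S.IsHermitian) (hS1 : EntryLe (S - 1) ‖π‖)
    (d : ℕ) :
    matVol μ p n {U | EntryLe (of U) 1 ∧ EntryLe ((of U)ᴴ * of U - S) (‖π‖ ^ d)} =
    matVol μ p n {U | EntryLe (of U) 1 ∧ EntryLe ((of U)ᴴ * of U - 1) (‖π‖ ^ d)} := by
  obtain ⟨T, hT, hTS⟩ := h.exists_conjTranspose_mul_self hS hS1 d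
  have hp := h.norm_pos
  have hd0 := (h.norm_pow_pos d).le
  have h1p : EntryLe ((1 : Matrix p p E) - 1) ‖π‖ := by simpa using entryLe_zero hp.le
  have hTH : EntryLe (Tᴴ - 1) ‖π‖ := by
    have := hT.conjTranspose h
    rwa [conjTranspose_sub, conjTranspose_one] at this
  rw [← matVol_preimage_mul μ hμ hp.le h.norm_lt_one h1p hT
    {U | EntryLe (of U) 1 ∧ EntryLe ((of U)ᴴ * of U - S) (‖π‖ ^ d)}]
  congr 1
  ext U
  simp only [Set.mem_ofPred_eq, Equiv.apply_symm_apply]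
  rw [entryLe_mul_mul_iff h1p hT hp.le h.norm_lt_one zero_le_one, Matrix.one_mul]
  refine and_congr_right fun hU => ?_
  rw [← entryLe_mul_mul_iff hTH hT hp.le h.norm_lt_one hd0 (X := (of U)ᴴ * of U - 1)]
  refine EntryLe.congr_sub ?_
  have : (of U * T)ᴴ * (of U * T) - S - Tᴴ * ((of U)ᴴ * of U - 1) * T = Tᴴ * T - S := by
    rw [conjTranspose_mul]
    simp only [Matrix.mul_sub, Matrix.sub_mul, Matrix.mul_assoc, Matrix.mul_one]
    abel
  rw [this]
  exact hTS.mono (pow_le_pow_of_le_one hp.le h.norm_lt_one.le (Nat.le_succ d))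

/-- The volume of the solutions of the congruences for the four blocks. -/
theorem volume_blocks (B : Matrix n n E) (d : ℕ) :
    (((matVol μ p n).prod (matVol μ n n)).prod ((matVol μ p n).prod (matVol μ n n)))
      {y | ((EntryLe (of y.1.1) 1 ∧ EntryLe (of y.1.2) 1) ∧
          EntryLe ((of y.1.2)ᴴ * of y.1.2 - (1 - algebraMap F E π • ((of y.1.1)ᴴ * of y.1.1)))
            (‖π‖ ^ (d + 1))) ∧
        ((EntryLe (of y.2.1) 1 ∧ EntryLe (of y.2.2) ‖π‖) ∧
          EntryLe ((of y.2.1)ᴴ * of y.2.1 + (algebraMap F E π)⁻¹ • ((of y.2.2)ᴴ * of y.2.2) - B)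
            (‖π‖ ^ d) ∧
          EntryLe ((of y.2.1)ᴴ * of y.1.1 + (algebraMap F E π)⁻¹ • ((of y.2.2)ᴴ * of y.1.2))
            (‖π‖ ^ d))} =
    matVol μ n n {U | EntryLe (of U) 1 ∧ EntryLe ((of U)ᴴ * of U - 1) (‖π‖ ^ (d + 1))} *
      (matVol μ p n {P | EntryLe (of P) 1 ∧ EntryLe ((of P)ᴴ * of P - B) (‖π‖ ^ d)} *
        matVol μ n n {R | EntryLe (of R) (‖π‖ ^ (d + 1))}) := by
  have := h.continuousStar
  have hp := h.norm_pos
  set ϖ : E := algebraMap F E π with hϖ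
  have hϖn : ‖ϖ‖ = ‖π‖ := norm_algebraMap' E π
  have hs : star ϖ = ϖ := h.star_algebraMap π
  have hof : ∀ (a b : Type _), Continuous fun x : a → b → E => (of x : Matrix a b E) :=
    fun _ _ => continuous_id
  have hsmall : ∀ Q : Matrix p n E, EntryLe Q 1 → EntryLe (ϖ • (Qᴴ * Q)) ‖π‖ := fun Q hQ => by
    have := (((hQ.conjTranspose h).mul_one_left hQ zero_le_one).smul hϖn.le)
    rwa [mul_one] at this
  have hpd : ‖π‖ ^ (d + 1) ≤ ‖π‖ := by
    rw [pow_succ]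
    exact mul_le_of_le_one_left hp.le (pow_le_one₀ hp.le h.norm_lt_one.le)
  have b1 : BorelSpace ((p → n → E) × (n → n → E)) := inferInstance
  have b3 : BorelSpace (((p → n → E) × (n → n → E)) × ((p → n → E) × (n → n → E))) :=
    inferInstance
  have sf : SFinite ((matVol μ p n).prod (matVol μ n n)) := inferInstance
  have cQ : Continuous fun y : ((p → n → E) × (n → n → E)) × ((p → n → E) × (n → n → E)) =>
    (of y.1.1 : Matrix p n E) := continuous_fst.comp continuous_fst
  have cU : Continuous fun y : ((p → n → E) × (n → n → E)) × ((p → n → E) × (n → n → E)) =>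
    (of y.1.2 : Matrix n n E) := continuous_snd.comp continuous_fst
  have cP : Continuous fun y : ((p → n → E) × (n → n → E)) × ((p → n → E) × (n → n → E)) =>
    (of y.2.1 : Matrix p n E) := continuous_fst.comp continuous_snd
  have cR : Continuous fun y : ((p → n → E) × (n → n → E)) × ((p → n → E) × (n → n → E)) =>
    (of y.2.2 : Matrix n n E) := continuous_snd.comp continuous_snd
  have dQ : Continuous fun y : (p → n → E) × (n → n → E) => (of y.1 : Matrix p n E) :=
    continuous_fst
  have dU : Continuous fun y : (p → n → E) × (n → n → E) => (of y.2 : Matrix n n E) :=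
    continuous_snd
  have hT : MeasurableSet {y : (p → n → E) × (n → n → E) |
      (EntryLe (of y.1) 1 ∧ EntryLe (of y.2) 1) ∧
        EntryLe ((of y.2)ᴴ * of y.2 - (1 - ϖ • ((of y.1)ᴴ * of y.1))) (‖π‖ ^ (d + 1))} :=
    (((isClosed_entryLe dQ _).inter (isClosed_entryLe dU _)).inter
      (isClosed_entryLe ((dU.matrix_conjTranspose.matrix_mul dU).sub
        (continuous_const.sub ((dQ.matrix_conjTranspose.matrix_mul dQ).const_smul ϖ)))
        _)).measurableSet
  -- Fubini over `(Q, U)`: whatever the admissible pair, the slice of solutions `(P, R)` has the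
  -- same volume.
  rw [prod_apply_of_const_slice _ _ _ hT
    (matVol μ p n {P | EntryLe (of P) 1 ∧ EntryLe ((of P)ᴴ * of P - B) (‖π‖ ^ d)} *
        matVol μ n n {R | EntryLe (of R) (‖π‖ ^ (d + 1))})]
  · congr 1
    -- Fubini over `Q`: the right side `1 - πQ*Q` is `≡ 1 mod π`, so the volume of the `U` does not
    -- depend on `Q`.
    rw [prod_apply_of_const_slice (T := {Q : p → n → E | EntryLe (of Q) 1}) _ _ hT
      (isClosed_entryLe (hof p n) _).measurableSet
      (matVol μ n n {U | EntryLe (of U) 1 ∧ EntryLe ((of U)ᴴ * of U - 1) (‖π‖ ^ (d + 1))}),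
      matVol_entryLe, hμ, one_pow, one_mul]
    · intro Q hQ
      have hQ : EntryLe (of Q) 1 := hQ
      rw [← h.volume_congr_right μ hμ (S := 1 - ϖ • ((of Q)ᴴ * of Q))]
      · congr 1
        ext U
        simp only [Set.mem_preimage, Set.mem_ofPred_eq, hQ, true_and]
      · simp [IsHermitian, conjTranspose_smul, hs]
      · rw [sub_sub_cancel_left]
        exact (hsmall _ hQ).neg
    · intro Q hQ
      have hQ : ¬ EntryLe (of Q) 1 := hQ
      simp only [Set.preimage_ofPred_eq, hQ, false_and]
      exact measure_empty
  · rintro ⟨Q, U⟩ ⟨⟨hQ, hU⟩, hUQ⟩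
    have hUU : EntryLe ((of U)ᴴ * of U - 1) ‖π‖ := by
      have := (hUQ.mono hpd).sub (hsmall _ hQ)
      simpa [sub_sub_eq_add_sub, add_sub_right_comm] using this
    obtain ⟨hV, -, -⟩ := h.inverse_of_unitary hU hUU
    set S : Matrix p p E := 1 + ϖ • (of Q * ((of U)⁻¹ * (of U)⁻¹ᴴ) * (of Q)ᴴ) with hS
    have hSH : S.IsHermitian := by
      simp [hS, IsHermitian, conjTranspose_smul, hs, Matrix.mul_assoc]
    have hS1 : EntryLe (S - 1) ‖π‖ := by
      rw [hS, add_sub_cancel_left]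
      have := ((hQ.mul_one_left (hV.mul_one_left (hV.conjTranspose h) zero_le_one)
        zero_le_one).mul_one_left (hQ.conjTranspose h) zero_le_one).smul hϖn.le
      rwa [mul_one] at this
    have hslice : Prod.mk (Q, U) ⁻¹' {y : ((p → n → E) × (n → n → E)) × ((p → n → E) × (n → n → E)) |
        ((EntryLe (of y.1.1) 1 ∧ EntryLe (of y.1.2) 1) ∧
          EntryLe ((of y.1.2)ᴴ * of y.1.2 - (1 - ϖ • ((of y.1.1)ᴴ * of y.1.1)))
            (‖π‖ ^ (d + 1))) ∧
        ((EntryLe (of y.2.1) 1 ∧ EntryLe (of y.2.2) ‖π‖) ∧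
          EntryLe ((of y.2.1)ᴴ * of y.2.1 + ϖ⁻¹ • ((of y.2.2)ᴴ * of y.2.2) - B)
            (‖π‖ ^ d) ∧
          EntryLe ((of y.2.1)ᴴ * of y.1.1 + ϖ⁻¹ • ((of y.2.2)ᴴ * of y.1.2))
            (‖π‖ ^ d))} = {z | (EntryLe (of z.1) 1 ∧
              EntryLe ((of z.1)ᴴ * S * of z.1 - B) (‖π‖ ^ d)) ∧
            EntryLe (of z.2 - -(ϖ • ((of U)⁻¹ᴴ * (of Q)ᴴ * of z.1))) (‖π‖ ^ (d + 1))} := by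
      ext ⟨P, R⟩
      have h1 : EntryLe (of Q) 1 := hQ
      have h2 : EntryLe (of U) 1 := hU
      have h3 : EntryLe ((of U)ᴴ * of U - (1 - ϖ • ((of Q)ᴴ * of Q))) (‖π‖ ^ (d + 1)) := hUQ
      simp only [Set.mem_preimage, Set.mem_ofPred_eq, h1, h2, h3, true_and]
      exact h.elim_block hQ hU hUU B d (of P) (of R)
    have dS : Continuous fun y : p → n → E => (of y)ᴴ * S * of y - B :=
      (((hof p n).matrix_conjTranspose.matrix_mul continuous_const).matrix_mul (hof p n)).sub
        continuous_const
    rw [hslice, ← h.volume_congr_one μ hμ hSH hS1]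
    refine prod_apply_of_const_slice _ _ ?_ ?_ _ ?_ ?_
    · refine (((isClosed_entryLe dQ _).inter (isClosed_entryLe (dS.comp continuous_fst) _)).inter
        (isClosed_entryLe (dU.sub ?_) _)).measurableSet
      exact ((continuous_const.matrix_mul dQ).const_smul ϖ).neg
    · exact ((isClosed_entryLe (hof p n) _).inter (isClosed_entryLe dS _)).measurableSet
    -- For fixed `P` the admissible `R` form a translate of `π^{d+1} M_n(O_E)`.
    · intro P hP
      rw [← matVol_entryLe_sub μ (of.symm (-(ϖ • ((of U)⁻¹ᴴ * (of Q)ᴴ * of P))))]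
      congr 1
      ext R
      exact and_iff_right hP
    · intro P hP
      have : Prod.mk P ⁻¹' {z : (p → n → E) × (n → n → E) | (EntryLe (of z.1) 1 ∧
              EntryLe ((of z.1)ᴴ * S * of z.1 - B) (‖π‖ ^ d)) ∧
            EntryLe (of z.2 - -(ϖ • ((of U)⁻¹ᴴ * (of Q)ᴴ * of z.1))) (‖π‖ ^ (d + 1))} = ∅ := by
        ext R
        exact iff_of_false (fun hR => hP hR.1) (Set.notMem_empty _)
      rw [this, measure_empty]
  · intro y hy
    have : Prod.mk y ⁻¹' {y : ((p → n → E) × (n → n → E)) × ((p → n → E) × (n → n → E)) |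
        ((EntryLe (of y.1.1) 1 ∧ EntryLe (of y.1.2) 1) ∧
          EntryLe ((of y.1.2)ᴴ * of y.1.2 - (1 - ϖ • ((of y.1.1)ᴴ * of y.1.1)))
            (‖π‖ ^ (d + 1))) ∧
        ((EntryLe (of y.2.1) 1 ∧ EntryLe (of y.2.2) ‖π‖) ∧
          EntryLe ((of y.2.1)ᴴ * of y.2.1 + ϖ⁻¹ • ((of y.2.2)ᴴ * of y.2.2) - B)
            (‖π‖ ^ d) ∧
          EntryLe ((of y.2.1)ᴴ * of y.1.1 + ϖ⁻¹ • ((of y.2.2)ᴴ * of y.1.2))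
            (‖π‖ ^ d))} = ∅ := by
      ext z
      exact iff_of_false (fun hz => hy hz.1) (Set.notMem_empty _)
    rw [this, measure_empty]
  · refine ((((isClosed_entryLe cQ _).inter (isClosed_entryLe cU _)).inter
      (isClosed_entryLe ((cU.matrix_conjTranspose.matrix_mul cU).sub
        (continuous_const.sub ((cQ.matrix_conjTranspose.matrix_mul cQ).const_smul ϖ)))
        _)).inter
      (((isClosed_entryLe cP _).inter (isClosed_entryLe cR _)).inter
      ((isClosed_entryLe (((cP.matrix_conjTranspose.matrix_mul cP).add
        ((cR.matrix_conjTranspose.matrix_mul cR).const_smul ϖ⁻¹)).sub continuous_const) _).inter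
      (isClosed_entryLe ((cP.matrix_conjTranspose.matrix_mul cQ).add
        ((cR.matrix_conjTranspose.matrix_mul cU).const_smul ϖ⁻¹)) _)))).measurableSet

end volume

end UnramQuad

/-! ### The congruences in block form and the factorization of the truncated integral. -/

/-- The rows of `M_{2n+2r,2n}(E)`, with the rows `n+1, …, 2n` moved to the end. -/
def splitRow (n r : ℕ) : (Fin n ⊕ Fin (2 * r)) ⊕ Fin n ≃ Fin (n + n) ⊕ Fin (2 * r) :=
  (Equiv.sumAssoc _ _ _).trans <| ((Equiv.refl _).sumCongr (Equiv.sumComm _ _)).trans <|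
    (Equiv.sumAssoc _ _ _).symm.trans <| finSumFinEquiv.sumCongr (Equiv.refl _)

section

variable {F E : Type*} [NontriviallyNormedField F] [NontriviallyNormedField E] [NormedAlgebra F E]
  (π : F) (n r : ℕ)

theorem submatrix_stab_gramA : (stab (gramA E π n n) r).submatrix (splitRow n r) (splitRow n r) =
    fromBlocks 1 0 0 ((algebraMap F E π)⁻¹ • 1) := by
  have h2 : 2 * n - n = n := by lia
  ext i j
  rcases i with (i | i) | i <;> rcases j with (j | j) | j <;>
    simp [splitRow, stab, gramA, Matrix.one_apply, diagonal_apply, h2, Fin.ext_iff] <;>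
    lia

theorem submatrix_blockB (B₁ : Matrix (Fin n) (Fin n) E) :
    (blockB π B₁).submatrix finSumFinEquiv finSumFinEquiv =
      fromBlocks B₁ 0 0 ((algebraMap F E π)⁻¹ • 1) := by
  simp [blockB]

omit [NormedAlgebra F E] in
theorem blockFun_mem_suppSet_iff (hπ : ‖π‖ ≤ 1)
    (y : (((Fin n ⊕ Fin (2 * r)) → Fin n → E) × (Fin n → Fin n → E)) ×
      (((Fin n ⊕ Fin (2 * r)) → Fin n → E) × (Fin n → Fin n → E))) :
    blockFun (splitRow n r) finSumFinEquiv y ∈ suppSet E π n n n r ↔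
      (EntryLe (of y.1.1) 1 ∧ EntryLe (of y.1.2) 1) ∧
        (EntryLe (of y.2.1) 1 ∧ EntryLe (of y.2.2) ‖π‖) := by
  have h2 : 2 * n - n = n := by lia
  have h1 : (∀ i j, ‖blockFun (splitRow n r) finSumFinEquiv y i j‖ ≤ 1) ↔ _ :=
    entryLe_blockFun_iff (splitRow n r) finSumFinEquiv y 1
  have hR : ∀ i j : Fin n, blockFun (splitRow n r) finSumFinEquiv y (Sum.inl (Fin.natAdd n i))
      (Fin.castAdd n j) = y.2.2 i j := by
    intro i j
    have : blockFun (splitRow n r) finSumFinEquiv y (splitRow n r (Sum.inr i))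
      (finSumFinEquiv (Sum.inl j)) = y.2.2 i j := by simp [blockFun]
    simpa [splitRow] using this
  rw [suppSet, Set.mem_ofPred_eq, h1, h2]
  constructor
  · rintro ⟨⟨⟨hQ, hU⟩, hP, -⟩, hX⟩
    refine ⟨⟨hQ, hU⟩, hP, fun i j => ?_⟩
    have := hX (Fin.natAdd n i) (Fin.castAdd n j) (by simp) (by simp)
    rwa [hR] at this
  · rintro ⟨⟨hQ, hU⟩, hP, hR'⟩
    refine ⟨⟨⟨hQ, hU⟩, hP, hR'.mono hπ⟩, ?_⟩
    intro i j hi hj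
    obtain ⟨j, rfl⟩ : ∃ j', j = Fin.castAdd n j' := ⟨⟨j, hj⟩, rfl⟩
    obtain ⟨i, rfl⟩ : ∃ i', i = Fin.natAdd n i' :=
      ⟨⟨i - n, by lia⟩, Fin.ext (by simp; lia)⟩
    rw [hR]
    exact hR' i j

end

namespace UnramQuad

variable {F E : Type*} [NontriviallyNormedField F] [NontriviallyNormedField E]
    [NormedAlgebra F E] [StarRing E] {π : F} (h : UnramQuad F E π) [IsUltrametricDist E]
include h

omit [IsUltrametricDist E] in
theorem blockB_isHermitian {n : ℕ} {B₁ : Matrix (Fin n) (Fin n) E} (hB : B₁.IsHermitian) :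
    (blockB π B₁).IsHermitian := by
  rw [blockB, reindex_apply]
  refine IsHermitian.submatrix ?_ _
  simp [IsHermitian, fromBlocks_conjTranspose, hB.eq, conjTranspose_smul, h.star_algebraMap]

-- The lower right block carries a factor `π^{-1}`, which raises its modulus to `π^{d+1}`. The two
-- off-diagonal congruences are conjugate, so one of them is dropped.
omit [IsUltrametricDist E] in
theorem entryLe_blocks_iff {p n : Type*} [Fintype p] [Fintype n] [DecidableEq p] [DecidableEq n]
    (B₁ : Matrix n n E) (P Q : Matrix p n E) (R U : Matrix n n E) (d : ℕ) :
    EntryLe (act (fromBlocks 1 0 0 ((algebraMap F E π)⁻¹ • 1)) (fromBlocks P Q R U) -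
        fromBlocks B₁ 0 0 ((algebraMap F E π)⁻¹ • 1)) (‖π‖ ^ d) ↔
      EntryLe (Uᴴ * U - (1 - algebraMap F E π • (Qᴴ * Q))) (‖π‖ ^ (d + 1)) ∧
      EntryLe (Pᴴ * P + (algebraMap F E π)⁻¹ • (Rᴴ * R) - B₁) (‖π‖ ^ d) ∧
      EntryLe (Pᴴ * Q + (algebraMap F E π)⁻¹ • (Rᴴ * U)) (‖π‖ ^ d) := by
  have h0 := h.ne_zeroE
  have hs := h.star_algebraMap π
  have e : act (fromBlocks 1 0 0 ((algebraMap F E π)⁻¹ • 1)) (fromBlocks P Q R U) -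
        fromBlocks B₁ 0 0 ((algebraMap F E π)⁻¹ • 1) =
      fromBlocks (Pᴴ * P + (algebraMap F E π)⁻¹ • (Rᴴ * R) - B₁)
        (Pᴴ * Q + (algebraMap F E π)⁻¹ • (Rᴴ * U)) (Pᴴ * Q + (algebraMap F E π)⁻¹ • (Rᴴ * U))ᴴ
        ((algebraMap F E π)⁻¹ • (Uᴴ * U - (1 - algebraMap F E π • (Qᴴ * Q)))) := by
    rw [act, fromBlocks_conjTranspose, fromBlocks_multiply, fromBlocks_multiply, sub_eq_add_neg,
      fromBlocks_neg, fromBlocks_add]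
    simp only [Matrix.mul_one, Matrix.mul_zero, add_zero, zero_add, Matrix.mul_smul,
      Matrix.smul_mul, neg_zero, conjTranspose_add, conjTranspose_smul, conjTranspose_mul,
      conjTranspose_conjTranspose, star_inv₀, hs, smul_sub, smul_smul, inv_mul_cancel₀ h0, one_smul]
    congr 1 <;> abel
  rw [e, entryLe_fromBlocks_iff]
  have h1 : EntryLe ((algebraMap F E π)⁻¹ • (Uᴴ * U - (1 - algebraMap F E π • (Qᴴ * Q)))) (‖π‖ ^ d) ↔
      EntryLe (Uᴴ * U - (1 - algebraMap F E π • (Qᴴ * Q))) (‖π‖ ^ (d + 1)) := by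
    rw [← h.entryLe_smul_iff, smul_smul, mul_inv_cancel₀ h0, one_smul, pow_succ']
  rw [h1]
  constructor
  · rintro ⟨⟨a, b⟩, -, c⟩
    exact ⟨c, a, b⟩
  · rintro ⟨c, a, b⟩
    exact ⟨⟨a, b⟩, b.conjTranspose h, c⟩

variable [IsUltrametricDist F] [ProperSpace F] [ProperSpace E] [MeasurableSpace E] [BorelSpace E]
    (μ : Measure E) [μ.IsAddHaarMeasure]

/-- The factorization of the truncated integral into representation densities. -/
theorem whitTrunc_blockB {ψ : AddChar F Circle} (hψ : ∀ a : F, ‖a‖ ≤ 1 → ψ a = 1)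
    (hψ' : ∃ a : F, ‖a‖ ≤ ‖π‖⁻¹ ∧ ψ a ≠ 1) (hμ : μ {x : E | ‖x‖ ≤ 1} = 1) {n : ℕ}
    (ν : Measure (HermMat (Fin (n + n)) E)) [ν.IsAddHaarMeasure]
    (hν : ν {Y | EntryLe Y.1 1} = 1) {B₁ : Matrix (Fin n) (Fin n) E}
    (hB : B₁.IsHermitian) (r d : ℕ) :
    whitTrunc π ψ μ ν n n (blockB π B₁) r d = ((resCard F : ℂ) ^ (3 * n ^ 2))⁻¹ *
      densApprox π (stab (1 : Matrix (Fin n) (Fin n) E) r) B₁ d *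
      densApprox π (1 : Matrix (Fin n) (Fin n) E) (1 : Matrix (Fin n) (Fin n) E) (d + 1) := by
  have hstab : stab (1 : Matrix (Fin n) (Fin n) E) r = 1 := fromBlocks_one
  have hact : ∀ {m : Type} [Fintype m] [DecidableEq m] (X : Matrix m (Fin n) E),
      act 1 X = Xᴴ * X := fun X => by rw [act, Matrix.mul_one]
  rw [h.whitTrunc_eq μ hψ hψ' hμ ν hν (h.blockB_isHermitian hB),
    h.densApprox_eq μ hμ (by rw [hstab]; exact entryLe_one),
    h.densApprox_eq μ hμ entryLe_one, hstab]
  have hvol : matVol μ _ _ {X | X ∈ suppSet E π n n n r ∧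
      EntryLe (act (stab (gramA E π n n) r) (of X) - blockB π B₁) (‖π‖ ^ d)} =
      matVol μ (Fin n) (Fin n)
        {U | EntryLe (of U) 1 ∧ EntryLe ((of U)ᴴ * of U - 1) (‖π‖ ^ (d + 1))} *
      (matVol μ (Fin n ⊕ Fin (2 * r)) (Fin n)
        {P | EntryLe (of P) 1 ∧ EntryLe ((of P)ᴴ * of P - B₁) (‖π‖ ^ d)} *
      matVol μ (Fin n) (Fin n) {R | EntryLe (of R) (‖π‖ ^ (d + 1))}) := by
    rw [← matVol_preimage_blockFun μ hμ (splitRow n r) finSumFinEquiv]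
    have := h.volume_blocks μ hμ (p := Fin n ⊕ Fin (2 * r)) B₁ d
    convert this using 2
    ext y
    rw [Set.mem_preimage, Set.mem_ofPred_eq, Set.mem_ofPred_eq,
      blockFun_mem_suppSet_iff π n r h.norm_lt_one.le,
      ← entryLe_submatrix_iff finSumFinEquiv finSumFinEquiv, submatrix_sub, Pi.sub_apply,
      Pi.sub_apply, submatrix_act (splitRow n r), submatrix_blockFun, submatrix_stab_gramA,
      submatrix_blockB, h.entryLe_blocks_iff]
    tauto
  have hq : (resCard F : ℝ) ≠ 0 :=
    Nat.cast_ne_zero.2 (zero_lt_one.trans h.unif.one_lt_resCard).ne'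
  rw [measureReal_def, hvol, h.matVol_le_pow μ hμ, ENNReal.toReal_mul, ENNReal.toReal_mul,
    ENNReal.toReal_inv, ENNReal.toReal_pow, ENNReal.toReal_natCast, ← measureReal_def,
    ← measureReal_def, Fintype.card_fin]
  simp only [hact]
  rw [← Complex.ofReal_natCast, ← Complex.ofReal_pow, ← Complex.ofReal_inv, ← Complex.ofReal_mul,
    ← Complex.ofReal_mul]
  congr 1
  set a := (matVol μ (Fin n) (Fin n)).real _
  set b := (matVol μ (Fin n ⊕ Fin (2 * r)) (Fin n)).real _
  -- Source of the constant `q^{-3n²}`: the density for `U` is taken at level `d + 1`, which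
  -- accounts for `n²`, and the volume of the `R` is `q^{-2(d+1)n²}`, which accounts for `2n²`.
  have e : (resCard F : ℝ) ^ (d * (n + n) ^ 2) * (resCard F : ℝ) ^ (3 * n ^ 2) =
      (resCard F : ℝ) ^ (d * n ^ 2) * (resCard F : ℝ) ^ ((d + 1) * n ^ 2) *
        (resCard F : ℝ) ^ (2 * (d + 1) * (n * n)) := by
    rw [← pow_add, ← pow_add, ← pow_add]
    congr 1
    ring
  field_simp
  linear_combination e

end UnramQuad

/-! ### Vanishing of the Whittaker integrals for `i < n`. -/

namespace UnramQuad

variable {F E : Type*} [NontriviallyNormedField F] [NontriviallyNormedField E]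
    [NormedAlgebra F E] [StarRing E] {π : F} (h : UnramQuad F E π) [IsUltrametricDist E]
include h

/-- If only `i < n` diagonal entries of an integral diagonal matrix `A` are not divisible by `π`,
then `A` does not represent, modulo `π`, the unit matrix of size `n`. -/
theorem not_entryLe_act_sub_one {m n : Type*} [Fintype m] [Fintype n] [DecidableEq m]
    [DecidableEq n] (a : m → E) {i : ℕ} (s : Fin i → m)
    (hs : ∀ k, k ∉ Set.range s → ‖a k‖ ≤ ‖π‖) (hi : i < Fintype.card n) {X : Matrix m n E}
    (hX : EntryLe X 1) : ¬ EntryLe (act (diagonal a) X - 1) ‖π‖ := by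
  intro hM
  -- The `i < n` rows of `X` facing the remaining entries of `A` have a common kernel vector `v ≠
  -- 0`. For it `A X v` is small compared with `v`, whereas `A[X] ≡ 1` would preserve the norm of
  -- `v`.
  have hker : LinearMap.ker (Matrix.toLin' (X.submatrix s id)) ≠ ⊥ :=
    LinearMap.ker_ne_bot_of_finrank_lt (by simpa using hi)
  obtain ⟨v, hv, hv0⟩ := Submodule.exists_mem_ne_zero_of_ne_bot hker
  have hne : ∃ j, v j ≠ 0 := Function.ne_iff.1 hv0
  obtain ⟨j, hj⟩ := hne
  have : Nonempty n := ⟨j⟩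
  obtain ⟨l, hl⟩ := Finite.exists_max fun k => ‖v k‖
  have hpos : 0 < ‖v l‖ := (norm_pos_iff.2 hj).trans_le (hl j)
  have hvle : EntryLe (replicateCol Unit v) ‖v l‖ := fun k _ => hl k
  have hXv : EntryLe (X * replicateCol Unit v) ‖v l‖ := hX.mul_one_left hvle hpos.le
  have hc : 0 ≤ ‖π‖ * ‖v l‖ := mul_nonneg h.norm_pos.le hpos.le
  have hAX : EntryLe (diagonal a * (X * replicateCol Unit v)) (‖π‖ * ‖v l‖) := by
    intro k u
    rw [diagonal_mul, norm_mul]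
    by_cases hk : k ∈ Set.range s
    · obtain ⟨k', rfl⟩ := hk
      have : (X * replicateCol Unit v) (s k') u = 0 := congrFun (LinearMap.mem_ker.1 hv) k'
      rw [this, norm_zero, mul_zero]
      exact hc
    · exact mul_le_mul (hs k hk) (hXv k u) (norm_nonneg _) h.norm_pos.le
  have h1 : EntryLe (act (diagonal a) X * replicateCol Unit v) (‖π‖ * ‖v l‖) := by
    rw [act, Matrix.mul_assoc, Matrix.mul_assoc]
    exact (hX.conjTranspose h).mul_one_left hAX hc
  rw [entryLe_mul_iff_of_sub_one hM h.norm_pos.le h.norm_lt_one hc] at h1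
  have h2 : ‖v l‖ ≤ ‖π‖ * ‖v l‖ := h1 l ()
  have h3 := h.norm_lt_one
  nlinarith

/-- Multiply by `π`: the form `π A_i^{[r]}` is integral with only `i` unit diagonal entries, while
the lower right block of `πB` is `1_n`. The congruence modulo `π^d` becomes one modulo `π^{d+1}`, so
even `d = 0` gives a contradiction modulo `π`. -/
theorem suppSet_blockB_empty {n : ℕ} (B₁ : Matrix (Fin n) (Fin n) E) {i : ℕ} (hi : i < n)
    (k r d : ℕ) : {X | X ∈ suppSet E π n k i r ∧
      EntryLe (act (stab (gramA E π n i) r) (of X) - blockB π B₁) (‖π‖ ^ d)} = ∅ := by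
  rw [Set.eq_empty_iff_forall_notMem]
  rintro X ⟨⟨hX, -⟩, hXB⟩
  have h0 := h.ne_zeroE
  have hn1 := h.norm_lt_one.le
  let a : Fin (n + n) ⊕ Fin (2 * r) → E :=
    Sum.elim (fun k => if (k : ℕ) < 2 * n - i then algebraMap F E π else 1) fun _ => algebraMap F E π
  have hna : ‖algebraMap F E π‖ = ‖π‖ := norm_algebraMap' E π
  have hA : algebraMap F E π • stab (gramA E π n i) r = diagonal a := by
    have hg : gramA E π n i = diagonal fun k : Fin (n + n) =>
      if (k : ℕ) < 2 * n - i then 1 else (algebraMap F E π)⁻¹ := rfl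
    rw [stab, hg, ← diagonal_one, fromBlocks_diagonal, ← diagonal_smul]
    congr 1
    ext k
    rcases k with k | k
    · simp only [a, Pi.smul_apply, Sum.elim_inl, smul_eq_mul]
      split_ifs
      · rw [mul_one]
      · rw [mul_inv_cancel₀ h0]
    · simp [a]
  have hX2 : EntryLe ((of X).submatrix id (Fin.natAdd n : Fin n → Fin (n + n))) 1 :=
    fun u v => hX _ _
  refine h.not_entryLe_act_sub_one a (i := i)
    (fun u => Sum.inl ⟨2 * n - i + u, by lia⟩) ?_ (by simpa using hi) hX2 ?_
  · rintro (u | u) hu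
    · simp only [a, Sum.elim_inl]
      split_ifs with hlt
      · rw [hna]
      · exfalso
        exact hu ⟨⟨u - (2 * n - i), by lia⟩, congrArg Sum.inl (Fin.ext (by simp; lia))⟩
    · simp [a, hna]
  · have h1 : EntryLe (algebraMap F E π • (act (stab (gramA E π n i) r) (of X) - blockB π B₁))
        (‖π‖ * 1) :=
      h.entryLe_smul_iff.2 (hXB.mono (pow_le_one₀ h.norm_pos.le hn1))
    rw [mul_one] at h1
    have h2 : EntryLe ((algebraMap F E π • (act (stab (gramA E π n i) r) (of X) -
      blockB π B₁)).submatrix (Fin.natAdd n) (Fin.natAdd n)) ‖π‖ := fun u v => h1 _ _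
    convert h2 using 1
    have e1 : (blockB π B₁).submatrix (Fin.natAdd n) (Fin.natAdd n) = (algebraMap F E π)⁻¹ • 1 := by
      ext u v
      change fromBlocks _ _ _ _ (finSumFinEquiv.symm (Fin.natAdd n u))
        (finSumFinEquiv.symm (Fin.natAdd n v)) = _
      rw [finSumFinEquiv_symm_apply_natAdd, finSumFinEquiv_symm_apply_natAdd]
      rfl
    rw [← hA, smul_sub, submatrix_sub, Pi.sub_apply, Pi.sub_apply, submatrix_smul, Pi.smul_apply,
      Pi.smul_apply, submatrix_smul, Pi.smul_apply, Pi.smul_apply, e1, smul_smul,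
      mul_inv_cancel₀ h0, one_smul, act, act, Matrix.mul_smul, Matrix.smul_mul]
    rfl

end UnramQuad

/-! ### Stabilization of the representation densities. -/

theorem prod_apply_of_const_slice_symm {V W : Type*} [MeasurableSpace V] [MeasurableSpace W]
    (μ : Measure V) (ν : Measure W) [SFinite μ] [SFinite ν] {S : Set (V × W)}
    (hS : MeasurableSet S) {T : Set W} (hT : MeasurableSet T) (c : ENNReal)
    (h1 : ∀ b ∈ T, μ ((fun a => (a, b)) ⁻¹' S) = c)
    (h2 : ∀ b ∉ T, μ ((fun a => (a, b)) ⁻¹' S) = 0) : μ.prod ν S = ν T * c := by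
  rw [← Measure.prod_swap, Measure.map_apply measurable_swap hS]
  exact prod_apply_of_const_slice ν μ (measurable_swap hS) hT c h1 h2

namespace UnramQuad

variable {F E : Type*} [NontriviallyNormedField F] [NontriviallyNormedField E]
    [NormedAlgebra F E] [StarRing E] {π : F} (h : UnramQuad F E π) [ProperSpace E]
    {p n : Type*} [Fintype p] [Fintype n]
include h

/-- The measure given in the theorem lives on matrices of size `2n`; the densities of `B₁` need one
in size `n`. -/
theorem exists_haar_herm (n : Type*) [Fintype n] : ∃ ν : Measure (HermMat n E),
    ν.IsAddHaarMeasure ∧ ν {Y | EntryLe Y.1 1} = 1 := by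
  have := h.continuousStar
  have hcomp : IsCompact {Y : HermMat n E | EntryLe Y.1 1} := by
    have h1 : IsCompact {X : Matrix n n E | EntryLe X 1} := by
      have : {X : Matrix n n E | EntryLe X 1} =
          Set.univ.pi fun _ : n => Set.univ.pi fun _ : n => Metric.closedBall (0 : E) 1 := by
        ext X
        constructor
        · intro hX i _ j _
          simpa using hX i j
        · intro hX i j
          simpa using hX i trivial j trivial
      rw [this]
      exact isCompact_univ_pi fun _ => isCompact_univ_pi fun _ => isCompact_closedBall 0 1
    exact isClosed_selfAdjoint_matrix.isClosedEmbedding_subtypeVal.isCompact_preimage h1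
  have hnhds : {Y : HermMat n E | EntryLe Y.1 1} ∈ 𝓝 (0 : HermMat n E) := by
    change ∀ᶠ Y : HermMat n E in 𝓝 0, ∀ i j, ‖Y.1 i j‖ ≤ 1
    rw [eventually_all]
    intro i
    rw [eventually_all]
    intro j
    have hc : Continuous fun Y : HermMat n E => ‖Y.1 i j‖ :=
      (continuous_subtype_val.matrix_elem i j).norm
    have : ∀ᶠ Y : HermMat n E in 𝓝 0, ‖Y.1 i j‖ < 1 :=
      (isOpen_lt hc continuous_const).mem_nhds (by simp)
    exact this.mono fun Y hY => hY.le
  let K : TopologicalSpace.PositiveCompacts (HermMat n E) :=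
    ⟨⟨{Y | EntryLe Y.1 1}, hcomp⟩, ⟨0, mem_interior_iff_mem_nhds.2 hnhds⟩⟩
  exact ⟨Measure.addHaarMeasure K, inferInstance, Measure.addHaarMeasure_self⟩

omit h [ProperSpace E] [StarRing E] [NormedAlgebra F E] in
theorem exists_entryLe_pow (hπ : 0 < ‖π‖) (hπ1 : ‖π‖ < 1) (X : Matrix n n E) :
    ∃ c : ℕ, EntryLe X (‖π‖ ^ c)⁻¹ := by
  obtain ⟨c, hc⟩ := pow_unbounded_of_one_lt (∑ i, ∑ j, ‖X i j‖) ((one_lt_inv₀ hπ).2 hπ1)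
  refine ⟨c, fun i j => ?_⟩
  rw [← inv_pow]
  refine le_trans ?_ hc.le
  refine le_trans ?_ (Finset.single_le_sum (f := fun i => ∑ j, ‖X i j‖)
    (fun i _ => Finset.sum_nonneg fun j _ => norm_nonneg _) (Finset.mem_univ i))
  exact Finset.single_le_sum (f := fun j => ‖X i j‖) (fun j _ => norm_nonneg _) (Finset.mem_univ j)

variable [IsUltrametricDist E] [MeasurableSpace E] [BorelSpace E] (μ : Measure E)
  [μ.IsAddHaarMeasure] (hμ : μ {x : E | ‖x‖ ≤ 1} = 1) [DecidableEq p] [DecidableEq n]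
include hμ

/-- The volume of the solutions of `ᵗx* x ≡ B + π^d H mod π^{d+1}` does not depend on `H`, for
large `d`. -/
theorem volume_lift {B : Matrix n n E} (hB : B.IsHermitian) (hB' : IsUnit B.det) {c d : ℕ}
    (hc : EntryLe B⁻¹ (‖π‖ ^ c)⁻¹) (hd : c + 1 ≤ d) {H : Matrix n n E} (hH : H.IsHermitian)
    (hH1 : EntryLe H 1) :
    matVol μ p n {x | EntryLe (of x) 1 ∧
      EntryLe ((of x)ᴴ * of x - B - algebraMap F E π ^ d • H) (‖π‖ ^ (d + 1))} =
    matVol μ p n {x | EntryLe (of x) 1 ∧ EntryLe ((of x)ᴴ * of x - B) (‖π‖ ^ (d + 1))} := by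
  have hp := h.norm_pos
  have hp1 := h.norm_lt_one
  set ϖ : E := algebraMap F E π ^ d with hϖ
  have hϖn : ‖ϖ‖ = ‖π‖ ^ d := by rw [hϖ, norm_pow, norm_algebraMap']
  have hs : star ϖ = ϖ := by rw [hϖ, star_pow, h.star_algebraMap]
  obtain ⟨t, ht0⟩ : ∃ t : E, t = 2⁻¹ := ⟨_, rfl⟩
  have ht : t + t = 1 := by rw [← two_mul, ht0]; exact mul_inv_cancel₀ h.twoE_ne
  have hts : star t = t := by rw [ht0, h.star_half]
  have htn : ‖t‖ = 1 := by rw [ht0, norm_inv, h.norm_twoE, inv_one]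
  have hBi : (B⁻¹)ᴴ = B⁻¹ := hB.inv.eq
  have hcinv : 0 ≤ (‖π‖ ^ c)⁻¹ := by positivity
  -- With `κ = ½ π^d B^{-1}H` one has `(1 + κ)* B (1 + κ) = B + π^d H + ¼ π^{2d} H B^{-1} H`. For `d
  -- ≥ c + 1` this gives `κ ≡ 0 mod π` and a last term in `π^{d+1}`, so `x ↦ x(1 + κ)` carries one
  -- congruence to the other.
  obtain ⟨κ, hκ⟩ : ∃ κ, κ = (t * ϖ) • (B⁻¹ * H) := ⟨_, rfl⟩
  have hκH : κᴴ = (t * ϖ) • (H * B⁻¹) := by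
    rw [hκ, conjTranspose_smul, conjTranspose_mul, hBi, hH.eq, star_mul', hs, hts]
  have hdc : ‖π‖ ^ d * (‖π‖ ^ c)⁻¹ ≤ ‖π‖ := by
    rw [mul_inv_le_iff₀ (h.norm_pow_pos c), ← pow_succ']
    exact pow_le_pow_of_le_one hp.le hp1.le hd
  have hκ1 : EntryLe κ ‖π‖ := by
    rw [hκ]
    refine EntryLe.mono ((hc.mul_one_right hH1 hcinv).smul (a := ‖π‖ ^ d) ?_) hdc
    rw [norm_mul, htn, hϖn, one_mul]
  have hk : EntryLe ((1 + κ) - 1) ‖π‖ := by rwa [add_sub_cancel_left]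
  have hkH : EntryLe ((1 + κ)ᴴ - 1) ‖π‖ := by
    have := hκ1.conjTranspose h
    rwa [conjTranspose_add, conjTranspose_one, add_sub_cancel_left]
  have h1p : EntryLe ((1 : Matrix p p E) - 1) ‖π‖ := by simpa using entryLe_zero hp.le
  have hd1 := (h.norm_pow_pos (d + 1)).le
  have hkey : (1 + κ)ᴴ * B * (1 + κ) = B + ϖ • H + (t * ϖ * (t * ϖ)) • (H * (B⁻¹ * H)) := by
    have e1 : B * κ = (t * ϖ) • H := by
      rw [hκ, Matrix.mul_smul, ← Matrix.mul_assoc, mul_nonsing_inv _ hB', Matrix.one_mul]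
    have e2 : κᴴ * B = (t * ϖ) • H := by
      rw [hκH, Matrix.smul_mul, Matrix.mul_assoc, nonsing_inv_mul _ hB', Matrix.mul_one]
    have e3 : ϖ • H = (t * ϖ) • H + (t * ϖ) • H := by
      rw [← add_smul, ← add_mul, ht, one_mul]
    rw [conjTranspose_add, conjTranspose_one, Matrix.add_mul, Matrix.one_mul, Matrix.mul_add,
      Matrix.mul_one, Matrix.add_mul, e1, e2, e3, hκ, Matrix.smul_mul, Matrix.mul_smul, smul_smul]
    abel
  have hsmall : EntryLe ((t * ϖ * (t * ϖ)) • (H * (B⁻¹ * H))) (‖π‖ ^ (d + 1)) := by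
    have h1 : EntryLe (H * (B⁻¹ * H)) (‖π‖ ^ c)⁻¹ :=
      hH1.mul_one_left (hc.mul_one_right hH1 hcinv) hcinv
    refine EntryLe.mono (h1.smul (a := ‖π‖ ^ d * ‖π‖ ^ d) ?_) ?_
    · rw [norm_mul, norm_mul, htn, hϖn, one_mul]
    · rw [mul_assoc, pow_succ]
      exact mul_le_mul_of_nonneg_left hdc (by positivity)
  rw [← matVol_preimage_mul μ hμ hp.le hp1 h1p hk {x | EntryLe (of x) 1 ∧
      EntryLe ((of x)ᴴ * of x - B - ϖ • H) (‖π‖ ^ (d + 1))}]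
  congr 1
  ext x
  simp only [Set.mem_ofPred_eq, Equiv.apply_symm_apply]
  rw [entryLe_mul_mul_iff h1p hk hp.le hp1 zero_le_one, Matrix.one_mul]
  refine and_congr_right fun hx => ?_
  rw [← entryLe_mul_mul_iff hkH hk hp.le hp1 hd1 (X := (of x)ᴴ * of x - B)]
  refine EntryLe.congr_sub ?_
  have : (of x * (1 + κ))ᴴ * (of x * (1 + κ)) - B - ϖ • H -
      (1 + κ)ᴴ * ((of x)ᴴ * of x - B) * (1 + κ) = (t * ϖ * (t * ϖ)) • (H * (B⁻¹ * H)) := by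
    rw [Matrix.mul_sub, Matrix.sub_mul, hkey, conjTranspose_mul]
    simp only [Matrix.mul_assoc]
    abel
  rw [this]
  exact hsmall

/-- Compute in two ways the volume of the pairs `(H, x)` with `x*x - B ≡ π^d H mod π^{d+1}`, both
integral. For fixed `H` the volume is independent of `H` by `volume_lift`. For fixed `x` the `H`
form a coset of `πV` if `x` is a solution modulo `π^d`, and there are none otherwise. -/
theorem volume_step (ν : Measure (HermMat n E)) [ν.IsAddHaarMeasure]
    (hν : ν {Y | EntryLe Y.1 1} = 1) {B : Matrix n n E} (hB : B.IsHermitian)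
    (hB' : IsUnit B.det) {c d : ℕ} (hc : EntryLe B⁻¹ (‖π‖ ^ c)⁻¹) (hd : c + 1 ≤ d) :
    matVol μ p n {x | EntryLe (of x) 1 ∧ EntryLe ((of x)ᴴ * of x - B) (‖π‖ ^ (d + 1))} =
    matVol μ p n {x | EntryLe (of x) 1 ∧ EntryLe ((of x)ᴴ * of x - B) (‖π‖ ^ d)} *
      ν {Y | EntryLe Y.1 ‖π‖} := by
  have := h.continuousStar
  have hp := h.norm_pos
  have hp1 := h.norm_lt_one
  have hd0 := (h.norm_pow_pos d).le
  set ϖ : E := algebraMap F E π ^ d with hϖ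
  have hϖ0 : ϖ ≠ 0 := pow_ne_zero _ h.ne_zeroE
  have hϖn : ‖ϖ‖ = ‖π‖ ^ d := by rw [hϖ, norm_pow, norm_algebraMap']
  have hs : star ϖ = ϖ := by rw [hϖ, star_pow, h.star_algebraMap]
  have hof : Continuous fun x : p → n → E => (of x : Matrix p n E) := continuous_id
  have hofS : Continuous fun y : HermMat n E × (p → n → E) => (of y.2 : Matrix p n E) :=
    continuous_snd
  have hHS : Continuous fun y : HermMat n E × (p → n → E) => y.1.1 :=
    continuous_subtype_val.comp continuous_fst
  have hH : Continuous fun y : HermMat n E => y.1 := continuous_subtype_val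
  let S : Set (HermMat n E × (p → n → E)) := {y | EntryLe y.1.1 1 ∧ EntryLe (of y.2) 1 ∧
    EntryLe ((of y.2)ᴴ * of y.2 - B - ϖ • y.1.1) (‖π‖ ^ (d + 1))}
  have hS : MeasurableSet S := by
    refine ((isClosed_entryLe hHS _).inter ((isClosed_entryLe hofS _).inter
      (isClosed_entryLe ?_ _))).measurableSet
    exact ((hofS.matrix_conjTranspose.matrix_mul hofS).sub continuous_const).sub
      (hHS.const_smul ϖ)
  have h1 := prod_apply_of_const_slice ν (matVol μ p n) hS
    (T := {Y | EntryLe Y.1 1}) (isClosed_entryLe hH _).measurableSet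
    (matVol μ p n {x | EntryLe (of x) 1 ∧ EntryLe ((of x)ᴴ * of x - B) (‖π‖ ^ (d + 1))})
    (fun Y hY => by
      rw [← h.volume_lift μ hμ hB hB' hc hd (H := Y.1) Y.2 hY]
      congr 1
      ext x
      exact and_iff_right hY)
    (fun Y hY => by
      have : Prod.mk Y ⁻¹' S = ∅ := by
        ext x
        exact iff_of_false (fun hx => hY hx.1) (Set.notMem_empty _)
      rw [this, measure_empty])
  have h2 := prod_apply_of_const_slice_symm ν (matVol μ p n) hS
    (T := {x | EntryLe (of x) 1 ∧ EntryLe ((of x)ᴴ * of x - B) (‖π‖ ^ d)})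
    ((isClosed_entryLe hof _).inter (isClosed_entryLe
      ((hof.matrix_conjTranspose.matrix_mul hof).sub continuous_const) _)).measurableSet
    (ν {Y | EntryLe Y.1 ‖π‖})
    (fun x hx => by
      have hZ : (ϖ⁻¹ • ((of x)ᴴ * of x - B)).IsHermitian := by
        simp [IsHermitian, conjTranspose_smul, hs, hB.eq]
      have hZ1 : EntryLe (ϖ⁻¹ • ((of x)ᴴ * of x - B)) 1 := by
        refine EntryLe.mono (hx.2.smul (a := (‖π‖ ^ d)⁻¹) ?_) ?_
        · rw [norm_inv, hϖn]
        · rw [inv_mul_cancel₀ (h.norm_pow_pos d).ne']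
      let H₀ : HermMat n E := ⟨ϖ⁻¹ • ((of x)ᴴ * of x - B), hZ⟩
      have htr := measure_preimage_add_right ν (-H₀) {Y | EntryLe Y.1 ‖π‖}
      rw [← htr]
      congr 1
      ext Y
      have e : (of x)ᴴ * of x - B - ϖ • Y.1 = -(ϖ • (Y.1 - H₀.1)) := by
        rw [smul_sub, smul_smul, mul_inv_cancel₀ hϖ0, one_smul, neg_sub]
      have e' : EntryLe (-(ϖ • (Y.1 - H₀.1))) (‖π‖ ^ (d + 1)) ↔ EntryLe (Y.1 - H₀.1) ‖π‖ := by
        refine forall_congr' fun i => forall_congr' fun j => ?_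
        rw [Matrix.neg_apply, norm_neg, Matrix.smul_apply, smul_eq_mul, norm_mul, hϖn, pow_succ]
        exact mul_le_mul_iff_right₀ (h.norm_pow_pos d)
      have e'' : (Y + -H₀).1 = Y.1 - H₀.1 := by
        rw [AddSubgroup.coe_add, AddSubgroup.coe_neg, sub_eq_add_neg]
      change (EntryLe Y.1 1 ∧ EntryLe (of x) 1 ∧ EntryLe _ _) ↔ EntryLe (Y + -H₀).1 ‖π‖
      rw [e, e', e'']
      refine ⟨fun hY => hY.2.2, fun hY => ⟨?_, hx.1, hY⟩⟩
      rw [← sub_add_cancel Y.1 H₀.1]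
      exact (hY.mono hp1.le).add hZ1)
    (fun x hx => by
      have : (fun Y => (Y, x)) ⁻¹' S = ∅ := by
        ext Y
        refine iff_of_false (fun hY => hx ⟨hY.2.1, ?_⟩) (Set.notMem_empty _)
        have h3 : EntryLe ((of x)ᴴ * of x - B - ϖ • Y.1) (‖π‖ ^ d) :=
          hY.2.2.mono (pow_le_pow_of_le_one hp.le hp1.le (Nat.le_succ d))
        have h4 : EntryLe (ϖ • Y.1) (‖π‖ ^ d) :=
          EntryLe.mono (hY.1.smul hϖn.le) (mul_one _).le
        simpa using h3.add h4
      rw [this, measure_empty])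
  rw [h1, hν, one_mul] at h2
  exact h2

variable [IsUltrametricDist F] [ProperSpace F]

/-- The approximations of the representation density stabilize. -/
theorem densApprox_stable {B : Matrix n n E} (hB : B.IsHermitian) (hB' : IsUnit B.det) {c d : ℕ}
    (hc : EntryLe B⁻¹ (‖π‖ ^ c)⁻¹) (hd : c + 1 ≤ d) :
    densApprox π (1 : Matrix p p E) B d = densApprox π (1 : Matrix p p E) B (c + 1) := by
  obtain ⟨ν, _, hν⟩ := h.exists_haar_herm (E := E) n
  induction d, hd using Nat.le_induction with
  | base => rfl
  | succ d hd ih =>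
    rw [← ih, h.densApprox_eq μ hμ entryLe_one, h.densApprox_eq μ hμ entryLe_one]
    have hq : (resCard F : ℝ) ≠ 0 :=
      Nat.cast_ne_zero.2 (zero_lt_one.trans h.unif.one_lt_resCard).ne'
    simp only [act, Matrix.mul_one]
    rw [measureReal_def, h.volume_step μ hμ ν hν hB hB' hc hd, h.measure_herm_unif μ ν hμ hν,
      ENNReal.toReal_mul, ENNReal.toReal_inv, ENNReal.toReal_pow, ENNReal.toReal_natCast,
      ← measureReal_def, add_mul, pow_add, one_mul]
    congr 1
    field_simp

theorem densApprox_tendsto {B : Matrix n n E} (hB : B.IsHermitian) (hB' : IsUnit B.det) {c : ℕ}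
    (hc : EntryLe B⁻¹ (‖π‖ ^ c)⁻¹) :
    Tendsto (densApprox π (1 : Matrix p p E) B) atTop
      (𝓝 (densApprox π (1 : Matrix p p E) B (c + 1))) := by
  refine tendsto_const_nhds.congr' ?_
  filter_upwards [eventually_ge_atTop (c + 1)] with d hd
  exact (h.densApprox_stable μ hμ hB hB' hc hd).symm

/-- The representation density of `1` by `1` is not zero. -/
theorem densApprox_one_ne_zero (d : ℕ) :
    densApprox π (1 : Matrix n n E) (1 : Matrix n n E) d ≠ 0 := by
  have hq : (resCard F : ℝ) ≠ 0 :=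
    Nat.cast_ne_zero.2 (zero_lt_one.trans h.unif.one_lt_resCard).ne'
  rw [h.densApprox_eq μ hμ entryLe_one, Complex.ofReal_ne_zero]
  refine mul_ne_zero (pow_ne_zero _ hq) ?_
  have hd1 : ‖π‖ ^ d ≤ 1 := pow_le_one₀ h.norm_pos.le h.norm_lt_one.le
  -- The residue class of the identity matrix consists of solutions and has positive volume.
  have hsub : {x : n → n → E | EntryLe (of x - of (of.symm (1 : Matrix n n E))) (‖π‖ ^ d)} ⊆
      {x | EntryLe (of x) 1 ∧ EntryLe (act 1 (of x) - 1) (‖π‖ ^ d)} := by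
    intro x hx
    have hx : EntryLe (of x - 1) (‖π‖ ^ d) := hx
    have hx1 : EntryLe (of x) 1 := by simpa using (hx.mono hd1).add entryLe_one
    refine ⟨hx1, ?_⟩
    have := h.entryLe_act_sub_act entryLe_one hx1 entryLe_one (h.norm_pow_pos d).le hx
    simpa [act] using this
  have h1 : matVol μ n n {x | EntryLe (of x) 1 ∧ EntryLe (act 1 (of x) - 1) (‖π‖ ^ d)} ≠ 0 := by
    intro h0
    have h2 := measure_mono_null hsub h0
    rw [matVol_entryLe_sub, h.matVol_le_pow μ hμ, ENNReal.inv_eq_zero] at h2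
    exact ENNReal.pow_ne_top (ENNReal.natCast_ne_top _) h2
  have h2 : matVol μ n n {x | EntryLe (of x) 1 ∧ EntryLe (act 1 (of x) - 1) (‖π‖ ^ d)} ≠ ⊤ := by
    refine ne_top_of_le_ne_top ENNReal.one_ne_top ?_
    rw [← h.matVol_le_one μ hμ n n]
    exact measure_mono fun x hx => hx.1
  exact ENNReal.toReal_ne_zero.2 ⟨h1, h2⟩

end UnramQuad

/-! ### Cardinalities of modules, the residue field of `E`, and `-1` as a norm. -/

/-- The cardinality of a finite module over a local ring is a power of that of the residue field. -/
theorem exists_card_eq_pow_card_residueField {R : Type*} [CommRing R] [IsLocalRing R] (m : ℕ) :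
    ∀ (M : Type*) [AddCommGroup M] [Module R M] [Finite M], Nat.card M = m →
      ∃ k, Nat.card M = Nat.card (IsLocalRing.ResidueField R) ^ k := by
  induction m using Nat.strong_induction_on with
  | _ m ih =>
    intro M _ _ _ hM
    rcases subsingleton_or_nontrivial M with hs | hn
    · exact ⟨0, by rw [pow_zero, Nat.card_unique]⟩
    let I := IsLocalRing.maximalIdeal R
    let M' : Submodule R M := I • ⊤
    -- Nakayama: the submodule `𝔪M` is proper, so the induction applies to it, and `M / 𝔪M` is a
    -- vector space over the residue field.
    have hlt : M' ≠ ⊤ := by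
      intro htop
      have hbot := Submodule.eq_bot_of_le_smul_of_le_jacobson_bot I ⊤ Module.Finite.fg_top htop.ge
        (IsLocalRing.maximalIdeal_le_jacobson _)
      exact top_ne_bot hbot
    have hcard : Nat.card M = Nat.card M' * Nat.card (M ⧸ M') := by
      rw [mul_comm]
      exact M'.toAddSubgroup.card_eq_card_quotient_mul_card_addSubgroup
    have hfin : Finite (M ⧸ M') := Finite.of_surjective _ M'.mkQ_surjective
    have hquot : ∃ k, Nat.card (M ⧸ M') = Nat.card (IsLocalRing.ResidueField R) ^ k := by
      let _ : Field (R ⧸ I) := Ideal.Quotient.field I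
      have : Module.Finite (R ⧸ I) (M ⧸ M') := Module.Finite.of_finite
      exact ⟨_, Module.natCard_eq_pow_finrank (K := R ⧸ I) (V := M ⧸ M')⟩
    have hsmall : Nat.card M' < m := by
      rw [← hM]
      have : Nontrivial (M ⧸ M') := Submodule.Quotient.nontrivial_iff.2 hlt
      have h1 : 1 < Nat.card (M ⧸ M') := Finite.one_lt_card
      have h2 : 0 < Nat.card M' := Nat.card_pos
      rw [hcard]
      nlinarith
    obtain ⟨k, hk⟩ := hquot
    obtain ⟨l, hl⟩ := ih _ hsmall M' rfl
    exact ⟨l + k, by rw [hcard, hk, hl, pow_add]⟩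

namespace UnramQuad

variable {F E : Type*} [NontriviallyNormedField F] [NontriviallyNormedField E]
    [NormedAlgebra F E] [StarRing E] {π : F} (h : UnramQuad F E π)
    [IsUltrametricDist F] [IsUltrametricDist E] [ProperSpace F] [ProperSpace E]
include h

/-- Both sides are the inverse of the volume of `πO_E`, computed once within `E` and once from the
basis `1, w` over `F`. -/
theorem resCard_sq : resCard E = resCard F ^ 2 := by
  let _ : MeasurableSpace E := borel E
  have : BorelSpace E := ⟨rfl⟩
  let K₀ : TopologicalSpace.PositiveCompacts E := ⟨⟨Metric.closedBall 0 1, isCompact_closedBall 0 1⟩,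
    ⟨0, mem_interior_iff_mem_nhds.2 (Metric.closedBall_mem_nhds 0 one_pos)⟩⟩
  let μ : Measure E := Measure.addHaarMeasure K₀
  have hμ : μ {x : E | ‖x‖ ≤ 1} = 1 := by
    have : (K₀ : Set E) = {x : E | ‖x‖ ≤ 1} := by
      ext x
      change x ∈ Metric.closedBall 0 1 ↔ _
      simp
    rw [← this]
    exact Measure.addHaarMeasure_self
  have h1 := h.unifE.resCard_mul_measure μ
  rw [norm_algebraMap', hμ, h.measure_unif μ hμ] at h1
  have h2 := ENNReal.eq_inv_of_mul_eq_one_left h1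
  rw [inv_inv] at h2
  exact_mod_cast h2

-- With `u = w²`, a unit of `O_F`, the norm of `a + bw` is `a² - ub²`. Over a finite field of odd
-- order, `a² - ub² + 1` has a zero, which lifts to `O_F`.
omit [IsUltrametricDist E] [ProperSpace E] in
theorem exists_norm_residue : ∃ ε : E, ‖ε * star ε + 1‖ ≤ ‖π‖ := by
  obtain ⟨w, hw1, hws⟩ := h.imag
  obtain ⟨u, hu⟩ := h.fixed (w * w) (by rw [star_mul', hws, neg_mul_neg])
  have hu1 : ‖u‖ = 1 := by rw [← norm_algebraMap' E u, hu, norm_mul, hw1, one_mul]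
  have : Finite (Valued.ResidueField F) := h.unif.finite_residueField
  let _ : Fintype (Valued.ResidueField F) := Fintype.ofFinite _
  let u' : Valued.integer F := ⟨u, Valued.integer.mem_iff.2 hu1.le⟩
  have hu0 : IsLocalRing.residue _ u' ≠ 0 := by
    rw [Ne, IsLocalRing.residue_eq_zero_iff, h.unif.mem_maximalIdeal_iff]
    change ¬ ‖u‖ ≤ ‖π‖
    rw [hu1]
    exact not_le.2 h.norm_lt_one
  have h20 : (2 : Valued.ResidueField F) ≠ 0 := by
    have : (2 : Valued.ResidueField F) = IsLocalRing.residue _ (2 : Valued.integer F) := by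
      rw [map_ofNat]
    rw [this, Ne, IsLocalRing.residue_eq_zero_iff, h.unif.mem_maximalIdeal_iff]
    change ¬ ‖(2 : F)‖ ≤ ‖π‖
    rw [h.norm_two]
    exact not_le.2 h.norm_lt_one
  have hodd : Fintype.card (Valued.ResidueField F) % 2 = 1 :=
    FiniteField.odd_card_of_char_ne_two fun hchar => by
      have := ringChar.Nat.cast_ringChar (R := Valued.ResidueField F)
      rw [hchar] at this
      exact h20 (by exact_mod_cast this)
  obtain ⟨a, b, hab⟩ := FiniteField.exists_root_sum_quadratic
    (f := (Polynomial.X ^ 2 : Polynomial (Valued.ResidueField F)))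
    (g := Polynomial.C (-IsLocalRing.residue _ u') * Polynomial.X ^ 2 + Polynomial.C 0 * Polynomial.X
      + Polynomial.C 1) (Polynomial.degree_X_pow 2)
    (Polynomial.degree_quadratic (neg_ne_zero.2 hu0)) hodd
  obtain ⟨a, rfl⟩ := IsLocalRing.residue_surjective a
  obtain ⟨b, rfl⟩ := IsLocalRing.residue_surjective b
  have hmem : a * a - u' * (b * b) + 1 ∈ IsLocalRing.maximalIdeal (Valued.integer F) := by
    rw [← IsLocalRing.residue_eq_zero_iff]
    simp only [Polynomial.eval_add, Polynomial.eval_mul, Polynomial.eval_pow, Polynomial.eval_X,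
      Polynomial.eval_C] at hab
    simp only [map_add, map_sub, map_mul, map_one]
    linear_combination hab
  rw [h.unif.mem_maximalIdeal_iff] at hmem
  refine ⟨algebraMap F E a + algebraMap F E b * w, ?_⟩
  have : (algebraMap F E a + algebraMap F E b * w) * star (algebraMap F E a + algebraMap F E b * w) +
      1 = algebraMap F E ((a : F) * a - u * (b * b) + 1) := by
    rw [star_add, star_mul', h.star_algebraMap, h.star_algebraMap, hws]
    simp only [map_add, map_sub, map_mul, map_one, hu]
    ring
  rw [this, norm_algebraMap']
  exact hmem

omit [ProperSpace E] in
/-- Modulo any power of `π`, `-1` is a norm. -/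
theorem exists_norm_approx (d : ℕ) : ∃ ε : E, ‖ε‖ = 1 ∧ ‖ε * star ε + 1‖ ≤ ‖π‖ ^ d := by
  obtain ⟨ε, hε⟩ := h.exists_norm_residue
  have hp := h.norm_pos
  have hp1 := h.norm_lt_one
  have key : ∀ z : E, ‖z * star z + 1‖ < 1 → ‖z * star z‖ = 1 := fun z hz => by
    have := IsUltrametricDist.norm_add_eq_max_of_norm_ne_norm (x := z * star z + 1) (y := (-1 : E))
      (by rw [norm_neg, norm_one]; exact hz.ne)
    rw [add_neg_cancel_right, norm_neg, norm_one, max_eq_right hz.le] at this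
    exact this
  have hN := key ε (hε.trans_lt hp1)
  set N := ε * star ε with hNdef
  have hN0 : N ≠ 0 := norm_pos_iff.1 (by rw [hN]; exact one_pos)
  have hNs : star N = N := by rw [hNdef, star_mul', star_star, mul_comm]
  -- Since `N = ε ε* ≡ -1`, the `1 × 1` hermitian matrix `-1/N` is `≡ 1 mod π` and hence
  -- approximately `t* t`. Then `εt` has norm approximately `-1`.
  obtain ⟨T, -, hT⟩ := h.exists_conjTranspose_mul_self (n := Unit) (S := of fun _ _ => -N⁻¹)
    (by
      ext i j
      simp [hNs])
    (by
      intro i j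
      simp only [Matrix.sub_apply, of_apply, Matrix.one_apply]
      rw [if_pos trivial]
      have : -N⁻¹ - 1 = -((N + 1) / N) := by field_simp; ring
      rw [this, norm_neg, norm_div, hN, div_one]
      exact hε) d
  have hT' : ‖star (T () ()) * T () () + N⁻¹‖ ≤ ‖π‖ ^ (d + 1) := by
    have := hT () ()
    simpa [Matrix.mul_apply] using this
  have hb : ‖(ε * T () ()) * star (ε * T () ()) + 1‖ ≤ ‖π‖ ^ (d + 1) := by
    have : (ε * T () ()) * star (ε * T () ()) + 1 = N * (star (T () ()) * T () () + N⁻¹) := by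
      rw [mul_add, mul_inv_cancel₀ hN0, star_mul', hNdef]
      ring
    rw [this, norm_mul, hN, one_mul]
    exact hT'
  have hlt : ‖π‖ ^ (d + 1) < 1 := pow_lt_one₀ hp.le hp1 (Nat.succ_ne_zero d)
  refine ⟨ε * T () (), ?_, hb.trans (pow_le_pow_of_le_one hp.le hp1.le (Nat.le_succ d))⟩
  have := key _ (hb.trans_lt hlt)
  rw [norm_mul, h.norm_star, ← sq] at this
  exact (pow_eq_one_iff_of_nonneg (norm_nonneg _) two_ne_zero).1 this

end UnramQuad

/-! ### Gauss integrals of hermitian matrices. -/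

/-- The hermitian form `v Y ᵗv*` on row vectors. -/
def hermForm {E : Type*} [NontriviallyNormedField E] [StarRing E] {n : Type*} [Fintype n]
    (Y : Matrix n n E) (v : n → E) : E :=
  v ⬝ᵥ (Y *ᵥ star v)

/-- The vectors with integral entries. -/
def intVec (n E : Type*) [NontriviallyNormedField E] : Set (n → E) := {v | ∀ j, ‖v j‖ ≤ 1}

/-- The Gauss integral attached to the hermitian matrix `Y`. -/
noncomputable def gaussInt {F E : Type*} [NontriviallyNormedField F] [NontriviallyNormedField E]
    [NormedAlgebra F E] [StarRing E] [MeasurableSpace E] (ψ : AddChar F Circle) (μ : Measure E)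
    {n : Type*} [Fintype n] (Y : Matrix n n E) : ℂ :=
  ∫ v in intVec n E, ((ψ (toBase F (hermForm Y v)) : Circle) : ℂ) ∂(Measure.pi fun _ => μ)

section

variable {E : Type*} [NontriviallyNormedField E] {n : Type*}

theorem add_mem_intVec_iff [IsUltrametricDist E] {v w : n → E} (hw : w ∈ intVec n E) :
    v + w ∈ intVec n E ↔ v ∈ intVec n E := by
  refine forall_congr' fun j => ⟨fun hj => ?_, fun hj => norm_add_le_of_le hj (hw j)⟩
  simpa using norm_sub_le_of_le hj (hw j)

theorem isClosed_intVec : IsClosed (intVec n E) := by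
  simp only [intVec, Set.ofPred_forall]
  exact isClosed_iInter fun j => isClosed_le (continuous_apply j).norm continuous_const

theorem pi_le [MeasurableSpace E] (μ : Measure E) [SigmaFinite μ] [Fintype n] (c : ℝ) :
    (Measure.pi fun _ : n => μ) {v | ∀ j, ‖v j‖ ≤ c} = μ {x | ‖x‖ ≤ c} ^ Fintype.card n := by
  have : {v : n → E | ∀ j, ‖v j‖ ≤ c} = Set.univ.pi fun _ : n => {x | ‖x‖ ≤ c} := by
    ext v
    simp [Set.mem_pi]
  rw [this, Measure.pi_pi, Finset.prod_const, Finset.card_univ]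

variable [StarRing E] [Fintype n]

theorem hermForm_add {Y : Matrix n n E} (hY : Y.IsHermitian) (x y : n → E) :
    hermForm Y (x + y) =
      hermForm Y x + (y ⬝ᵥ (Y *ᵥ star x) + star (y ⬝ᵥ (Y *ᵥ star x))) + hermForm Y y := by
  have : star (y ⬝ᵥ (Y *ᵥ star x)) = x ⬝ᵥ (Y *ᵥ star y) := by
    rw [← star_dotProduct_star, star_mulVec, star_star, hY.eq, ← dotProduct_mulVec]
  rw [this, hermForm, hermForm, hermForm, star_add, mulVec_add, add_dotProduct, dotProduct_add,
    dotProduct_add]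
  ring

theorem hermForm_neg (Y : Matrix n n E) (v : n → E) : hermForm (-Y) v = -hermForm Y v := by
  rw [hermForm, hermForm, neg_mulVec, dotProduct_neg]

theorem hermForm_smul (Y : Matrix n n E) (ε : E) (v : n → E) :
    hermForm Y (ε • v) = ε * star ε * hermForm Y v := by
  rw [hermForm, hermForm, star_smul, mulVec_smul, smul_dotProduct, dotProduct_smul, smul_eq_mul,
    smul_eq_mul, mul_assoc]

theorem continuous_hermForm [ContinuousStar E] {α : Type*} [TopologicalSpace α]
    {Y : α → Matrix n n E} {v : α → n → E} (hY : Continuous Y) (hv : Continuous v) :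
    Continuous fun a => hermForm (Y a) (v a) :=
  hv.dotProduct (hY.matrix_mulVec hv.star)

end

theorem norm_dotProduct_le {E : Type*} [NontriviallyNormedField E] [IsUltrametricDist E]
    {n : Type*} [Fintype n] {v w : n → E} {c : ℝ} (hv : v ∈ intVec n E) (hw : ∀ j, ‖w j‖ ≤ c)
    (hc : 0 ≤ c) : ‖v ⬝ᵥ w‖ ≤ c := by
  refine IsUltrametricDist.norm_sum_le_of_forall_le_of_nonneg hc fun k _ => ?_
  rw [norm_mul]
  exact (mul_le_of_le_one_left (norm_nonneg _) (hv k)).trans (hw k)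

namespace UnramQuad

variable {F E : Type*} [NontriviallyNormedField F] [NontriviallyNormedField E]
    [NormedAlgebra F E] [StarRing E] {π : F} (h : UnramQuad F E π) [IsUltrametricDist E]
    {n : Type*} [Fintype n] {ψ : AddChar F Circle}
include h

omit [Fintype n] [IsUltrametricDist E] in
theorem star_mem_intVec {v : n → E} (hv : v ∈ intVec n E) : star v ∈ intVec n E := fun j =>
  (h.norm_star (v j)).trans_le (hv j)

theorem norm_mulVec_star_le {Y : Matrix n n E} {c : ℝ} (hY : EntryLe Y c) (hc : 0 ≤ c) {v : n → E}
    (hv : v ∈ intVec n E) (j : n) : ‖(Y *ᵥ star v) j‖ ≤ c := by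
  rw [mulVec, dotProduct_comm]
  exact norm_dotProduct_le (h.star_mem_intVec hv) (hY j) hc

theorem norm_hermForm_le {Y : Matrix n n E} {c : ℝ} (hY : EntryLe Y c) (hc : 0 ≤ c) {v : n → E}
    (hv : v ∈ intVec n E) : ‖hermForm Y v‖ ≤ c :=
  norm_dotProduct_le hv (h.norm_mulVec_star_le hY hc hv) hc

variable [ProperSpace E] [MeasurableSpace E] [BorelSpace E] (μ : Measure E) [μ.IsAddHaarMeasure]
  (hψ : ∀ a : F, ‖a‖ ≤ 1 → ψ a = 1)
include hψ

omit [ProperSpace E] [MeasurableSpace E] [BorelSpace E] in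
theorem continuous_char_hermForm {α : Type*} [TopologicalSpace α]
    {Y : α → Matrix n n E} {v : α → n → E} (hY : Continuous Y) (hv : Continuous v) :
    Continuous fun a => ((ψ (toBase F (hermForm (Y a) (v a))) : Circle) : ℂ) := by
  have := h.continuousStar
  exact continuous_subtype_val.comp ((continuous_addChar hψ).comp
    (h.continuous_toBase.comp (continuous_hermForm hY hv)))

variable (hμ : μ {x : E | ‖x‖ ≤ 1} = 1)
include hμ

/-- Gauss integrals are real. -/
theorem gaussInt_neg [IsUltrametricDist F] [ProperSpace F] {Y : Matrix n n E} {d : ℕ}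
    (hY : EntryLe Y (‖π‖ ^ (-(d : ℤ)))) : gaussInt ψ μ (-Y) = gaussInt ψ μ Y := by
  -- The substitution `v ↦ εv` multiplies the form by `ε ε* ≡ -1 mod π^d`. As `Y` has entries in
  -- `π^{-d}O_E`, the error is integral and `ψ` does not see it.
  obtain ⟨ε, hε1, hε⟩ := h.exists_norm_approx (E := E) d
  have hε0 : ε ≠ 0 := norm_pos_iff.1 (by rw [hε1]; exact one_pos)
  let e : (n → E) ≃+ (n → E) :=
    { toFun := fun v => ε • v
      invFun := fun v => ε⁻¹ • v
      left_inv := fun v => inv_smul_smul₀ hε0 v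
      right_inv := fun v => smul_inv_smul₀ hε0 v
      map_add' := smul_add ε }
  have he : Continuous e := continuous_const_smul ε
  have he' : Continuous e.symm := continuous_const_smul ε⁻¹
  have hmem : e ⁻¹' intVec n E = intVec n E := by
    ext v
    refine forall_congr' fun j => ?_
    change ‖ε * v j‖ ≤ 1 ↔ _
    rw [norm_mul, hε1, one_mul]
  have hvol : (Measure.pi fun _ : n => μ) (intVec n E) = 1 := by
    rw [intVec, pi_le, hμ, one_pow]
  have hHaar : (Measure.pi fun _ : n => μ).IsAddHaarMeasure := Measure.pi.isAddHaarMeasure _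
  have hpres : MeasurePreserving e (Measure.pi fun _ : n => μ) (Measure.pi fun _ : n => μ) := by
    refine ⟨he.measurable, Measure.ext fun S hS => ?_⟩
    rw [Measure.map_apply he.measurable hS]
    exact measure_preimage_of_haar _ _ e he he' hvol (by rw [hmem, hvol]) S
  symm
  rw [gaussInt, gaussInt, ← hpres.setIntegral_preimage_emb
    (Homeomorph.mk e.toEquiv he he').measurableEmbedding, hmem]
  refine setIntegral_congr_fun isClosed_intVec.measurableSet fun v hv => ?_
  have hb := h.norm_hermForm_le hY (by have := h.norm_pos; positivity) hv
  have : ψ (toBase F ((ε * star ε + 1) * hermForm Y v)) = 1 := by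
    refine hψ _ ((h.norm_toBase_le _).trans ?_)
    rw [norm_mul]
    calc _ ≤ ‖π‖ ^ d * ‖π‖ ^ (-(d : ℤ)) :=
          mul_le_mul hε hb (norm_nonneg _) (h.norm_pow_pos d).le
      _ = 1 := by
          rw [_root_.zpow_neg, zpow_natCast, mul_inv_cancel₀ (h.norm_pow_pos d).ne']
  change ((ψ (toBase F (hermForm Y (ε • v))) : Circle) : ℂ) =
    ((ψ (toBase F (hermForm (-Y) v)) : Circle) : ℂ)
  have e2 : hermForm Y (ε • v) = (ε * star ε + 1) * hermForm Y v + hermForm (-Y) v := by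
    rw [hermForm_smul, hermForm_neg]
    ring
  rw [e2, toBase_add, AddChar.map_add_eq_mul, this, one_mul]

/-- Orthogonality for the characters of the lattice of integral vectors. -/
theorem integral_char_dotProduct (hψ' : ∃ a : F, ‖a‖ ≤ ‖π‖⁻¹ ∧ ψ a ≠ 1) (w : n → E)
    [Decidable (w ∈ intVec n E)] :
    ∫ y in intVec n E, ((ψ (toBase F (y ⬝ᵥ w + star (y ⬝ᵥ w))) : Circle) : ℂ)
      ∂(Measure.pi fun _ => μ) = if w ∈ intVec n E then 1 else 0 := by
  classical
  have hvol : (Measure.pi fun _ : n => μ) (intVec n E) = 1 := by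
    rw [intVec, pi_le, hμ, one_pow]
  have hHaar : (Measure.pi fun _ : n => μ).IsAddHaarMeasure := Measure.pi.isAddHaarMeasure _
  split_ifs with hw
  · rw [setIntegral_congr_fun (g := fun _ => (1 : ℂ)) isClosed_intVec.measurableSet]
    · simp [measureReal_def, hvol]
    · intro y hy
      have h1 := norm_dotProduct_le hy hw zero_le_one
      have : ψ (toBase F (y ⬝ᵥ w + star (y ⬝ᵥ w))) = 1 :=
        hψ _ ((h.norm_toBase_le _).trans
          (norm_add_le_of_le h1 ((h.norm_star _).trans_le h1)))
      simp only [this, Circle.coe_one]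
  · obtain ⟨b, hb, hψb⟩ := hψ'
    have : NeZero (2 : F) := ⟨h.two_ne⟩
    simp only [intVec, Set.mem_ofPred_eq, not_forall, not_le] at hw
    obtain ⟨j, hj⟩ := hw
    have hj0 : w j ≠ 0 := norm_pos_iff.1 (one_pos.trans hj)
    have hwj : ‖π‖⁻¹ ≤ ‖w j‖ := by
      by_contra hlt
      rw [not_le, ← _root_.zpow_neg_one] at hlt
      have := h.le_of_lt_zpow hlt
      rw [neg_add_cancel, zpow_zero] at this
      exact absurd hj (not_lt.2 this)
    let a : E := algebraMap F E (b / 2) / w j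
    have ha : ‖a‖ ≤ 1 := by
      rw [norm_div, norm_algebraMap', norm_div, h.norm_two, div_one]
      exact div_le_one_of_le₀ (hb.trans hwj) (norm_nonneg _)
    have haw : Pi.single j a ⬝ᵥ w = algebraMap F E (b / 2) := by
      rw [single_dotProduct, div_mul_cancel₀ _ hj0]
    refine setIntegral_eq_zero_of_translate _ isClosed_intVec.measurableSet (g := Pi.single j a)
      (c := ((ψ b : Circle) : ℂ)) (fun hc => hψb (Circle.ext hc)) (fun y => ?_) (fun y => ?_)
    · refine add_mem_intVec_iff fun k => ?_
      by_cases hk : k = j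
      · subst hk
        simpa using ha
      · simp [hk]
    · have : toBase F ((y + Pi.single j a) ⬝ᵥ w + star ((y + Pi.single j a) ⬝ᵥ w)) =
          b + toBase F (y ⬝ᵥ w + star (y ⬝ᵥ w)) := by
        rw [add_dotProduct, haw, star_add, h.star_algebraMap, add_add_add_comm, toBase_add,
          ← map_add, add_halves, h.toBase_algebraMap, add_comm]
      rw [this, AddChar.map_add_eq_mul, Circle.coe_mul]

/-- Shift `x` to `x + y` in the product: the term `ψ(y Y y*)` cancels and only the pairing of `y`
with `Y x*` and the form at `x` remain. Integration over `y` forces `Y x*` to be integral, and then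
the form at `x` is integral too. -/
theorem gaussInt_mul_neg (hψ' : ∃ a : F, ‖a‖ ≤ ‖π‖⁻¹ ∧ ψ a ≠ 1) {Y : Matrix n n E}
    (hY : Y.IsHermitian) : gaussInt ψ μ Y * gaussInt ψ μ (-Y) =
      ((Measure.pi fun _ : n => μ).real {x | x ∈ intVec n E ∧ Y *ᵥ star x ∈ intVec n E} : ℂ) := by
  classical
  have := h.continuousStar
  have hvol : (Measure.pi fun _ : n => μ) (intVec n E) = 1 := by
    rw [intVec, pi_le, hμ, one_pow]
  have hHaar : (Measure.pi fun _ : n => μ).IsAddHaarMeasure := Measure.pi.isAddHaarMeasure _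
  have hO : MeasurableSet (intVec n E) := isClosed_intVec.measurableSet
  have hfin : IsFiniteMeasure ((Measure.pi fun _ : n => μ).restrict (intVec n E)) :=
    isFiniteMeasure_restrict.2 (by rw [hvol]; exact ENNReal.one_ne_top)
  set κ := Measure.pi fun _ : n => μ with hκ
  let f : (n → E) → (n → E) → ℂ := fun y x =>
    ((ψ (toBase F (hermForm Y x)) : Circle) : ℂ) *
      ((ψ (toBase F (y ⬝ᵥ (Y *ᵥ star x) + star (y ⬝ᵥ (Y *ᵥ star x)))) : Circle) : ℂ)
  have h1 : gaussInt ψ μ Y * gaussInt ψ μ (-Y) =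
      ∫ y in intVec n E, ∫ x in intVec n E, f y x ∂κ ∂κ := by
    rw [gaussInt, gaussInt, ← integral_const_mul]
    refine setIntegral_congr_fun hO fun y hy => ?_
    have htr : ∫ x in intVec n E, ((ψ (toBase F (hermForm Y x)) : Circle) : ℂ) ∂κ =
        ∫ x in intVec n E, ((ψ (toBase F (hermForm Y (x + y))) : Circle) : ℂ) ∂κ := by
      rw [← integral_indicator hO, ← integral_indicator hO, ← integral_add_right_eq_self _ y]
      refine integral_congr_ae (Eventually.of_forall fun x => ?_)
      by_cases hx : x ∈ intVec n E
      · simp only [Set.indicator_of_mem hx, Set.indicator_of_mem ((add_mem_intVec_iff hy).2 hx)]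
      · simp only [Set.indicator_of_notMem hx,
          Set.indicator_of_notMem (mt (add_mem_intVec_iff hy).1 hx)]
    change (∫ x in intVec n E, ((ψ (toBase F (hermForm Y x)) : Circle) : ℂ) ∂κ) *
      ((ψ (toBase F (hermForm (-Y) y)) : Circle) : ℂ) = ∫ x in intVec n E, f y x ∂κ
    rw [htr, ← integral_mul_const]
    refine setIntegral_congr_fun hO fun x _ => ?_
    simp only [f]
    rw [← Circle.coe_mul, ← Circle.coe_mul, ← AddChar.map_add_eq_mul, ← AddChar.map_add_eq_mul,
      ← toBase_add, ← toBase_add, hermForm_add hY, hermForm_neg, add_neg_cancel_right]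
  have c1 : Continuous fun p : (n → E) × (n → E) => f p.1 p.2 := by
    have hz : Continuous fun p : (n → E) × (n → E) => p.1 ⬝ᵥ (Y *ᵥ star p.2) :=
      continuous_fst.dotProduct (continuous_const.matrix_mulVec continuous_snd.star)
    exact (h.continuous_char_hermForm hψ continuous_const continuous_snd).mul
      (continuous_subtype_val.comp ((continuous_addChar hψ).comp
        (h.continuous_toBase.comp (hz.add hz.star))))
  have hcl : IsClosed {x : n → E | Y *ᵥ star x ∈ intVec n E} :=
    isClosed_intVec.preimage (continuous_const.matrix_mulVec continuous_id.star)
  rw [h1, integral_integral_swap]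
  · have h2 : ∀ x ∈ intVec n E, ∫ y in intVec n E, f y x ∂κ =
        {x : n → E | Y *ᵥ star x ∈ intVec n E}.indicator (fun _ => (1 : ℂ)) x := by
      intro x hx
      simp only [f]
      rw [integral_const_mul, h.integral_char_dotProduct μ hψ hμ hψ' (Y *ᵥ star x)]
      by_cases hYx : Y *ᵥ star x ∈ intVec n E
      · have : ψ (toBase F (hermForm Y x)) = 1 :=
          hψ _ ((h.norm_toBase_le _).trans (norm_dotProduct_le hx hYx zero_le_one))
        rw [if_pos hYx, this, Set.indicator_of_mem (by exact hYx)]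
        simp
      · rw [if_neg hYx, mul_zero, Set.indicator_of_notMem (by exact hYx)]
    rw [setIntegral_congr_fun hO h2, integral_indicator hcl.measurableSet, setIntegral_const,
      measureReal_restrict_apply hcl.measurableSet, Set.inter_comm]
    simp only [Complex.real_smul, mul_one]
    rfl
  · refine Integrable.of_bound (C := 1) c1.aestronglyMeasurable (Eventually.of_forall fun p => ?_)
    simp only [Function.uncurry, f, norm_mul, Circle.norm_coe, mul_one]
    exact le_rfl

end UnramQuad

/-! ### Volumes of lattices and the square of a Gauss integral. -/

section

variable {E : Type*} [NontriviallyNormedField E] [ProperSpace E] {n : Type*} [Fintype n]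

omit [Fintype n] in
theorem isCompact_intVec : IsCompact (intVec n E) := by
  have : intVec n E = Set.univ.pi fun _ => Metric.closedBall (0 : E) 1 := by
    ext v
    simp [intVec, Set.mem_pi]
  rw [this]
  exact isCompact_univ_pi fun _ => isCompact_closedBall _ _

/-- A lattice of integral vectors containing `{v | ‖v j‖ ≤ c}` has finite index in the lattice of
all integral vectors. -/
theorem finite_quotient_integer_pi [IsUltrametricDist E]
    (Λ : Submodule (Valued.integer E) (n → Valued.integer E)) {c : ℝ} (hc : 0 < c)
    (hΛ : ∀ v : n → Valued.integer E, (∀ j, ‖(v j : E)‖ ≤ c) → v ∈ Λ) :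
    Finite ((n → Valued.integer E) ⧸ Λ) := by
  have : CompactSpace (Valued.integer E) := compactSpace_integer
  refine AddSubgroup.quotient_finite_of_isOpen Λ.toAddSubgroup ?_
  refine AddSubgroup.isOpen_of_mem_nhds _ (g := 0) ?_
  have : {v : n → Valued.integer E | ∀ j, ‖(v j : E)‖ < c} ∈ 𝓝 (0 : n → Valued.integer E) := by
    refine IsOpen.mem_nhds ?_ (by simpa using fun _ => hc)
    simp only [Set.ofPred_forall]
    exact isOpen_iInter_of_finite fun j => isOpen_lt
      (continuous_norm.comp (continuous_subtype_val.comp (continuous_apply j))) continuous_const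
  filter_upwards [this] with x hx
  exact hΛ x fun j => (hx j).le

/-- The volume of a lattice of integral vectors is the inverse of its index. -/
theorem card_quotient_mul_volume [IsUltrametricDist E] [MeasurableSpace E] [BorelSpace E]
    (μ : Measure E) [μ.IsAddHaarMeasure] (hμ : μ {x : E | ‖x‖ ≤ 1} = 1)
    (Λ : Submodule (Valued.integer E) (n → Valued.integer E))
    [Finite ((n → Valued.integer E) ⧸ Λ)] {S : Set (n → E)} (hS : MeasurableSet S)
    (hS1 : S ⊆ intVec n E)
    (hΛ : ∀ v : n → Valued.integer E, v ∈ Λ ↔ (fun j => (v j : E)) ∈ S) :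
    (Nat.card ((n → Valued.integer E) ⧸ Λ) : ENNReal) * (Measure.pi fun _ => μ) S = 1 := by
  classical
  have hHaar : (Measure.pi fun _ : n => μ).IsAddHaarMeasure := Measure.pi.isAddHaarMeasure _
  let f : (n → E) → (n → Valued.integer E) ⧸ Λ := fun v =>
    if hv : v ∈ intVec n E then
      Λ.mkQ fun j => ⟨v j, Valued.integer.mem_iff.2 (hv j)⟩ else 0
  have hfib : ∀ s ∈ intVec n E,
      {x | x ∈ intVec n E ∧ f x = f s} = (fun x => x + -s) ⁻¹' S := by
    intro s hs
    have hns : -s ∈ intVec n E := fun j => (norm_neg (s j)).trans_le (hs j)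
    ext x
    simp only [Set.mem_ofPred_eq, Set.mem_preimage]
    have key : ∀ hx : x ∈ intVec n E, f x = f s ↔ x + -s ∈ S := by
      intro hx
      simp only [f, dif_pos hx, dif_pos hs]
      rw [← sub_eq_zero, ← map_sub, Submodule.mkQ_apply, Submodule.Quotient.mk_eq_zero, hΛ,
        ← sub_eq_add_neg]
      rfl
    exact ⟨fun hx => (key hx.1).1 hx.2, fun hx =>
      have hx' := (add_mem_intVec_iff hns).1 (hS1 hx)
      ⟨hx', (key hx').2 hx⟩⟩
  have := measure_eq_ncard_mul (Measure.pi fun _ : n => μ) f (intVec n E)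
    ((Measure.pi fun _ => μ) S) (fun s hs => by
      rw [hfib s hs]
      exact (measurable_add_const _) hS) (fun s hs => by
      rw [hfib s hs, measure_preimage_add_right])
  rw [intVec, pi_le, hμ, one_pow] at this
  rw [this, ← Set.ncard_univ]
  congr 3
  symm
  rw [Set.eq_univ_iff_forall]
  intro y
  obtain ⟨v, rfl⟩ := Λ.mkQ_surjective y
  have hv : (fun j => (v j : E)) ∈ intVec n E := fun j => Valued.integer.norm_le_one (v j)
  refine ⟨fun j => v j, hv, ?_⟩
  simp only [f, dif_pos hv]

end

namespace UnramQuad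

variable {F E : Type*} [NontriviallyNormedField F] [NontriviallyNormedField E]
    [NormedAlgebra F E] [StarRing E] {π : F} (h : UnramQuad F E π) [IsUltrametricDist E]
    [IsUltrametricDist F] [ProperSpace F] [ProperSpace E] [MeasurableSpace E] [BorelSpace E]
    {n : Type*} [Fintype n] {ψ : AddChar F Circle} (μ : Measure E) [μ.IsAddHaarMeasure]
    (hμ : μ {x : E | ‖x‖ ≤ 1} = 1)
include h hμ

/-- As `x ↦ Y x*` is semilinear, the set is an `O_E`-lattice. Its index in `O_E^n` is therefore a
power of the residue cardinality `q²` of `E`. It contains `π^d O_E^n`, which gives the bound on `k`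
and later bounds the degree of the polynomial. -/
theorem volume_mulVec_star {Y : Matrix n n E} {d : ℕ} (hY : EntryLe Y (‖π‖ ^ (-(d : ℤ)))) :
    ∃ k ≤ d * Fintype.card n,
      (Measure.pi fun _ : n => μ).real {x | x ∈ intVec n E ∧ Y *ᵥ star x ∈ intVec n E} =
        ((resCard F : ℝ) ^ (2 * k))⁻¹ := by
  have := h.continuousStar
  set S : Set (n → E) := {x | x ∈ intVec n E ∧ Y *ᵥ star x ∈ intVec n E} with hSdef
  have hS : MeasurableSet S :=
    (isClosed_intVec.inter
      (isClosed_intVec.preimage (continuous_const.matrix_mulVec continuous_id.star))).measurableSet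
  have hsub : {x : n → E | ∀ j, ‖x j‖ ≤ ‖π‖ ^ d} ⊆ S := by
    intro x hx
    refine ⟨fun j => (hx j).trans (pow_le_one₀ h.norm_pos.le h.norm_lt_one.le), fun j => ?_⟩
    refine IsUltrametricDist.norm_sum_le_of_forall_le_of_nonneg zero_le_one fun k _ => ?_
    rw [norm_mul]
    calc _ ≤ ‖π‖ ^ (-(d : ℤ)) * ‖π‖ ^ d :=
          mul_le_mul (hY j k) ((h.norm_star _).trans_le (hx k)) (norm_nonneg _)
            (zpow_nonneg (norm_nonneg _) _)
      _ = 1 := by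
          rw [_root_.zpow_neg, zpow_natCast, inv_mul_cancel₀ (h.norm_pow_pos d).ne']
  let Λ : Submodule (Valued.integer E) (n → Valued.integer E) :=
    { carrier := {v | (fun j => (v j : E)) ∈ S}
      zero_mem' := hsub fun j => by simp
      add_mem' := by
        intro v w hv hw
        refine ⟨(add_mem_intVec_iff hw.1).2 hv.1, ?_⟩
        have : Y *ᵥ star (fun j => ((v + w) j : E)) =
            Y *ᵥ star (fun j => (v j : E)) + Y *ᵥ star (fun j => (w j : E)) := by
          rw [← mulVec_add, ← star_add]
          rfl
        change _ ∈ intVec n E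
        rw [this]
        exact (add_mem_intVec_iff hw.2).2 hv.2
      smul_mem' := by
        intro a v hv
        have ha : ‖(a : E)‖ ≤ 1 := Valued.integer.norm_le_one a
        refine ⟨fun j => ?_, ?_⟩
        · change ‖(a : E) * v j‖ ≤ 1
          rw [norm_mul]
          exact mul_le_one₀ ha (norm_nonneg _) (hv.1 j)
        · have : Y *ᵥ star (fun j => ((a • v) j : E)) =
              star (a : E) • (Y *ᵥ star (fun j => (v j : E))) := by
            rw [← mulVec_smul, ← star_smul]
            rfl
          change _ ∈ intVec n E
          rw [this]
          intro j
          rw [Pi.smul_apply, smul_eq_mul, norm_mul, h.norm_star]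
          exact mul_le_one₀ ha (norm_nonneg _) (hv.2 j) }
  have hfin : Finite ((n → Valued.integer E) ⧸ Λ) :=
    finite_quotient_integer_pi Λ (h.norm_pow_pos d) fun v hv => hsub hv
  obtain ⟨k, hk⟩ := exists_card_eq_pow_card_residueField (R := Valued.integer E) _
    ((n → Valued.integer E) ⧸ Λ) rfl
  have hk' : Nat.card ((n → Valued.integer E) ⧸ Λ) = resCard F ^ (2 * k) := by
    rw [hk, pow_mul, ← h.resCard_sq]
    rfl
  have hvol := card_quotient_mul_volume μ hμ Λ hS (fun x hx => hx.1) fun v => Iff.rfl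
  have hq : 1 < resCard F := h.unif.one_lt_resCard
  have hvol' : (Measure.pi fun _ : n => μ) S = ((resCard F : ENNReal) ^ (2 * k))⁻¹ := by
    rw [hk', Nat.cast_pow, mul_comm] at hvol
    exact ENNReal.eq_inv_of_mul_eq_one_left hvol
  refine ⟨k, ?_, ?_⟩
  · have hle := measure_mono (μ := Measure.pi fun _ : n => μ) hsub
    rw [hvol', pi_le, h.measure_le_pow μ hμ, ← ENNReal.inv_pow, ENNReal.inv_le_inv, ← pow_mul] at hle
    have : resCard F ^ (2 * k) ≤ resCard F ^ (2 * d * Fintype.card n) := by exact_mod_cast hle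
    have := (Nat.pow_le_pow_iff_right hq).1 this
    rw [mul_assoc] at this
    omega
  · rw [measureReal_def, hvol', ENNReal.toReal_inv, ENNReal.toReal_pow, ENNReal.toReal_natCast]

/-! ### Fourier expansion and polynomiality of the densities. -/

variable (hψ : ∀ a : F, ‖a‖ ≤ 1 → ψ a = 1)
include hψ

/-- Since `G(-Y) = G(Y)`, the product `G(Y)G(-Y)` is the square. The sign of `G(Y)` stays
undetermined, which does no harm because `r` enters only through `G(Y)^{2r}`. -/
theorem gaussInt_sq (hψ' : ∃ a : F, ‖a‖ ≤ ‖π‖⁻¹ ∧ ψ a ≠ 1) {Y : Matrix n n E}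
    (hYh : Y.IsHermitian) {d : ℕ} (hY : EntryLe Y (‖π‖ ^ (-(d : ℤ)))) :
    ∃ k ≤ d * Fintype.card n, gaussInt ψ μ Y ^ 2 = ((resCard F : ℂ) ^ (2 * k))⁻¹ := by
  obtain ⟨k, hk, hkv⟩ := h.volume_mulVec_star μ hμ hY
  refine ⟨k, hk, ?_⟩
  have := h.gaussInt_mul_neg μ hψ hμ hψ' hYh
  rw [h.gaussInt_neg μ hψ hμ hY, hkv] at this
  rw [sq, this]
  push_cast
  rfl

omit [IsUltrametricDist F] [ProperSpace F] hμ in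
theorem continuous_gaussInt : Continuous fun Y : HermMat n E => gaussInt ψ μ Y.1 := by
  have := h.continuousStar
  have hHaar : (Measure.pi fun _ : n => μ).IsAddHaarMeasure := Measure.pi.isAddHaarMeasure _
  exact continuous_parametric_integral_of_continuous
    (f := fun (Y : HermMat n E) (v : n → E) => ((ψ (toBase F (hermForm Y.1 v)) : Circle) : ℂ))
    (h.continuous_char_hermForm hψ (continuous_subtype_val.comp continuous_fst) continuous_snd)
    isCompact_intVec

omit [IsUltrametricDist F] [ProperSpace F] [BorelSpace E] hψ h in
theorem norm_gaussInt_le_one (Y : Matrix n n E) : ‖gaussInt ψ μ Y‖ ≤ 1 := by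
  have hvol : (Measure.pi fun _ : n => μ) (intVec n E) = 1 := by
    rw [intVec, pi_le, hμ, one_pow]
  refine (norm_setIntegral_le_of_norm_le_const (C := 1) (by rw [hvol]; exact ENNReal.one_lt_top)
    fun v _ => (Circle.norm_coe _).le).trans ?_
  rw [measureReal_def, hvol]
  simp

-- The trace of `Y x* x` is the sum of the values of the hermitian form at the rows of `x`, so the
-- integral splits into one Gauss integral per row.
omit [IsUltrametricDist F] [ProperSpace F] [BorelSpace E] h hμ hψ in
theorem integral_char_act {m : Type*} [Fintype m] [DecidableEq m] (Y B : Matrix n n E) :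
    ∫ x in {x : m → n → E | EntryLe (of x) 1},
      ((ψ (toBase F (trace (Y * (act 1 (of x) - B)))) : Circle) : ℂ) ∂(matVol μ m n) =
    ((ψ (toBase F (-trace (Y * B))) : Circle) : ℂ) * gaussInt ψ μ Y ^ Fintype.card m := by
  have hset : {x : m → n → E | EntryLe (of x) 1} = Set.univ.pi fun _ : m => intVec n E := by
    ext x
    simp [EntryLe, intVec, Set.mem_pi]
  have htr : ∀ x : m → n → E, trace (Y * (act 1 (of x) - B)) =
      -trace (Y * B) + ∑ i, hermForm Y (x i) := by
    intro x
    rw [act, Matrix.mul_one, Matrix.mul_sub, trace_sub, ← Matrix.mul_assoc, trace_mul_comm,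
      sub_eq_neg_add]
    rfl
  have hsum : ∀ (s : Finset m) (x : m → n → E),
      ((ψ (toBase F (∑ i ∈ s, hermForm Y (x i))) : Circle) : ℂ) =
        ∏ i ∈ s, ((ψ (toBase F (hermForm Y (x i))) : Circle) : ℂ) := by
    intro s x
    classical
    induction s using Finset.induction_on with
    | empty => simp [toBase]
    | insert a s ha ih =>
      rw [Finset.sum_insert ha, Finset.prod_insert ha, toBase_add, AddChar.map_add_eq_mul,
        Circle.coe_mul, ih]
  rw [hset, Measure.restrict_pi_pi]
  simp only [htr, toBase_add, AddChar.map_add_eq_mul, Circle.coe_mul, hsum]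
  rw [integral_const_mul,
    integral_fintype_prod_eq_pow (fun v : n → E => ((ψ (toBase F (hermForm Y v)) : Circle) : ℂ))]
  rfl

variable (hψ' : ∃ a : F, ‖a‖ ≤ ‖π‖⁻¹ ∧ ψ a ≠ 1) (ν : Measure (HermMat n E)) [ν.IsAddHaarMeasure]
    (hν : ν {Y | EntryLe Y.1 1} = 1)
include hψ' hν

/-- The Fourier expansion of the local densities. -/
theorem densApprox_eq_integral {m : Type*} [Fintype m] [DecidableEq m] {B : Matrix n n E}
    (hB : B.IsHermitian) (d : ℕ) :
    densApprox π (1 : Matrix m m E) B d =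
      ∫ Y in {Y : HermMat n E | EntryLe Y.1 (‖π‖ ^ (-(d : ℤ)))},
        ((ψ (toBase F (-trace (Y.1 * B))) : Circle) : ℂ) *
          gaussInt ψ μ Y.1 ^ Fintype.card m ∂ν := by
  have := h.continuousStar
  have hνd := h.measure_herm_neg μ ν hμ hν d
  have hA : matVol μ m n {x : m → n → E | EntryLe (of x) 1} ≠ ⊤ := by
    rw [matVol_entryLe, hμ, one_pow]
    exact ENNReal.one_ne_top
  have hZ : ∀ x : m → n → E, (act (1 : Matrix m m E) (of x) - B).IsHermitian := fun x =>
    (act_isHermitian isHermitian_one _).sub hB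
  have hZc : Continuous fun x : m → n → E => act (1 : Matrix m m E) (of x) - B :=
    (continuous_act 1).sub continuous_const
  have := h.integral_integral_char ν hψ hψ' (matVol μ m n) hZ hZc hA d
    (by rw [hνd]; exact ENNReal.pow_ne_top (ENNReal.natCast_ne_top _))
  simp only [integral_char_act] at this
  rw [this, h.densApprox_eq μ hμ entryLe_one, measureReal_def ν, hνd, ENNReal.toReal_pow,
    ENNReal.toReal_natCast]
  rfl

/-- The local densities are polynomials in `(-q)^{-2r}`. -/
theorem exists_isPolyIn_densApprox {m : Type*} [Fintype m] [DecidableEq m] {B : Matrix n n E}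
    (hB : B.IsHermitian) (d : ℕ) : ∃ P : Polynomial ℂ,
      IsPolyIn (resCard F) (fun r => densApprox π (stab (1 : Matrix m m E) r) B d) P := by
  classical
  have := h.continuousStar
  set S : Set (HermMat n E) := {Y | EntryLe Y.1 (‖π‖ ^ (-(d : ℤ)))} with hSdef
  have hS : MeasurableSet S := (isClosed_entryLe continuous_subtype_val _).measurableSet
  have hSfin : ν S ≠ ⊤ := by
    rw [hSdef, h.measure_herm_neg μ ν hμ hν]
    exact ENNReal.pow_ne_top (ENNReal.natCast_ne_top _)
  have : IsFiniteMeasure (ν.restrict S) := isFiniteMeasure_restrict.2 hSfin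
  have hq : 1 < resCard F := h.unif.one_lt_resCard
  have hq0 : (resCard F : ℂ) ≠ 0 := Nat.cast_ne_zero.2 (zero_lt_one.trans hq).ne'
  let y : ℕ → ℂ := fun k => ((resCard F : ℂ) ^ (2 * k))⁻¹
  have hy : Function.Injective y := by
    intro a b hab
    have : resCard F ^ (2 * a) = resCard F ^ (2 * b) := by exact_mod_cast inv_injective hab
    have := Nat.pow_right_injective hq this
    omega
  -- `g k` is the integrand restricted to `G(Y)² = q^{-2k}`. There, `2r` additional rows contribute
  -- the factor `(q^{-2k})^r = x^k`, so the integral of `g k` is the coefficient of `x^k`.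
  let g : ℕ → HermMat n E → ℂ := fun k =>
    {Y : HermMat n E | gaussInt ψ μ Y.1 ^ 2 = y k}.indicator fun Y =>
      ((ψ (toBase F (-trace (Y.1 * B))) : Circle) : ℂ) * gaussInt ψ μ Y.1 ^ Fintype.card m
  have hG := h.continuous_gaussInt (n := n) μ hψ
  have hchar : Continuous fun Y : HermMat n E =>
      ((ψ (toBase F (-trace (Y.1 * B))) : Circle) : ℂ) := by
    refine continuous_subtype_val.comp ((continuous_addChar hψ).comp (h.continuous_toBase.comp ?_))
    exact (continuous_subtype_val.matrix_mul continuous_const).matrix_trace.neg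
  have hg : ∀ k, IntegrableOn (g k) S ν := by
    intro k
    refine Integrable.of_bound (C := 1) ?_ (Eventually.of_forall fun Y => ?_)
    · exact ((hchar.mul (hG.pow _)).stronglyMeasurable.indicator
        (isClosed_eq (hG.pow 2) continuous_const).measurableSet).aestronglyMeasurable
    · refine (norm_indicator_le_norm_self _ _).trans ?_
      rw [norm_mul, Circle.norm_coe, one_mul, norm_pow]
      exact pow_le_one₀ (norm_nonneg _) (norm_gaussInt_le_one μ hμ _)
  refine ⟨∑ k ∈ Finset.range (d * Fintype.card n + 1),
    Polynomial.C (∫ Y in S, g k Y ∂ν) * Polynomial.X ^ k, fun r => ?_⟩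
  have hst : stab (1 : Matrix m m E) r = 1 := fromBlocks_one
  have hx : ∀ k : ℕ, ((-(resCard F : ℂ)) ^ (-(2 * (r : ℤ)))) ^ k = y k ^ r := by
    intro k
    rw [_root_.zpow_neg, _root_.zpow_mul, zpow_ofNat, neg_sq, zpow_natCast]
    simp only [y]
    rw [inv_pow, inv_pow]
    congr 1
    ring
  simp only [Polynomial.eval_finsetSum, Polynomial.eval_mul, Polynomial.eval_C,
    Polynomial.eval_pow, Polynomial.eval_X, hx]
  rw [hst, h.densApprox_eq_integral μ hμ hψ hψ' ν hν hB]
  simp only [← integral_mul_const]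
  rw [← integral_finsetSum _ fun k _ => (hg k).mul_const _]
  refine setIntegral_congr_fun hS fun Y hY => ?_
  obtain ⟨k, hk, hkY⟩ := h.gaussInt_sq μ hμ hψ hψ' Y.2 hY
  change _ = ∑ k ∈ _, _
  rw [Finset.sum_eq_single k]
  · simp only [g]
    rw [Set.indicator_of_mem (by exact hkY), mul_assoc, Fintype.card_sum, Fintype.card_fin, pow_add,
      pow_mul, hkY]
  · intro l _ hl
    simp only [g]
    rw [Set.indicator_of_notMem, zero_mul]
    exact fun hmem => hl (hy (hmem.symm.trans hkY))
  · exact fun hmem => absurd (Finset.mem_range.2 (Nat.lt_succ_of_le hk)) hmem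

end UnramQuad

/-! ### Passage to the limit and the formula for `𝒥_n^n`. -/

/-- A polynomial in `(-q)^{-2r}` is determined by its values. -/
theorem IsPolyIn.unique {q : ℕ} (hq : 1 < q) {f : ℕ → ℂ} {P Q : Polynomial ℂ}
    (hP : IsPolyIn q f P) (hQ : IsPolyIn q f Q) : P = Q := by
  refine Polynomial.eq_of_infinite_eval_eq P Q
    (Set.infinite_of_injective_forall_mem (f := fun r : ℕ => (-(q : ℂ)) ^ (-(2 * (r : ℤ)))) ?_
      fun r => (hP r).symm.trans (hQ r))
  intro a b hab
  have hx : ∀ r : ℕ, (-(q : ℂ)) ^ (-(2 * (r : ℤ))) = ((q : ℂ) ^ (2 * r))⁻¹ := by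
    intro r
    rw [_root_.zpow_neg, _root_.zpow_mul, zpow_ofNat, neg_sq, zpow_natCast, pow_mul]
  simp only [hx] at hab
  have : q ^ (2 * a) = q ^ (2 * b) := by exact_mod_cast inv_injective hab
  have := Nat.pow_right_injective hq this
  omega

theorem IsPolyIn.derivAtOne_eq {q : ℕ} (hq : 1 < q) {f : ℕ → ℂ} {P : Polynomial ℂ}
    (hP : IsPolyIn q f P) : derivAtOne q f = -P.derivative.eval 1 := by
  have hf : ∃ P, IsPolyIn q f P := ⟨P, hP⟩
  rw [derivAtOne, dif_pos hf, hf.choose_spec.unique hq hP]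

theorem IsPolyIn.const_mul {q : ℕ} {f : ℕ → ℂ} {P : Polynomial ℂ} (hP : IsPolyIn q f P) (c : ℂ) :
    IsPolyIn q (fun r => c * f r) (Polynomial.C c * P) := fun r => by
  rw [Polynomial.eval_mul, Polynomial.eval_C, ← hP r]

theorem gramA_self_eq_blockB {F E : Type*} [NontriviallyNormedField F] [NontriviallyNormedField E]
    [NormedAlgebra F E] (π : F) (n : ℕ) : gramA E π n n = blockB π (1 : Matrix (Fin n) (Fin n) E) := by
  have : gramA E π n n = reindex finSumFinEquiv finSumFinEquiv
      (diagonal fun i : Fin n ⊕ Fin n => Sum.elim (fun _ => 1) (fun _ => (algebraMap F E π)⁻¹) i) := by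
    rw [reindex_apply, submatrix_diagonal_equiv, gramA]
    congr 1
    ext i
    obtain ⟨j, rfl⟩ := finSumFinEquiv.surjective i
    rw [Function.comp_apply, Equiv.symm_apply_apply]
    cases j with
    | inl j =>
      rw [finSumFinEquiv_apply_left, if_pos (by rw [Fin.val_castAdd]; omega)]
      rfl
    | inr j =>
      rw [finSumFinEquiv_apply_right, if_neg (by rw [Fin.val_natAdd]; omega)]
      rfl
  rw [this, blockB]
  congr 1
  rw [← diagonal_one, ← diagonal_smul, fromBlocks_diagonal]
  congr 1
  ext i
  cases i <;> simp

namespace UnramQuad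

variable {F E : Type*} [NontriviallyNormedField F] [NontriviallyNormedField E]
    [NormedAlgebra F E] [StarRing E] {π : F} (h : UnramQuad F E π) [IsUltrametricDist E]
    [IsUltrametricDist F] [ProperSpace F] [ProperSpace E] [MeasurableSpace E] [BorelSpace E]
    {ψ : AddChar F Circle} (μ : Measure E) [μ.IsAddHaarMeasure]
    (hψ : ∀ a : F, ‖a‖ ≤ 1 → ψ a = 1) (hψ' : ∃ a : F, ‖a‖ ≤ ‖π‖⁻¹ ∧ ψ a ≠ 1)
    (hμ : μ {x : E | ‖x‖ ≤ 1} = 1)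
    {n : ℕ} (ν : Measure (HermMat (Fin (n + n)) E)) [ν.IsAddHaarMeasure]
    (hν : ν {Y | EntryLe Y.1 1} = 1) {B₁ : Matrix (Fin n) (Fin n) E}
include h hμ

section

variable {N : Type*} [Fintype N] [DecidableEq N]

/-- The level `d` depends on `B` alone and not on the number of rows. Hence one level computes the
densities for all `r` at once, and polynomiality at a finite level passes to the limit. -/
theorem exists_dens_eq {B : Matrix N N E} (hB : B.IsHermitian) (hB' : IsUnit B.det) : ∃ d,
    ∀ (p : Type) [Fintype p] [DecidableEq p], Tendsto (densApprox π (1 : Matrix p p E) B) atTop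
      (𝓝 (densApprox π (1 : Matrix p p E) B d)) := by
  obtain ⟨c, hc⟩ := exists_entryLe_pow h.norm_pos h.norm_lt_one B⁻¹
  exact ⟨c + 1, fun p _ _ => h.densApprox_tendsto μ hμ hB hB' hc⟩

theorem tendsto_densApprox_one {B : Matrix N N E} (hB : B.IsHermitian) (hB' : IsUnit B.det)
    (p : Type) [Fintype p] [DecidableEq p] :
    Tendsto (densApprox π (1 : Matrix p p E) B) atTop (𝓝 (dens π (1 : Matrix p p E) B)) := by
  obtain ⟨d, hd⟩ := h.exists_dens_eq μ hμ hB hB'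
  exact tendsto_nhds_limUnder ⟨_, hd p⟩

theorem dens_one_one_ne_zero :
    dens π (1 : Matrix (Fin n) (Fin n) E) (1 : Matrix (Fin n) (Fin n) E) ≠ 0 := by
  obtain ⟨d, hd⟩ := h.exists_dens_eq μ hμ (isHermitian_one (n := Fin n) (α := E)) (by simp)
  rw [dens, (hd _).limUnder_eq]
  exact h.densApprox_one_ne_zero μ hμ d

include hψ hψ' in
theorem exists_isPolyIn_dens {B : Matrix N N E} (hB : B.IsHermitian) (hB' : IsUnit B.det)
    (p : Type) [Fintype p] [DecidableEq p] : ∃ P : Polynomial ℂ,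
      IsPolyIn (resCard F) (fun r => dens π (stab (1 : Matrix p p E) r) B) P := by
  obtain ⟨d, hd⟩ := h.exists_dens_eq μ hμ hB hB'
  obtain ⟨ν, _, hν⟩ := h.exists_haar_herm (E := E) N
  obtain ⟨P, hP⟩ := h.exists_isPolyIn_densApprox μ hμ hψ hψ' ν hν (m := p) hB d
  refine ⟨P, fun r => ?_⟩
  have hst : stab (1 : Matrix p p E) r = 1 := fromBlocks_one
  rw [← hP r]
  simp only [hst]
  exact (hd _).limUnder_eq

end

include hψ hψ' hν

theorem whitTrunc_tendsto (hB : B₁.IsHermitian) (hB' : IsUnit B₁.det) (r : ℕ) :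
    Tendsto (whitTrunc π ψ μ ν n n (blockB π B₁) r) atTop
      (𝓝 (((resCard F : ℂ) ^ (3 * n ^ 2))⁻¹ *
        dens π (1 : Matrix (Fin n) (Fin n) E) (1 : Matrix (Fin n) (Fin n) E) *
        dens π (stab (1 : Matrix (Fin n) (Fin n) E) r) B₁)) := by
  have hst : stab (1 : Matrix (Fin n) (Fin n) E) r = 1 := fromBlocks_one
  have h1 := h.tendsto_densApprox_one μ hμ hB hB' (Fin n ⊕ Fin (2 * r))
  have h2 := (h.tendsto_densApprox_one μ hμ (isHermitian_one (n := Fin n) (α := E)) (by simp)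
    (Fin n)).comp (tendsto_add_atTop_nat 1)
  rw [← hst] at h1
  rw [mul_right_comm]
  refine ((h1.const_mul ((resCard F : ℂ) ^ (3 * n ^ 2))⁻¹).mul h2).congr fun d => ?_
  rw [h.whitTrunc_blockB μ hψ hψ' hμ ν hν hB]
  rfl

theorem whitTrunc_blockB_eq_zero (hB : B₁.IsHermitian) {i : ℕ} (hi : i < n) (r d : ℕ) :
    whitTrunc π ψ μ ν n i (blockB π B₁) r d = 0 := by
  rw [h.whitTrunc_eq μ hψ hψ' hμ ν hν (h.blockB_isHermitian hB), h.suppSet_blockB_empty B₁ hi]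
  simp

/-- The values of the Whittaker integrals and of `𝒥_n^n` at `diag(B₁, π^{-1} 1_n)`. -/
theorem calJ_blockB (hB : B₁.IsHermitian) (hB' : IsUnit B₁.det) :
    (∀ r, Tendsto (whitTrunc π ψ μ ν n n (blockB π B₁) r) atTop
      (𝓝 (whit π ψ μ ν n n (blockB π B₁) r))) ∧
    (∃ P, IsPolyIn (resCard F) (whit π ψ μ ν n n (blockB π B₁)) P) ∧
    Tendsto (whitTrunc π ψ μ ν n n (gramA E π n n) 0) atTop
      (𝓝 (whit π ψ μ ν n n (gramA E π n n) 0)) ∧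
    whit π ψ μ ν n n (gramA E π n n) 0 ≠ 0 ∧
    (∀ r, Tendsto (densApprox π (stab (1 : Matrix (Fin n) (Fin n) E) r) B₁) atTop
      (𝓝 (dens π (stab (1 : Matrix (Fin n) (Fin n) E) r) B₁))) ∧
    (∃ P, IsPolyIn (resCard F) (fun r => dens π (stab (1 : Matrix (Fin n) (Fin n) E) r) B₁) P) ∧
    Tendsto (densApprox π (1 : Matrix (Fin n) (Fin n) E) (1 : Matrix (Fin n) (Fin n) E)) atTop
      (𝓝 (dens π (1 : Matrix (Fin n) (Fin n) E) (1 : Matrix (Fin n) (Fin n) E))) ∧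
    dens π (1 : Matrix (Fin n) (Fin n) E) (1 : Matrix (Fin n) (Fin n) E) ≠ 0 ∧
    (∀ i < n, Tendsto (whitTrunc π ψ μ ν n i (blockB π B₁) 0) atTop (𝓝 0) ∧
      whit π ψ μ ν n i (blockB π B₁) 0 = 0) ∧
    calJ π ψ μ ν n (blockB π B₁) =
      dens' π (1 : Matrix (Fin n) (Fin n) E) B₁ /
        dens π (1 : Matrix (Fin n) (Fin n) E) (1 : Matrix (Fin n) (Fin n) E) := by
  have hst : ∀ r, stab (1 : Matrix (Fin n) (Fin n) E) r = 1 := fun r => fromBlocks_one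
  have hq := h.unif.one_lt_resCard
  have hq0 : (resCard F : ℂ) ≠ 0 := Nat.cast_ne_zero.2 (zero_lt_one.trans hq).ne'
  have h11 := h.dens_one_one_ne_zero μ hμ (n := n)
  have h1H : (1 : Matrix (Fin n) (Fin n) E).IsHermitian := isHermitian_one
  have h1U : IsUnit (1 : Matrix (Fin n) (Fin n) E).det := by simp
  have hT1 := h.tendsto_densApprox_one μ hμ h1H h1U (Fin n)
  have hW := h.whitTrunc_tendsto μ hψ hψ' hμ ν hν hB hB'
  have hA := h.whitTrunc_tendsto μ hψ hψ' hμ ν hν h1H h1U 0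
  have hWe : ∀ r, whit π ψ μ ν n n (blockB π B₁) r = _ := fun r => (hW r).limUnder_eq
  have hAe : whit π ψ μ ν n n (blockB π 1) 0 = _ := hA.limUnder_eq
  -- For `r = 0` the rows are indexed by `Fin n ⊕ Fin 0` instead of `Fin n`; the Fourier expansion
  -- depends only on the number of rows.
  have hA0 : dens π (stab (1 : Matrix (Fin n) (Fin n) E) 0) (1 : Matrix (Fin n) (Fin n) E) =
      dens π (1 : Matrix (Fin n) (Fin n) E) (1 : Matrix (Fin n) (Fin n) E) := by
    obtain ⟨ν', _, hν'⟩ := h.exists_haar_herm (E := E) (Fin n)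
    rw [hst, dens, dens]
    congr 1
    ext d
    rw [h.densApprox_eq_integral μ hμ hψ hψ' ν' hν' h1H,
      h.densApprox_eq_integral μ hμ hψ hψ' ν' hν' h1H, Fintype.card_sum, Fintype.card_fin,
      Fintype.card_fin, mul_zero, add_zero]
  obtain ⟨P, hP⟩ := h.exists_isPolyIn_dens μ hψ hψ' hμ hB hB' (Fin n)
  set C : ℂ := ((resCard F : ℂ) ^ (3 * n ^ 2))⁻¹ *
    dens π (1 : Matrix (Fin n) (Fin n) E) (1 : Matrix (Fin n) (Fin n) E) with hC
  have hC0 : C ≠ 0 := mul_ne_zero (inv_ne_zero (pow_ne_zero _ hq0)) h11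
  have hWP : IsPolyIn (resCard F) (whit π ψ μ ν n n (blockB π B₁)) (Polynomial.C C * P) := fun r =>
    (hWe r).trans (hP.const_mul C r)
  have h0 : ∀ i < n, Tendsto (whitTrunc π ψ μ ν n i (blockB π B₁) 0) atTop (𝓝 0) := fun i hi =>
    tendsto_const_nhds.congr fun d =>
      (h.whitTrunc_blockB_eq_zero μ hψ hψ' hμ ν hν hB hi 0 d).symm
  rw [hA0] at hA hAe
  refine ⟨fun r => ?_, ⟨_, hWP⟩, ?_, ?_, fun r => ?_, ⟨P, hP⟩, hT1, h11,
    fun i hi => ⟨h0 i hi, (h0 i hi).limUnder_eq⟩, ?_⟩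
  · rw [hWe]
    exact hW r
  · rw [gramA_self_eq_blockB, hAe]
    exact hA
  · rw [gramA_self_eq_blockB, hAe]
    exact mul_ne_zero hC0 h11
  · rw [hst]
    exact h.tendsto_densApprox_one μ hμ hB hB' _
  -- Every summand contains a vanishing Whittaker value, so nothing about the constants `β` is
  -- needed. The factor `C` then cancels between `W'_{n,n}(B, 0)` and `W_{n,n}(A_n, 0) = C α(1_n,
  -- 1_n)`.
  · have hsum : ∑ i : Fin n, corrBeta π ψ μ ν n i * whit π ψ μ ν n i (blockB π B₁) 0 = 0 :=
      Finset.sum_eq_zero fun i _ => by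
        rw [show whit π ψ μ ν n i (blockB π B₁) 0 = 0 from (h0 i i.2).limUnder_eq, mul_zero]
    rw [calJ, hsum, sub_zero, gramA_self_eq_blockB, hAe, whit', hWP.derivAtOne_eq hq, dens',
      hP.derivAtOne_eq hq, Polynomial.derivative_C_mul, Polynomial.eval_mul, Polynomial.eval_C]
    field_simp

end UnramQuad

/-! ### Verification of the properties in `UnramQuad`, and the theorem. -/

theorem norm_two_eq_one {p : ℕ} [hpp : Fact p.Prime] (hp : 2 < p) {F : Type*} [NormedField F]
    [IsUltrametricDist F] (hF : ‖(p : F)‖ < 1) : ‖(2 : F)‖ = 1 := by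
  have h2 : ‖(2 : F)‖ ≤ 1 := by exact_mod_cast IsUltrametricDist.norm_natCast_le_one F 2
  refine le_antisymm h2 (not_lt.1 fun hlt => ?_)
  obtain ⟨k, hk⟩ := hpp.out.odd_of_ne_two hp.ne'
  have h1 : (1 : F) = p - 2 * k := by
    rw [hk]
    push_cast
    ring
  have hk1 : ‖(2 : F) * k‖ < 1 := by
    rw [norm_mul]
    exact (mul_le_of_le_one_right (norm_nonneg _)
      (IsUltrametricDist.norm_natCast_le_one F k)).trans_lt hlt
  have := (IsUltrametricDist.norm_add_le_max (p : F) (-(2 * k))).trans_lt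
    (max_lt hF (by rwa [norm_neg]))
  rw [← sub_eq_add_neg, ← h1, norm_one] at this
  exact lt_irrefl _ this

/-- A bounded multiplicative involution of a normed field is isometric. -/
theorem norm_star_eq_of_bound {E : Type*} [NormedField E] [StarRing E] {C : ℝ}
    (hC : ∀ z : E, ‖star z‖ ≤ C * ‖z‖) (z : E) : ‖star z‖ = ‖z‖ := by
  have key : ∀ z : E, ‖star z‖ ≤ ‖z‖ := by
    intro z
    by_contra! hlt
    have hz : 0 < ‖z‖ := norm_pos_iff.2 fun h0 => by simp [h0] at hlt
    obtain ⟨k, hk⟩ := pow_unbounded_of_one_lt C ((one_lt_div hz).2 hlt)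
    have := hC (z ^ k)
    rw [star_pow, norm_pow, norm_pow] at this
    rw [div_pow, lt_div_iff₀ (pow_pos hz k)] at hk
    exact absurd this (not_le.2 hk)
  exact le_antisymm (key z) (by simpa using key (star z))

/-- The involution is `F`-linear, hence bounded, hence isometric. Its fixed subalgebra is proper and
the degree is prime, so the fixed subalgebra is `F`. The trace formula follows by taking the trace
of `z + z*`, an element of `F`. The unit `w` is `z - z*` divided by a power of `π`, which is
possible because `π` remains a uniformizer in `E`. -/
theorem unramQuad_of_finrank_eq_two {F E : Type*} [NontriviallyNormedField F] [ProperSpace F]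
    [NontriviallyNormedField E] [NormedAlgebra F E] [StarRing E] {π : F} (hπ : IsUniformizer π)
    (hE : IsUniformizer (algebraMap F E π)) (h2 : ‖(2 : F)‖ = 1) (hEF : Module.finrank F E = 2)
    (hstarF : ∀ a : F, star (algebraMap F E a) = algebraMap F E a) (hstar : ∃ z : E, star z ≠ z) :
    UnramQuad F E π := by
  have hFD : FiniteDimensional F E := Module.finite_of_finrank_eq_succ hEF
  let σ : E ≃ₐ[F] E := AlgEquiv.ofRingEquiv (f := starRingAut) hstarF
  have hσ : ∀ z, σ z = star z := fun _ => rfl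
  have hnorm : ∀ z : E, ‖star z‖ = ‖z‖ := by
    let L : E →L[F] E := ⟨σ.toLinearMap, LinearMap.continuous_of_finiteDimensional _⟩
    exact norm_star_eq_of_bound (C := ‖L‖) fun z => L.le_opNorm z
  have hfix : ∀ z : E, star z = z → ∃ a : F, algebraMap F E a = z := by
    let S : Subalgebra F E := AlgHom.equalizer (σ : E →ₐ[F] E) (AlgHom.id F E)
    have : IsSimpleOrder (Subalgebra F E) :=
      Subalgebra.isSimpleOrder_of_finrank_prime F E (by rw [hEF]; exact Nat.prime_two)
    have hS : S = ⊥ := by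
      refine (eq_bot_or_eq_top S).resolve_right fun htop => ?_
      obtain ⟨z, hz⟩ := hstar
      have : z ∈ S := htop ▸ Algebra.mem_top
      exact hz this
    intro z hz
    have : z ∈ S := hz
    rw [hS] at this
    exact Algebra.mem_bot.1 this
  have h20 : (2 : F) ≠ 0 := norm_pos_iff.1 (by rw [h2]; exact one_pos)
  refine ⟨hπ, hE, hnorm, hstarF, hfix, h2, fun z => ?_, ?_⟩
  · obtain ⟨a, ha⟩ := hfix (z + star z) (by rw [star_add, star_star, add_comm])
    have h1 : Algebra.trace F E (star z) = Algebra.trace F E z :=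
      Algebra.trace_eq_of_algEquiv σ z
    have h3 := Algebra.trace_algebraMap (S := E) a
    rw [ha, map_add, h1, hEF, ← two_mul, nsmul_eq_mul, Nat.cast_ofNat] at h3
    rw [mul_left_cancel₀ h20 h3, ha]
  · obtain ⟨z, hz⟩ := hstar
    have hu : z - star z ≠ 0 := sub_ne_zero.2 (Ne.symm hz)
    obtain ⟨d, hd⟩ := hE.exists_norm_eq_zpow hu
    refine ⟨(z - star z) / algebraMap F E π ^ d, ?_, ?_⟩
    · rw [norm_div, norm_zpow, hd, div_self]
      exact zpow_ne_zero _ (norm_ne_zero_iff.2 hE.1)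
    · rw [star_div₀, star_zpow₀, hstarF, star_sub, star_star, ← neg_div, neg_sub]

end HermitianDensity

theorem theorem3p16
    -- `F / ℚ_p` is a finite unramified extension, `p > 2`
    (p : ℕ) [Fact p.Prime] (hp : 2 < p)
    (F : Type*) [NontriviallyNormedField F] [IsUltrametricDist F]
    [NormedAlgebra ℚ_[p] F] [FiniteDimensional ℚ_[p] F] (hF : IsUniformizer (p : F))
    -- a uniformizer of `F`
    (π : F) (hπ : IsUniformizer π)
    -- `E / F` is an unramified quadratic extension, `star` is its nontrivial automorphism
    (E : Type*) [NontriviallyNormedField E] [IsUltrametricDist E]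
    [NormedAlgebra F E] (hEF : Module.finrank F E = 2)
    (hE : IsUniformizer (algebraMap F E π))
    [StarRing E] (hstarF : ∀ a : F, star (algebraMap F E a) = algebraMap F E a)
    (hstar : ∃ z : E, star z ≠ z)
    -- an additive character of `F` with conductor `O_F`
    (ψ : AddChar F Circle) (hψ : ∀ a : F, ‖a‖ ≤ 1 → ψ a = 1)
    (hψ' : ∃ a : F, ‖a‖ ≤ ‖π‖⁻¹ ∧ ψ a ≠ 1)
    (n : ℕ)
    -- the Haar measures on `E` and on `V_{2n}(E)` which give the integral points volume 1
    [MeasurableSpace E] [BorelSpace E] (μ : Measure E) [μ.IsAddHaarMeasure]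
    (hμ : μ {x : E | ‖x‖ ≤ 1} = 1)
    (ν : Measure (HermMat (Fin (n + n)) E)) [ν.IsAddHaarMeasure]
    (hν : ν {Y | ∀ i j, ‖Y.1 i j‖ ≤ 1} = 1)
    -- `B₁ ∈ X_n(E)`
    (B₁ : Matrix (Fin n) (Fin n) E) (hB₁ : B₁.IsHermitian) (hB₁' : IsUnit B₁.det) :
    -- the quantities in the formula are well defined
    (∀ r, Tendsto (whitTrunc π ψ μ ν n n (blockB π B₁) r) atTop
      (𝓝 (whit π ψ μ ν n n (blockB π B₁) r))) ∧
    (∃ P, IsPolyIn (resCard F) (whit π ψ μ ν n n (blockB π B₁)) P) ∧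
    Tendsto (whitTrunc π ψ μ ν n n (gramA E π n n) 0) atTop
      (𝓝 (whit π ψ μ ν n n (gramA E π n n) 0)) ∧
    whit π ψ μ ν n n (gramA E π n n) 0 ≠ 0 ∧
    (∀ r, Tendsto (densApprox π (stab (1 : Matrix (Fin n) (Fin n) E) r) B₁) atTop
      (𝓝 (dens π (stab (1 : Matrix (Fin n) (Fin n) E) r) B₁))) ∧
    (∃ P, IsPolyIn (resCard F) (fun r => dens π (stab (1 : Matrix (Fin n) (Fin n) E) r) B₁) P) ∧
    Tendsto (densApprox π (1 : Matrix (Fin n) (Fin n) E) (1 : Matrix (Fin n) (Fin n) E)) atTop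
      (𝓝 (dens π (1 : Matrix (Fin n) (Fin n) E) (1 : Matrix (Fin n) (Fin n) E))) ∧
    dens π (1 : Matrix (Fin n) (Fin n) E) (1 : Matrix (Fin n) (Fin n) E) ≠ 0 ∧
    -- `W_{n,i}(B, 0) = 0` for `i < n`
    (∀ i < n, Tendsto (whitTrunc π ψ μ ν n i (blockB π B₁) 0) atTop (𝓝 0) ∧
      whit π ψ μ ν n i (blockB π B₁) 0 = 0) ∧
    -- the formula for `𝒥_n^n(B)`
    calJ π ψ μ ν n (blockB π B₁) =
      dens' π (1 : Matrix (Fin n) (Fin n) E) B₁ /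
        dens π (1 : Matrix (Fin n) (Fin n) E) (1 : Matrix (Fin n) (Fin n) E) := by
  have : Fact (1 < 2) := ⟨one_lt_two⟩
  have hFp : ProperSpace F := FiniteDimensional.proper ℚ_[p] F
  have hFD : FiniteDimensional F E := Module.finite_of_finrank_eq_succ hEF
  have hEp : ProperSpace E := FiniteDimensional.proper F E
  exact (unramQuad_of_finrank_eq_two hπ hE (norm_two_eq_one hp hF.2.1) hEF hstarF hstar).calJ_blockB
    μ hψ hψ' hμ ν hν hB₁ hB₁'
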